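/- Let $\mathbb{D}$ be the open unit disc and let $\omega:[0,1)\to(0,\infty)$ be continuous and integrable; write $\widehat\omega(r)=\int_r^1\omega(s)\,ds$. Let $1<p,q<\infty$, $1/p+1/p'=1$, $0\le\eta<1/p$. Assume that $\omega$ is regular, that is, there are constants $0<c\le C<\infty$ with $$c(1-r)\le \frac{\widehat\omega(r)}{\omega(r)}\le C(1-r),\qquad 0\le r<1,$$ and that $\omega$ satisfies the Muckenhoupt type condition $$\sup_{0\le r<1}\Big(\int_r^1\widehat\omega(t)^{-p'/p}\,dt\Big)^{p/p'}\int_0^r(1-t)^{-p}\,\widehat\omega(t)\,dt<\infty .$$ For $f$ analytic in $\mathbb{D}$ put $M_q(r,f)=\big(\frac1{2\pi}\int_0^{2\pi}|f(re^{i\theta})|^q\,d\theta\big)^{1/q}$; the Hardy space $H^q$ consists of the analytic $f$ with $\lim_{r\to1^-}M_q(r,f)<\infty$. For $g$ analytic in $\mathbb{D}$ put $$\|g\|_{\Lambda}=|g(0)|+\sup_{0<r<1}\frac{M_q(r,g')(1-r)^{1-1/p}}{\widehat\omega(r)^{\eta}} ,$$ say that $g\in\Lambda(q,\frac1p,\widehat\omega^\eta)$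 if $\|g\|_\Lambda<\infty$, and that $g\in\lambda(q,\frac1p,\widehat\omega^\eta)$ if $$\lim_{r\to1^-}M_q(r,g')(1-r)^{1-1/p}\,\widehat\omega(r)^{-\eta}=0.$$ For $g\in H^q$ let $g(e^{i\theta})$ denote its nontangential limit at $e^{i\theta}$ (which exists for almost every $\theta$), and put $$\Omega_q(g,t)=\sup_{0<h\le t}\Big(\frac1{2\pi}\int_0^{2\pi}|g(e^{i(\theta+h)})-g(e^{i\theta})|^q\,d\theta\Big)^{1/q}.$$ Then for every analytic function $g$ in $\mathbb{D}$: (i) $g\in\Lambda(q,\frac1p,\widehat\omega^\eta)$ if and only if $g\in H^q$ and $\Omega_q(g,t)=O\big(t^{1/p}\,\widehat\omega(1-t)^{\eta}\big)$ as $t\to0^+$. Moreover, there is a constant $C>0$ depending only on $p,q,\eta,\omega$ such that for all $g\in H^q$ (both quantities being possibly infinite) $$C^{-1}\|g\|_\Lambda\le |g(0)|+\sup_{0<t<1}\frac{\Omega_q(g,t)}{t^{1/p}\,\widehat\omega(1-t)^{\eta}}\le C\,\|g\|_\Lambda .$$ (ii) $g\in\lambda(q,\frac1p,\widehat\omega^\eta)$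 if and only if $g\in H^q$ and $\Omega_q(g,t)=o\big(t^{1/p}\,\widehat\omega(1-t)^{\eta}\big)$ as $t\to0^+$. -/

import Mathlib

open Set Filter Topology MeasureTheory
open scoped ENNReal

noncomputable section

/-- `IsRadialWeight ω`: `ω` is the radial profile `[0,1) → (0,∞)` of a radial weight of the unit
disc, i.e. it is positive and integrable (values outside `[0,1)` are irrelevant). -/
structure IsRadialWeight (ω : ℝ → ℝ) : Prop where
  pos : ∀ r ∈ Ico (0 : ℝ) 1, 0 < ω r
  integrable : IntegrableOn ω (Ico (0 : ℝ) 1)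

/-- The tail integral `ω̂(r) = ∫_r^1 ω(s) ds`. -/
def tailIntegral (ω : ℝ → ℝ) (r : ℝ) : ℝ := ∫ s in r..1, ω s

/-- The distortion function `ψ_ω(r) = ω̂(r) / ω(r)`. -/
def distortion (ω : ℝ → ℝ) (r : ℝ) : ℝ := (1 / ω r) * tailIntegral ω r

/-- The class of regular weights: continuous radial weights with `ψ_ω(r) ≍ 1 - r` on `[0,1)`. -/
structure IsRegularWeight (ω : ℝ → ℝ) : Prop where
  radialWeight : IsRadialWeight ω
  continuousOn : ContinuousOn ω (Ico (0 : ℝ) 1)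
  distortion_asymp : ∃ c C : ℝ, 0 < c ∧ 0 < C ∧
    ∀ r ∈ Ico (0 : ℝ) 1, c * (1 - r) ≤ distortion ω r ∧ distortion ω r ≤ C * (1 - r)

/-- The Muckenhoupt type condition
`sup_{0≤r<1} (∫_r^1 ω̂(t)^{-p'/p} dt)^{p/p'} ∫_0^r (1-t)^{-p} ω̂(t) dt < ∞`, `1/p + 1/p' = 1`. -/
def MuckenhouptCondition (p : ℝ) (ω : ℝ → ℝ) : Prop :=
  (⨆ r ∈ Ico (0 : ℝ) 1,
    (∫⁻ t in Ioo r 1, ENNReal.ofReal (tailIntegral ω t) ^ (-(p.conjExponent / p))) ^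
        (p / p.conjExponent) *
      ∫⁻ t in Ioo 0 r, ENNReal.ofReal ((1 - t) ^ (-p) * tailIntegral ω t)) < ∞

/-- The normalized `L^p` mean over `[0, 2π]`: `((1/2π) ∫_0^{2π} |F(θ)|^p dθ)^{1/p}`. -/
def circleMean (p : ℝ) (F : ℝ → ℂ) : ℝ≥0∞ :=
  ((∫⁻ θ in Ioc (0 : ℝ) (2 * Real.pi), ‖F θ‖ₑ ^ p) / ENNReal.ofReal (2 * Real.pi)) ^ (1 / p)

/-- The integral mean `M_p(r, f)`. -/
def integralMean (p r : ℝ) (f : ℂ → ℂ) : ℝ≥0∞ :=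
  circleMean p fun θ => f (r * Complex.exp (θ * Complex.I))

/-- Analytic functions in the open unit disc. -/
def AnalyticInDisc (f : ℂ → ℂ) : Prop := DifferentiableOn ℂ f (Metric.ball 0 1)

/-- The Hardy space `H^p`: `f` is analytic in the disc and `lim_{r → 1⁻} M_p(r, f) < ∞`. -/
def MemHardy (p : ℝ) (f : ℂ → ℂ) : Prop :=
  AnalyticInDisc f ∧
    ∃ L : ℝ≥0∞, L < ∞ ∧ Tendsto (fun r : ℝ => integralMean p r f) (𝓝[<] 1) (𝓝 L)

/-- The quantity `M_p(r, g') (1-r)^{1-α} / ω̂(r)^β`. -/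
def lambdaQuotient (p α : ℝ) (ω : ℝ → ℝ) (β : ℝ) (g : ℂ → ℂ) (r : ℝ) : ℝ≥0∞ :=
  integralMean p r (deriv g) * ENNReal.ofReal ((1 - r) ^ (1 - α)) /
    ENNReal.ofReal (tailIntegral ω r ^ β)

/-- The norm `‖g‖_{Λ(p,α,ω̂^β)} = sup_{0<r<1} M_p(r,g')(1-r)^{1-α}/ω̂(r)^β + |g(0)|`. -/
def lambdaNorm (p α : ℝ) (ω : ℝ → ℝ) (β : ℝ) (g : ℂ → ℂ) : ℝ≥0∞ :=
  (⨆ r ∈ Ioo (0 : ℝ) 1, lambdaQuotient p α ω β g r) + ‖g 0‖ₑ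

/-- The space `Λ(p, α, ω̂^β)`. -/
def MemLambda (p α : ℝ) (ω : ℝ → ℝ) (β : ℝ) (g : ℂ → ℂ) : Prop :=
  AnalyticInDisc g ∧ lambdaNorm p α ω β g < ∞

/-- The space `λ(p, α, ω̂^β)`. -/
def MemLittleLambda (p α : ℝ) (ω : ℝ → ℝ) (β : ℝ) (g : ℂ → ℂ) : Prop :=
  AnalyticInDisc g ∧ Tendsto (lambdaQuotient p α ω β g) (𝓝[<] 1) (𝓝 0)

/-- The Stolz (nontangential approach) region in the unit disc with vertex `ζ` and aperture `M`. -/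
def stolzRegion (M : ℝ) (ζ : ℂ) : Set ℂ := {z | ‖z‖ < 1 ∧ ‖ζ - z‖ < M * (1 - ‖z‖)}

/-- `f` has nontangential limit `L` at the point `ζ` of the unit circle. -/
def HasNontangentialLimit (f : ℂ → ℂ) (ζ L : ℂ) : Prop :=
  ∀ M : ℝ, 1 < M → Tendsto f (𝓝[stolzRegion M ζ] ζ) (𝓝 L)

open Classical in
/-- The boundary value `f(ζ)`: the nontangential limit of `f` at `ζ`, set to `0` at points where
there is none. For `f` in a Hardy space these points form a null set of the circle. -/
def boundaryValue (f : ℂ → ℂ) (ζ : ℂ) : ℂ :=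
  if h : ∃ L, HasNontangentialLimit f ζ L then h.choose else 0

/-- The integral modulus of continuity of order `q` of the boundary function,
`sup_{0<h≤t} ((1/2π) ∫_0^{2π} |g(e^{i(θ+h)}) - g(e^{iθ})|^q dθ)^{1/q}`. -/
def boundaryModulus (q : ℝ) (g : ℂ → ℂ) (t : ℝ) : ℝ≥0∞ :=
  ⨆ h ∈ Ioc (0 : ℝ) t, circleMean q fun θ =>
    boundaryValue g (Complex.exp (((θ + h : ℝ) : ℂ) * Complex.I)) -
      boundaryValue g (Complex.exp ((θ : ℂ) * Complex.I))

/-- The gauge `t^α ω̂(1-t)^β`, positive for `0 < t < 1` if `ω` is a radial weight. -/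
def lipGauge (α : ℝ) (ω : ℝ → ℝ) (β t : ℝ) : ℝ := t ^ α * tailIntegral ω (1 - t) ^ β

/-- The quotient of the modulus of continuity of order `q` by `t^α ω̂(1-t)^β`. -/
def modulusQuotient (q α : ℝ) (ω : ℝ → ℝ) (β : ℝ) (g : ℂ → ℂ) (t : ℝ) : ℝ≥0∞ :=
  boundaryModulus q g t / ENNReal.ofReal (lipGauge α ω β t)

end

/-! Write κ(t) = t^{1/p} ω̂(1-t)^η for `lipGauge (1 / p) ω η t` and δ = 1-r. The condition on g'
then reads M_q(r,g') ≲ κ(δ)/δ, and the theorem is a Hardy–Littlewood theorem for the gauge κ. It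
rests on two integral conditions, one for each direction.

From g' to the modulus: a shift by h on the unit circle is replaced by a path that descends to
radius 1-h, rotates by h and climbs back. Minkowski's inequality bounds the radial pieces by
∫_{1-h}^1 M_q(u,g') du and the arc by h M_q(1-h,g'). What is needed is ∫_0^h κ(s)/s ds ≲ κ(h), which
holds because ω̂(1-s) increases with s and s^{1/p-1} is integrable
(`IsRadialWeight.lintegral_lipGauge_div_le`).

From the modulus to g': Cauchy's formula writes g' as an integral of the boundary function against a
kernel of size min(δ^{-2}, t^{-2}) that annihilates constants, so differences of boundary values may
be inserted (`IsBoundaryFunction.enorm_deriv_le`). What is needed is ∫_δ^1 κ(s)/s² ds ≲ κ(δ)/δ. This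
follows from the Muckenhoupt condition by Hölder's inequality, and η < 1/p is exactly what makes the
power factor integrable at infinity (`MuckenhouptCondition.exists_lintegral_lipGauge_le`). Shifts
bounded away from 0 contribute a bounded amount, absorbed because κ(δ)/δ is at least a constant
times a negative power of δ (`MuckenhouptCondition.exists_le_lipGauge`). Since κ(δ)/δ → ∞, the same
argument gives the little-o statement.

Both directions need boundary values. These come from Fatou's theorem for H^q
(`exists_isBoundaryFunction`): a primitive G of g is bounded, its radial boundary function F exists
everywhere and has bounded variation on each period, hence is differentiable almost everywhere, and
at such points G' = g has a nontangential limit. Vitali's theorem adds L¹ convergence of the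
dilates, which carries Cauchy's formula to the boundary. -/

/-! ### Minkowski's integral inequality and means over the circle. -/

/-- Duality proof of Minkowski's inequality: split A^q = A·A^{q-1}, exchange the integrals, apply
Hölder for each t and divide by the common factor. -/
theorem lintegral_Lp_lintegral_le {α β : Type*} [MeasurableSpace α] [MeasurableSpace β]
    {μ : Measure α} [IsFiniteMeasure μ] {ν : Measure β} [SFinite ν] {q : ℝ} (hq : 1 < q)
    {f : α → β → ℝ≥0∞} (hf : Measurable (Function.uncurry f)) :
    (∫⁻ x, (∫⁻ t, f x t ∂ν) ^ q ∂μ) ^ (1 / q) ≤ ∫⁻ t, (∫⁻ x, f x t ^ q ∂μ) ^ (1 / q) ∂ν := by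
  have hq0 : 0 < q := by linarith
  have hqc := Real.HolderConjugate.conjExponent hq
  set R := ∫⁻ t, (∫⁻ x, f x t ^ q ∂μ) ^ (1 / q) ∂ν with hR
  set A : α → ℝ≥0∞ := fun x => ∫⁻ t, f x t ∂ν with hA
  have hAm : Measurable A := Measurable.lintegral_prod_right' hf
  have hAn : ∀ n : ℕ, Measurable fun x => min (A x) n := fun n => hAm.min measurable_const
  -- The division requires a finite integral, so A is truncated at n; finiteness of μ suffices for
  -- that, and monotone convergence removes the truncation.
  have key : ∀ n : ℕ, ∫⁻ x, (min (A x) n) ^ q ∂μ ≤ R ^ q := by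
    intro n
    set I := ∫⁻ x, (min (A x) n) ^ q ∂μ with hI
    have hIfin : I ≠ ∞ := by
      refine ne_of_lt (lt_of_le_of_lt (lintegral_mono (g := fun _ => (n : ℝ≥0∞) ^ q) fun x => ?_) ?_)
      · exact ENNReal.rpow_le_rpow (min_le_right _ _) hq0.le
      · rw [lintegral_const]
        exact ENNReal.mul_lt_top (ENNReal.rpow_lt_top_of_nonneg hq0.le (by simp))
          (measure_lt_top _ _)
    have h1 : I ≤ ∫⁻ x, ∫⁻ t, f x t * (min (A x) n) ^ (q - 1) ∂ν ∂μ := by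
      refine lintegral_mono fun x => ?_
      rw [lintegral_mul_const (f := fun t => f x t) _ (hf.comp measurable_prodMk_left)]
      calc (min (A x) n) ^ q = (min (A x) n) ^ (1 + (q - 1)) := by ring_nf
        _ = min (A x) n * (min (A x) n) ^ (q - 1) := by
          rw [ENNReal.rpow_add_of_nonneg _ _ (by norm_num) (by linarith), ENNReal.rpow_one]
        _ ≤ _ := by gcongr; exact min_le_left _ _
    have h2 : ∫⁻ x, ∫⁻ t, f x t * (min (A x) n) ^ (q - 1) ∂ν ∂μ ≤
        R * I ^ (1 / q.conjExponent) := by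
      rw [lintegral_lintegral_swap, hR, ← lintegral_mul_const]
      · refine lintegral_mono fun t => ?_
        refine (ENNReal.lintegral_mul_le_Lp_mul_Lq μ hqc (f := fun x => f x t)
          (g := fun x => (min (A x) n) ^ (q - 1))
          (hf.comp measurable_prodMk_right).aemeasurable ((hAn n).pow_const _).aemeasurable).trans_eq ?_
        congr 2
        refine lintegral_congr fun x => ?_
        rw [← ENNReal.rpow_mul]
        congr 1
        have : q - 1 ≠ 0 := by linarith
        rw [Real.conjExponent]; field_simp
      · exact Measurable.pow_const (Measurable.lintegral_prod_left' (hf.pow_const q)) _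
      · exact (hf.mul (((hAn n).pow_const (q - 1)).comp measurable_fst)).aemeasurable
    have h3 := h1.trans h2
    rcases eq_or_ne I 0 with h0 | h0
    · rw [h0]; exact zero_le
    have h4 : I ^ (1 / q) ≤ R := by
      have hne : I ^ (1 / q.conjExponent) ≠ 0 := by simp [ENNReal.rpow_eq_zero_iff, h0, hIfin]
      have hnt : I ^ (1 / q.conjExponent) ≠ ∞ :=
        (ENNReal.rpow_lt_top_of_nonneg (by have := hqc.symm.pos; positivity) hIfin).ne
      rw [← ENNReal.mul_le_mul_iff_left hne hnt, ← ENNReal.rpow_add _ _ h0 hIfin]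
      rwa [one_div, one_div, hqc.inv_add_inv_eq_one, ENNReal.rpow_one, ← one_div]
    calc I = (I ^ (1 / q)) ^ q := by
          rw [← ENNReal.rpow_mul, one_div_mul_cancel hq0.ne', ENNReal.rpow_one]
      _ ≤ R ^ q := ENNReal.rpow_le_rpow h4 hq0.le
  have hsup : ∀ x, A x ^ q = ⨆ n : ℕ, (min (A x) n) ^ q := by
    intro x
    have hmono : Monotone fun n : ℕ => (min (A x) n) ^ q := fun a b hab =>
      ENNReal.rpow_le_rpow (min_le_min_left _ (by exact_mod_cast hab)) hq0.le
    refine tendsto_nhds_unique ?_ (tendsto_atTop_iSup hmono)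
    have : Tendsto (fun n : ℕ => min (A x) (n : ℝ≥0∞)) atTop (𝓝 (min (A x) ∞)) :=
      tendsto_const_nhds.min ENNReal.tendsto_nat_nhds_top
    rw [min_eq_left le_top] at this
    exact (ENNReal.continuous_rpow_const.tendsto _).comp this
  have hle : ∫⁻ x, A x ^ q ∂μ ≤ R ^ q := by
    simp_rw [hsup]
    rw [lintegral_iSup (fun n => (hAn n).pow_const q)]
    · exact iSup_le key
    · exact fun a b hab x =>
        ENNReal.rpow_le_rpow (min_le_min_left _ (by exact_mod_cast hab)) hq0.le
  calc _ ≤ (R ^ q) ^ (1 / q) := ENNReal.rpow_le_rpow hle (by positivity)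
    _ = R := by rw [← ENNReal.rpow_mul, mul_one_div_cancel hq0.ne', ENNReal.rpow_one]

noncomputable section

/-- The normalized Lebesgue measure on the period `(0, 2π]`. -/
def circleMeasure : Measure ℝ :=
  (ENNReal.ofReal (2 * Real.pi))⁻¹ • volume.restrict (Ioc (0 : ℝ) (2 * Real.pi))

theorem ofReal_two_pi_ne_zero : ENNReal.ofReal (2 * Real.pi) ≠ 0 := by
  simp [Real.pi_pos]

instance : IsProbabilityMeasure circleMeasure := by
  constructor
  simp only [circleMeasure, Measure.smul_apply, Measure.restrict_apply_univ, Real.volume_Ioc,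
    sub_zero, smul_eq_mul]
  exact ENNReal.inv_mul_cancel ofReal_two_pi_ne_zero ENNReal.ofReal_ne_top

theorem lintegral_circleMeasure (f : ℝ → ℝ≥0∞) :
    ∫⁻ θ, f θ ∂circleMeasure =
      (ENNReal.ofReal (2 * Real.pi))⁻¹ * ∫⁻ θ in Ioc (0 : ℝ) (2 * Real.pi), f θ := by
  rw [circleMeasure, lintegral_smul_measure, smul_eq_mul]

theorem circleMeasure_absolutelyContinuous : circleMeasure ≪ (volume : Measure ℝ) :=
  (Measure.absolutelyContinuous_of_le Measure.restrict_le_self).smul_left _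

theorem circleMean_eq (q : ℝ) (F : ℝ → ℂ) :
    circleMean q F = (∫⁻ θ, ‖F θ‖ₑ ^ q ∂circleMeasure) ^ (1 / q) := by
  rw [circleMean, lintegral_circleMeasure, ENNReal.div_eq_inv_mul]

theorem circleMean_eq_eLpNorm' (q : ℝ) (F : ℝ → ℂ) :
    circleMean q F = eLpNorm' F q circleMeasure := by
  rw [circleMean_eq, eLpNorm']

theorem circleMean_congr_ae {q : ℝ} {F G : ℝ → ℂ} (h : ∀ᵐ θ, F θ = G θ) :
    circleMean q F = circleMean q G := by
  rw [circleMean_eq, circleMean_eq]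
  congr 1
  refine lintegral_congr_ae ?_
  filter_upwards [circleMeasure_absolutelyContinuous.ae_le h] with θ hθ
  rw [hθ]

theorem circleMean_le_of_enorm_le {q : ℝ} (hq : 0 < q) {F : ℝ → ℂ} {C : ℝ≥0∞}
    (h : ∀ θ, ‖F θ‖ₑ ≤ C) : circleMean q F ≤ C := by
  rw [circleMean_eq]
  calc _ ≤ (∫⁻ _, C ^ q ∂circleMeasure) ^ (1 / q) :=
        ENNReal.rpow_le_rpow (lintegral_mono fun θ => ENNReal.rpow_le_rpow (h θ) hq.le)
          (by positivity)
    _ = C := by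
      rw [lintegral_const, measure_univ, mul_one, ← ENNReal.rpow_mul, mul_one_div_cancel hq.ne',
        ENNReal.rpow_one]

theorem circleMean_add_le {q : ℝ} (hq : 1 ≤ q) {F G : ℝ → ℂ} (hF : Measurable F)
    (hG : Measurable G) :
    circleMean q (fun θ => F θ + G θ) ≤ circleMean q F + circleMean q G := by
  simp only [circleMean_eq_eLpNorm']
  exact eLpNorm'_add_le hF.aestronglyMeasurable hG.aestronglyMeasurable hq

theorem circleMean_neg (q : ℝ) (F : ℝ → ℂ) : circleMean q (fun θ => -F θ) = circleMean q F := by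
  simp [circleMean]

theorem circleMean_sub_le {q : ℝ} (hq : 1 ≤ q) {F G : ℝ → ℂ} (hF : Measurable F)
    (hG : Measurable G) :
    circleMean q (fun θ => F θ - G θ) ≤ circleMean q F + circleMean q G := by
  simp only [sub_eq_add_neg]
  refine (circleMean_add_le hq hF hG.neg).trans_eq ?_
  exact congrArg _ (circleMean_neg q G)

theorem setLIntegral_period_eq {f : ℝ → ℝ≥0∞} {T : ℝ} (hT : 0 < T) (hf : Function.Periodic f T)
    (a b : ℝ) : ∫⁻ θ in Ioc a (a + T), f θ = ∫⁻ θ in Ioc b (b + T), f θ := by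
  refine (isAddFundamentalDomain_Ioc hT a).setLIntegral_eq (isAddFundamentalDomain_Ioc hT b) f ?_
  rintro ⟨g, hg⟩ x
  obtain ⟨n, rfl⟩ := AddSubgroup.mem_zmultiples_iff.1 hg
  change f (n • T + x) = f x
  rw [add_comm]
  exact hf.zsmul n x

theorem lintegral_circleMeasure_add {f : ℝ → ℝ≥0∞} (hf : Function.Periodic f (2 * Real.pi))
    (h : ℝ) : ∫⁻ θ, f (θ + h) ∂circleMeasure = ∫⁻ θ, f θ ∂circleMeasure := by
  rw [lintegral_circleMeasure, lintegral_circleMeasure]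
  congr 1
  have := (measurePreserving_add_right (volume : Measure ℝ) h).setLIntegral_comp_preimage_emb
    (measurableEmbedding_addRight h) f (Ioc h (h + 2 * Real.pi))
  rw [preimage_add_const_Ioc, sub_self, add_sub_cancel_left] at this
  rw [this]
  simpa using setLIntegral_period_eq Real.two_pi_pos hf h 0

theorem circleMean_add {q : ℝ} {F : ℝ → ℂ} (hF : Function.Periodic F (2 * Real.pi)) (h : ℝ) :
    circleMean q (fun θ => F (θ + h)) = circleMean q F := by
  rw [circleMean_eq, circleMean_eq]
  congr 1
  refine lintegral_circleMeasure_add (f := fun θ => ‖F θ‖ₑ ^ q) (fun θ => ?_) h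
  simp [hF θ]

/-- Minkowski's integral inequality for `circleMean`. -/
theorem circleMean_le_lintegral {β : Type*} [MeasurableSpace β] {ν : Measure β} [SFinite ν]
    {q : ℝ} (hq : 1 < q) {F : ℝ → ℂ} {G : ℝ → β → ℂ} {k : β → ℝ≥0∞} (hk : Measurable k)
    (hG : Measurable (Function.uncurry G))
    (h : ∀ᵐ θ, ‖F θ‖ₑ ≤ ∫⁻ t, ‖G θ t‖ₑ * k t ∂ν) :
    circleMean q F ≤ ∫⁻ t, circleMean q (fun θ => G θ t) * k t ∂ν := by
  have hq0 : 0 < q := by linarith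
  rw [circleMean_eq]
  calc _ ≤ (∫⁻ θ, (∫⁻ t, ‖G θ t‖ₑ * k t ∂ν) ^ q ∂circleMeasure) ^ (1 / q) := by
        refine ENNReal.rpow_le_rpow (lintegral_mono_ae ?_) (by positivity)
        filter_upwards [circleMeasure_absolutelyContinuous.ae_le h] with θ hθ
        exact ENNReal.rpow_le_rpow hθ hq0.le
    _ ≤ _ := lintegral_Lp_lintegral_le hq
        (hG.enorm.mul (hk.comp measurable_snd))
    _ = _ := by
      refine lintegral_congr fun t => ?_
      rw [circleMean_eq]
      have hGt : Measurable fun θ => ‖G θ t‖ₑ ^ q :=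
        (hG.comp measurable_prodMk_right).enorm.pow_const q
      simp_rw [ENNReal.mul_rpow_of_nonneg _ _ hq0.le]
      rw [lintegral_mul_const _ hGt, ENNReal.mul_rpow_of_nonneg _ _ (by positivity),
        ← ENNReal.rpow_mul, mul_one_div_cancel hq0.ne', ENNReal.rpow_one]

end

/-! ### Integral estimates for the weight and the gauge. -/

theorem setLIntegral_Ioo_one_sub (f : ℝ → ℝ≥0∞) (a b : ℝ) :
    ∫⁻ t in Ioo a b, f (1 - t) = ∫⁻ s in Ioo (1 - b) (1 - a), f s := by
  have h := (Measure.measurePreserving_sub_left (volume : Measure ℝ) 1).setLIntegral_comp_preimage_emb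
    (measurableEmbedding_subLeft (1 : ℝ)) f (Ioo (1 - b) (1 - a))
  rw [← h]
  simp

theorem lintegral_Ioo_rpow_le_of_lt_neg_one {a t : ℝ} (ha : a < -1) (ht : 0 < t) (b : ℝ) :
    ∫⁻ s in Ioo t b, ENNReal.ofReal (s ^ a) ≤ ENNReal.ofReal (-t ^ (a + 1) / (a + 1)) := by
  rw [← integral_Ioi_rpow_of_lt ha ht, ofReal_integral_eq_lintegral_ofReal]
  · exact lintegral_mono_set Ioo_subset_Ioi_self
  · exact integrableOn_Ioi_rpow_of_lt ha ht
  · filter_upwards [ae_restrict_mem measurableSet_Ioi] with s hs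
    exact Real.rpow_nonneg (ht.trans hs).le _

theorem lintegral_Ioo_zero_rpow {a h : ℝ} (ha : -1 < a) (hh : 0 < h) :
    ∫⁻ s in Ioo 0 h, ENNReal.ofReal (s ^ a) = ENNReal.ofReal (h ^ (a + 1) / (a + 1)) := by
  have hi := intervalIntegral.intervalIntegrable_rpow' (a := 0) (b := h) ha
  rw [setLIntegral_congr Ioo_ae_eq_Ioc,
    ← ofReal_integral_eq_lintegral_ofReal]
  · rw [← intervalIntegral.integral_of_le hh.le, integral_rpow (Or.inl ha),
      Real.zero_rpow (by linarith), sub_zero]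
  · exact (intervalIntegrable_iff_integrableOn_Ioc_of_le hh.le).1 hi
  · filter_upwards [ae_restrict_mem measurableSet_Ioc] with s hs
    exact Real.rpow_nonneg hs.1.le _

section Weight

variable {ω : ℝ → ℝ}

theorem IsRadialWeight.intervalIntegrable (hω : IsRadialWeight ω) {a b : ℝ} (ha : 0 ≤ a)
    (hab : a ≤ b) (hb : b ≤ 1) : IntervalIntegrable ω volume a b := by
  rw [intervalIntegrable_iff_integrableOn_Ioo_of_le hab]
  exact hω.integrable.mono_set fun x hx => ⟨ha.trans hx.1.le, hx.2.trans_le hb⟩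

theorem IsRadialWeight.tailIntegral_pos (hω : IsRadialWeight ω) {r : ℝ} (hr : r ∈ Ico (0 : ℝ) 1) :
    0 < tailIntegral ω r :=
  intervalIntegral.intervalIntegral_pos_of_pos_on (hω.intervalIntegrable hr.1 hr.2.le le_rfl)
    (fun x hx => hω.pos x ⟨hr.1.trans hx.1.le, hx.2⟩) hr.2

theorem IsRadialWeight.tailIntegral_le (hω : IsRadialWeight ω) {r s : ℝ} (hr : 0 ≤ r)
    (hrs : r ≤ s) (hs : s ≤ 1) : tailIntegral ω s ≤ tailIntegral ω r := by
  have h := intervalIntegral.integral_add_adjacent_intervals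
    (hω.intervalIntegrable hr hrs hs) (hω.intervalIntegrable (hr.trans hrs) hs le_rfl)
  have h2 : 0 ≤ ∫ x in r..s, ω x := by
    rw [intervalIntegral.integral_of_le hrs, integral_Ioc_eq_integral_Ioo]
    exact setIntegral_nonneg measurableSet_Ioo fun x hx =>
      (hω.pos x ⟨hr.trans hx.1.le, hx.2.trans_le hs⟩).le
  rw [tailIntegral, tailIntegral]
  linarith

theorem IsRadialWeight.monotoneOn_tail (hω : IsRadialWeight ω) :
    MonotoneOn (fun t => tailIntegral ω (1 - t)) (Icc 0 1) := fun s hs t ht hst =>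
  hω.tailIntegral_le (by linarith [ht.2]) (by linarith) (by linarith [hs.1])

theorem IsRadialWeight.tail_pos (hω : IsRadialWeight ω) {t : ℝ} (ht : t ∈ Ioc (0 : ℝ) 1) :
    0 < tailIntegral ω (1 - t) :=
  hω.tailIntegral_pos ⟨by linarith [ht.2], by linarith [ht.1]⟩

theorem IsRadialWeight.lipGauge_pos (hω : IsRadialWeight ω) (α β : ℝ) {t : ℝ}
    (ht : t ∈ Ioc (0 : ℝ) 1) : 0 < lipGauge α ω β t :=
  mul_pos (Real.rpow_pos_of_pos ht.1 _) (Real.rpow_pos_of_pos (hω.tail_pos ht) _)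

theorem IsRadialWeight.lipGauge_le (hω : IsRadialWeight ω) {α β : ℝ} (hα : 0 ≤ α) (hβ : 0 ≤ β)
    {s t : ℝ} (hs : 0 < s) (hst : s ≤ t) (ht : t ≤ 1) : lipGauge α ω β s ≤ lipGauge α ω β t := by
  have h1 := hω.tail_pos (t := s) ⟨hs, hst.trans ht⟩
  have h2 := hω.monotoneOn_tail (a := s) (b := t) ⟨hs.le, hst.trans ht⟩ ⟨(hs.trans_le hst).le, ht⟩ hst
  unfold lipGauge
  have := Real.rpow_le_rpow h1.le h2 hβ
  have h3 := Real.rpow_le_rpow hs.le hst hα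
  exact mul_le_mul h3 this (Real.rpow_nonneg h1.le _) (Real.rpow_nonneg (hs.le.trans hst) _)

/-- In s = 1-u the factor ω̂(1-s)^β is at most its value at s = h, which leaves ∫_0^h s^{α-1} ds. -/
theorem IsRadialWeight.lintegral_lipGauge_div_le (hω : IsRadialWeight ω) {α β : ℝ} (hα : 0 < α)
    (hβ : 0 ≤ β) {h : ℝ} (hh : h ∈ Ioc (0 : ℝ) 1) :
    ∫⁻ u in Ioo (1 - h) 1, ENNReal.ofReal (lipGauge α ω β (1 - u) / (1 - u)) ≤
      ENNReal.ofReal (lipGauge α ω β h / α) := by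
  rw [setLIntegral_Ioo_one_sub (fun s => ENNReal.ofReal (lipGauge α ω β s / s)), sub_self,
    sub_sub_cancel]
  have hW := (hω.tail_pos hh).le
  calc _ ≤ ∫⁻ s in Ioo 0 h, ENNReal.ofReal (tailIntegral ω (1 - h) ^ β) *
        ENNReal.ofReal (s ^ (α - 1)) := by
        refine setLIntegral_mono' measurableSet_Ioo fun s hs => ?_
        rw [← ENNReal.ofReal_mul (Real.rpow_nonneg hW _)]
        refine ENNReal.ofReal_le_ofReal ?_
        have h1 := hω.tail_pos (t := s) ⟨hs.1, hs.2.le.trans hh.2⟩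
        have h2 := hω.monotoneOn_tail (a := s) (b := h) ⟨hs.1.le, hs.2.le.trans hh.2⟩
          ⟨hh.1.le, hh.2⟩ hs.2.le
        have h3 := Real.rpow_le_rpow h1.le h2 hβ
        rw [Real.rpow_sub_one hs.1.ne', lipGauge]
        have h4 : 0 ≤ s ^ α / s := div_nonneg (Real.rpow_nonneg hs.1.le _) hs.1.le
        calc _ = tailIntegral ω (1 - s) ^ β * (s ^ α / s) := by ring
          _ ≤ _ := mul_le_mul_of_nonneg_right h3 h4
    _ = _ := by
      rw [lintegral_const_mul' _ _ ENNReal.ofReal_ne_top, lintegral_Ioo_zero_rpow (by linarith) hh.1,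
        ← ENNReal.ofReal_mul (Real.rpow_nonneg hW _), lipGauge]
      congr 1
      rw [sub_add_cancel]
      ring

/-- For r = 1-t the tail ω̂ is at most ω̂(r) on (r,1), so the first factor of the Muckenhoupt
product is at least t^{p-1}/ω̂(1-t). Dividing by this bound leaves the second factor. -/
theorem MuckenhouptCondition.exists_lintegral_le {p : ℝ} (hp : 1 < p) (hω : IsRadialWeight ω)
    (hM : MuckenhouptCondition p ω) : ∃ K : ℝ, 0 < K ∧ ∀ t ∈ Ioo (0 : ℝ) 1,
      ∫⁻ s in Ioo t 1, ENNReal.ofReal (s ^ (-p) * tailIntegral ω (1 - s)) ≤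
        ENNReal.ofReal (K * (tailIntegral ω (1 - t) * t ^ (1 - p))) := by
  have hc := Real.HolderConjugate.conjExponent hp
  have hp0 : 0 < p := by linarith
  have hc0 := hc.symm.pos
  unfold MuckenhouptCondition at hM
  set S := ⨆ r ∈ Ico (0 : ℝ) 1,
    (∫⁻ t in Ioo r 1, ENNReal.ofReal (tailIntegral ω t) ^ (-(p.conjExponent / p))) ^
        (p / p.conjExponent) *
      ∫⁻ t in Ioo 0 r, ENNReal.ofReal ((1 - t) ^ (-p) * tailIntegral ω t) with hS
  refine ⟨S.toReal + 1, by positivity, fun t ht => ?_⟩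
  have hW := hω.tail_pos (t := t) ⟨ht.1, ht.2.le⟩
  have h1 := le_iSup₂ (f := fun r (_ : r ∈ Ico (0 : ℝ) 1) =>
    (∫⁻ t in Ioo r 1, ENNReal.ofReal (tailIntegral ω t) ^ (-(p.conjExponent / p))) ^
        (p / p.conjExponent) *
      ∫⁻ t in Ioo 0 r, ENNReal.ofReal ((1 - t) ^ (-p) * tailIntegral ω t)) (1 - t)
      ⟨by linarith [ht.2], by linarith [ht.1]⟩
  rw [← hS] at h1
  have h2 : ∫⁻ u in Ioo 0 (1 - t), ENNReal.ofReal ((1 - u) ^ (-p) * tailIntegral ω u) =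
      ∫⁻ s in Ioo t 1, ENNReal.ofReal (s ^ (-p) * tailIntegral ω (1 - s)) := by
    have := setLIntegral_Ioo_one_sub
      (fun s => ENNReal.ofReal (s ^ (-p) * tailIntegral ω (1 - s))) 0 (1 - t)
    simpa using this
  have h3 : ENNReal.ofReal (t ^ (p - 1) / tailIntegral ω (1 - t)) ≤
      (∫⁻ u in Ioo (1 - t) 1, ENNReal.ofReal (tailIntegral ω u) ^ (-(p.conjExponent / p))) ^
        (p / p.conjExponent) := by
    have h4 : ENNReal.ofReal t * ENNReal.ofReal (tailIntegral ω (1 - t)) ^ (-(p.conjExponent / p)) ≤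
        ∫⁻ u in Ioo (1 - t) 1, ENNReal.ofReal (tailIntegral ω u) ^ (-(p.conjExponent / p)) := by
      calc _ = ∫⁻ _ in Ioo (1 - t) 1,
            ENNReal.ofReal (tailIntegral ω (1 - t)) ^ (-(p.conjExponent / p)) := by
            rw [setLIntegral_const, Real.volume_Ioo, sub_sub_cancel, mul_comm]
        _ ≤ _ := by
          refine setLIntegral_mono' measurableSet_Ioo fun u hu => ?_
          have : 0 ≤ p.conjExponent / p := by positivity
          rw [ENNReal.rpow_neg, ENNReal.rpow_neg, ENNReal.inv_le_inv]
          exact ENNReal.rpow_le_rpow (ENNReal.ofReal_le_ofReal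
            (hω.tailIntegral_le (by linarith [ht.2]) hu.1.le hu.2.le)) this
    refine le_trans (le_of_eq ?_) (ENNReal.rpow_le_rpow h4 (by positivity))
    rw [ENNReal.mul_rpow_of_nonneg _ _ (by positivity), ← ENNReal.rpow_mul,
      ENNReal.ofReal_rpow_of_pos ht.1, ENNReal.ofReal_rpow_of_pos hW,
      ← ENNReal.ofReal_mul (Real.rpow_nonneg ht.1.le _)]
    have e1 : p / p.conjExponent = p - 1 := by
      have : p - 1 ≠ 0 := by linarith
      rw [Real.conjExponent]; field_simp
    have e2 : -(p.conjExponent / p) * (p / p.conjExponent) = -1 := by field_simp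
    rw [e2, e1, Real.rpow_neg_one, div_eq_mul_inv]
  rw [h2] at h1
  have h5 := (mul_le_mul_left h3 _).trans h1
  have h6 : S = ENNReal.ofReal S.toReal := (ENNReal.ofReal_toReal hM.ne).symm
  set J := ∫⁻ s in Ioo t 1, ENNReal.ofReal (s ^ (-p) * tailIntegral ω (1 - s))
  have ht0 := ht.1
  have h7 : 0 < t ^ (p - 1) / tailIntegral ω (1 - t) :=
    div_pos (Real.rpow_pos_of_pos ht.1 _) hW
  calc J = ENNReal.ofReal (t ^ (p - 1) / tailIntegral ω (1 - t))⁻¹ *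
        (ENNReal.ofReal (t ^ (p - 1) / tailIntegral ω (1 - t)) * J) := by
        rw [← mul_assoc, ← ENNReal.ofReal_mul (by positivity), inv_mul_cancel₀ h7.ne']; simp
    _ ≤ ENNReal.ofReal (t ^ (p - 1) / tailIntegral ω (1 - t))⁻¹ * ENNReal.ofReal S.toReal := by
        rw [← h6]; gcongr
    _ ≤ _ := by
        rw [← ENNReal.ofReal_mul (by positivity)]
        refine ENNReal.ofReal_le_ofReal ?_
        rw [inv_div, show (1 - p) = -(p - 1) by ring, Real.rpow_neg ht0.le, mul_comm,
          ← div_eq_mul_inv]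
        have : 0 ≤ tailIntegral ω (1 - t) / t ^ (p - 1) := by positivity
        gcongr
        linarith

/-- Hölder with exponents 1/η and 1/(1-η) applied to κ(s)/s² = (s^{-p} ω̂(1-s))^η (s^a)^{1-η}: the
Muckenhoupt bound handles the first factor, an explicit power integral the second. -/
theorem MuckenhouptCondition.exists_lintegral_lipGauge_le {p η : ℝ} (hp : 1 < p) (hη₀ : 0 ≤ η)
    (hη : η < 1 / p) (hω : IsRadialWeight ω) (hM : MuckenhouptCondition p ω) :
    ∃ K : ℝ, 0 < K ∧ ∀ t ∈ Ioo (0 : ℝ) 1,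
      ∫⁻ s in Ioo t 1, ENNReal.ofReal (lipGauge (1 / p) ω η s / s ^ 2) ≤
        ENNReal.ofReal (K * (lipGauge (1 / p) ω η t / t)) := by
  obtain ⟨K, hK, h⟩ := hM.exists_lintegral_le hp hω
  have hp0 : 0 < p := by linarith
  have hp1 : 1 / p < 1 := by rw [div_lt_one hp0]; exact hp
  have hη1 : 0 < 1 - η := by linarith
  -- The exponent is forced by the factorization; a < -1 amounts to (p-1)η < (p-1)/p, that is, to η
  -- < 1/p.
  set a := (1 / p - 2 + p * η) / (1 - η) with ha
  have ha1 : a < -1 := by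
    rw [ha, div_lt_iff₀ hη1]
    have e : p * (1 / p) = 1 := by field_simp
    nlinarith
  have ham : a * (1 - η) = 1 / p - 2 + p * η := by rw [ha]; field_simp
  refine ⟨K ^ η * (-1 / (a + 1)) ^ (1 - η), mul_pos (Real.rpow_pos_of_pos hK _)
    (Real.rpow_pos_of_pos (div_pos_of_neg_of_neg (by norm_num) (by linarith)) _), fun t ht => ?_⟩
  have hW := hω.tail_pos (t := t) ⟨ht.1, ht.2.le⟩
  have ht0 := ht.1
  have hWm : AEMeasurable (fun s => tailIntegral ω (1 - s)) (volume.restrict (Ioo t 1)) :=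
    aemeasurable_restrict_of_monotoneOn measurableSet_Ioo
      (hω.monotoneOn_tail.mono fun s hs => ⟨(ht0.trans hs.1).le, hs.2.le⟩)
  calc _ = ∫⁻ s in Ioo t 1, ENNReal.ofReal (s ^ (-p) * tailIntegral ω (1 - s)) ^ η *
        ENNReal.ofReal (s ^ a) ^ (1 - η) := by
        refine setLIntegral_congr_fun measurableSet_Ioo fun s hs => ?_
        have hs0 : 0 < s := ht0.trans hs.1
        have hWs := hω.tail_pos (t := s) ⟨hs0, hs.2.le⟩
        have hsp := Real.rpow_pos_of_pos hs0 (-p)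
        rw [ENNReal.ofReal_rpow_of_nonneg (by positivity) hη₀,
          ENNReal.ofReal_rpow_of_nonneg (by positivity) hη1.le, ← ENNReal.ofReal_mul (by positivity),
          Real.mul_rpow hsp.le hWs.le, ← Real.rpow_mul hs0.le, ← Real.rpow_mul hs0.le, ham, lipGauge]
        congr 1
        rw [show s ^ (-p * η) * tailIntegral ω (1 - s) ^ η * s ^ (1 / p - 2 + p * η) =
          s ^ (-p * η) * s ^ (1 / p - 2 + p * η) * tailIntegral ω (1 - s) ^ η by ring,
          ← Real.rpow_add hs0, show -p * η + (1 / p - 2 + p * η) = 1 / p - (2 : ℕ) by push_cast; ring,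
          Real.rpow_sub_natCast hs0.ne']
        ring
    _ ≤ (∫⁻ s in Ioo t 1, ENNReal.ofReal (s ^ (-p) * tailIntegral ω (1 - s))) ^ η *
        (∫⁻ s in Ioo t 1, ENNReal.ofReal (s ^ a)) ^ (1 - η) := by
        refine ENNReal.lintegral_mul_norm_pow_le ?_ ?_ hη₀ hη1.le (by ring)
        · exact (((measurable_id.pow_const (-p)).aemeasurable).mul hWm).ennreal_ofReal
        · exact ((measurable_id.pow_const a).ennreal_ofReal).aemeasurable
    _ ≤ ENNReal.ofReal (K * (tailIntegral ω (1 - t) * t ^ (1 - p))) ^ η *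
        ENNReal.ofReal (-t ^ (a + 1) / (a + 1)) ^ (1 - η) := by
        gcongr
        · exact h t ht
        · exact lintegral_Ioo_rpow_le_of_lt_neg_one ha1 ht0 1
    _ = _ := by
        have hta := Real.rpow_pos_of_pos ht0 (a + 1)
        have htp := Real.rpow_pos_of_pos ht0 (1 - p)
        have ha2 : 0 < -1 / (a + 1) := div_pos_of_neg_of_neg (by norm_num) (by linarith)
        rw [show -t ^ (a + 1) / (a + 1) = (-1 / (a + 1)) * t ^ (a + 1) by ring,
          ENNReal.ofReal_rpow_of_nonneg (by positivity) hη₀,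
          ENNReal.ofReal_rpow_of_nonneg (by positivity) hη1.le,
          ← ENNReal.ofReal_mul (by positivity), Real.mul_rpow hK.le (by positivity),
          Real.mul_rpow hW.le htp.le, Real.mul_rpow ha2.le hta.le, ← Real.rpow_mul ht0.le,
          ← Real.rpow_mul ht0.le, lipGauge]
        congr 1
        have e : t ^ ((1 - p) * η) * t ^ ((a + 1) * (1 - η)) = t ^ (1 / p) / t := by
          rw [← Real.rpow_add ht0, ← Real.rpow_sub_one ht0.ne']
          congr 1
          rw [add_mul, ham]; ring
        linear_combination (K ^ η * tailIntegral ω (1 - t) ^ η * (-1 / (a + 1)) ^ (1 - η)) * e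

/-- The Muckenhoupt condition prevents ω̂ from decaying faster than a power: ω̂(1-t) ≥ c t^{p-1}.
Hence κ(t)/t dominates a power of t whose exponent is negative when η < 1/p. -/
theorem MuckenhouptCondition.exists_le_lipGauge {p η : ℝ} (hp : 1 < p) (hη₀ : 0 ≤ η)
    (hω : IsRadialWeight ω) (hM : MuckenhouptCondition p ω) :
    ∃ c : ℝ, 0 < c ∧ ∀ t ∈ Ioo (0 : ℝ) 1,
      c * t ^ (-((p - 1) * (1 / p - η))) ≤ lipGauge (1 / p) ω η t / t := by
  obtain ⟨K, hK, h⟩ := hM.exists_lintegral_le hp hω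
  have hp0 : 0 < p := by linarith
  set w := tailIntegral ω (1 - 1 / 2) with hw
  have hw0 : 0 < w := hω.tail_pos (t := 1 / 2) (by norm_num)
  have hsuff : ∃ c : ℝ, 0 < c ∧ ∀ t ∈ Ioo (0 : ℝ) 1, c * t ^ (p - 1) ≤ tailIntegral ω (1 - t) := by
    -- For t ≥ 1/2 monotonicity gives w. For t < 1/2 the part of the integral over (1/2,1) is
    -- already at least w/2, so K ω̂(1-t) t^{1-p} ≥ w/2.
    refine ⟨min w (w / 2 / K), by positivity, fun t ht => ?_⟩
    have ht0 := ht.1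
    have hW := hω.tail_pos (t := t) ⟨ht.1, ht.2.le⟩
    have htp := Real.rpow_pos_of_pos ht0 (p - 1)
    rcases le_or_gt (1 / 2) t with h2 | h2
    · have h3 : t ^ (p - 1) ≤ 1 := Real.rpow_le_one ht0.le ht.2.le (by linarith)
      have h4 := hω.monotoneOn_tail (a := 1 / 2) (b := t) (by norm_num) ⟨ht0.le, ht.2.le⟩ h2
      calc _ ≤ w * 1 := mul_le_mul (min_le_left _ _) h3 htp.le hw0.le
        _ ≤ _ := by rw [mul_one]; exact h4
    · have h5 : ENNReal.ofReal (w / 2) ≤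
          ∫⁻ s in Ioo t 1, ENNReal.ofReal (s ^ (-p) * tailIntegral ω (1 - s)) := by
        calc ENNReal.ofReal (w / 2) = ∫⁻ _ in Ioo (1 / 2 : ℝ) 1, ENNReal.ofReal w := by
              rw [setLIntegral_const, Real.volume_Ioo, ← ENNReal.ofReal_mul hw0.le]; norm_num; ring_nf
          _ ≤ ∫⁻ s in Ioo (1 / 2 : ℝ) 1, ENNReal.ofReal (s ^ (-p) * tailIntegral ω (1 - s)) := by
              refine setLIntegral_mono' measurableSet_Ioo fun s hs => ENNReal.ofReal_le_ofReal ?_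
              have hs0 : (0 : ℝ) < s := by linarith [hs.1]
              have h6 := hω.monotoneOn_tail (a := 1 / 2) (b := s) (by norm_num) ⟨hs0.le, hs.2.le⟩ hs.1.le
              have h7 : 1 ≤ s ^ (-p) :=
                Real.one_le_rpow_of_pos_of_le_one_of_nonpos hs0 hs.2.le (by linarith)
              calc w = 1 * w := (one_mul _).symm
                _ ≤ _ := mul_le_mul h7 h6 hw0.le (by positivity)
          _ ≤ _ := lintegral_mono_set (Ioo_subset_Ioo_left h2.le)
      have h8 := h5.trans (h t ht)
      have htp' := Real.rpow_pos_of_pos ht0 (1 - p)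
      rw [ENNReal.ofReal_le_ofReal_iff (by positivity)] at h8
      have e : t ^ (1 - p) * t ^ (p - 1) = 1 := by rw [← Real.rpow_add ht0]; simp
      calc _ ≤ w / 2 / K * t ^ (p - 1) := by gcongr; exact min_le_right _ _
        _ ≤ (K * (tailIntegral ω (1 - t) * t ^ (1 - p))) / K * t ^ (p - 1) := by gcongr
        _ = tailIntegral ω (1 - t) * (t ^ (1 - p) * t ^ (p - 1)) := by field_simp
        _ = _ := by rw [e, mul_one]
  obtain ⟨c, hc, h⟩ := hsuff
  refine ⟨c ^ η, Real.rpow_pos_of_pos hc _, fun t ht => ?_⟩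
  have ht0 := ht.1
  have htp := Real.rpow_pos_of_pos ht0 (p - 1)
  have h1 := Real.rpow_le_rpow (by positivity) (h t ht) hη₀
  rw [Real.mul_rpow hc.le htp.le, ← Real.rpow_mul ht0.le] at h1
  have h2 : 0 ≤ t ^ (1 / p) / t := by positivity
  calc _ = c ^ η * t ^ ((p - 1) * η) * (t ^ (1 / p) / t) := by
        rw [mul_assoc, ← Real.rpow_sub_one ht0.ne', ← Real.rpow_add ht0]
        congr 2
        field_simp
        ring
    _ ≤ tailIntegral ω (1 - t) ^ η * (t ^ (1 / p) / t) := by gcongr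
    _ = _ := by rw [lipGauge]; ring

end Weight

/-! ### Cauchy and Poisson integrals over the unit circle. -/

theorem circleMap_zero_add (r θ h : ℝ) :
    circleMap 0 r (θ + h) = circleMap 0 1 h * circleMap 0 r θ := by
  simp [circleMap, add_mul, Complex.exp_add]; ring

theorem circleMap_zero_eq_mul (r θ : ℝ) : circleMap 0 r θ = r * circleMap 0 1 θ := by
  simp [circleMap]

theorem norm_circleMap_one (θ : ℝ) : ‖circleMap 0 1 θ‖ = 1 := by simp

theorem circleMap_one_ne_zero (θ : ℝ) : circleMap 0 1 θ ≠ 0 := by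
  rw [← norm_ne_zero_iff, norm_circleMap_one]; exact one_ne_zero

theorem circleMap_mem_unitBall {r : ℝ} (hr0 : 0 ≤ r) (hr : r < 1) (θ : ℝ) :
    circleMap 0 r θ ∈ Metric.ball (0 : ℂ) 1 := by
  simp [abs_of_nonneg hr0, hr]

theorem enorm_sub_le_lintegral_of_hasDerivAt {F F' : ℝ → ℂ} {a b : ℝ} (hab : a ≤ b)
    (hF : ∀ t ∈ Icc a b, HasDerivAt F (F' t) t) (hF' : ContinuousOn F' (Icc a b)) :
    ‖F b - F a‖ₑ ≤ ∫⁻ t in Ioc a b, ‖F' t‖ₑ := by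
  rw [← intervalIntegral.integral_eq_sub_of_hasDerivAt (f' := F') (by rwa [uIcc_of_le hab])
    (ContinuousOn.intervalIntegrable (by rwa [uIcc_of_le hab])),
    intervalIntegral.integral_of_le hab]
  exact enorm_integral_le_lintegral_enorm _

theorem deriv_eq_integral_circleMap {f : ℂ → ℂ} {U : Set ℂ} (hU : IsOpen U)
    (hsub : Metric.closedBall 0 1 ⊆ U) (hf : DifferentiableOn ℂ f U) {z : ℂ}
    (hz : z ∈ Metric.ball (0 : ℂ) 1) :
    deriv f z = (2 * Real.pi : ℂ)⁻¹ * ∫ θ in (0 : ℝ)..2 * Real.pi,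
      circleMap 0 1 θ * ((circleMap 0 1 θ - z) ^ 2)⁻¹ * f (circleMap 0 1 θ) := by
  rw [← Complex.two_pi_I_inv_smul_circleIntegral_sub_sq_inv_smul_of_differentiable hU hsub hf hz,
    circleIntegral, smul_eq_mul]
  have : ∀ θ : ℝ, deriv (circleMap 0 1) θ • (((circleMap 0 1 θ - z) ^ 2)⁻¹ • f (circleMap 0 1 θ)) =
      Complex.I * (circleMap 0 1 θ * ((circleMap 0 1 θ - z) ^ 2)⁻¹ * f (circleMap 0 1 θ)) := by
    intro θ
    rw [deriv_circleMap, smul_eq_mul, smul_eq_mul]; ring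
  simp_rw [this]
  rw [intervalIntegral.integral_const_mul, mul_inv, mul_assoc _ (Complex.I⁻¹), ← mul_assoc (Complex.I⁻¹),
    inv_mul_cancel₀ Complex.I_ne_zero, one_mul]

theorem continuous_cauchyKernel {z : ℂ} (hz : z ∈ Metric.ball (0 : ℂ) 1) :
    Continuous fun θ : ℝ => circleMap 0 1 θ * ((circleMap 0 1 θ - z) ^ 2)⁻¹ := by
  have : ∀ θ, circleMap 0 1 θ - z ≠ 0 := fun θ => sub_ne_zero.2 (circleMap_ne_mem_ball hz θ)
  exact (continuous_circleMap 0 1).mul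
    (Continuous.inv₀ (by fun_prop) fun θ => pow_ne_zero 2 (this θ))

/-- Cauchy's formula for the derivative at `z` of a function `H` analytic in the unit disc whose
dilates converge in `L¹` of the circle to `φ`; an auxiliary analytic factor `A` with `A z = 1`,
`A' z = 0` may be inserted. -/
theorem deriv_eq_integral_of_tendsto_L1 {H A : ℂ → ℂ} (hH : DifferentiableOn ℂ H (Metric.ball 0 1))
    {U : Set ℂ} (hU : IsOpen U) (hsub : Metric.closedBall 0 1 ⊆ U) (hA : DifferentiableOn ℂ A U)
    {z : ℂ} (hz : z ∈ Metric.ball (0 : ℂ) 1) (hA1 : A z = 1) (hA2 : deriv A z = 0)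
    {φ : ℝ → ℂ} (hφ : IntegrableOn φ (Ioc 0 (2 * Real.pi))) {s : ℕ → ℝ}
    (hs : ∀ n, s n ∈ Ioo (0 : ℝ) 1) (hs1 : Tendsto s atTop (𝓝 1))
    (hlim : Tendsto (fun n => ∫⁻ θ in Ioc 0 (2 * Real.pi), ‖H (circleMap 0 (s n) θ) - φ θ‖ₑ)
      atTop (𝓝 0)) :
    deriv H z = (2 * Real.pi : ℂ)⁻¹ * ∫ θ in (0 : ℝ)..2 * Real.pi,
      circleMap 0 1 θ * ((circleMap 0 1 θ - z) ^ 2)⁻¹ * A (circleMap 0 1 θ) * φ θ := by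
  set k : ℝ → ℂ := fun θ => circleMap 0 1 θ * ((circleMap 0 1 θ - z) ^ 2)⁻¹ * A (circleMap 0 1 θ)
    with hk
  have hAc : Continuous fun θ : ℝ => A (circleMap 0 1 θ) :=
    hA.continuousOn.comp_continuous (continuous_circleMap 0 1) fun θ => hsub (by simp)
  have hkc : Continuous k := (continuous_cauchyKernel hz).mul hAc
  have hzU : z ∈ U := hsub (Metric.ball_subset_closedBall hz)
  have hmem : ∀ n, ∀ w ∈ Metric.ball (0 : ℂ) (1 / s n), (s n : ℂ) * w ∈ Metric.ball (0 : ℂ) 1 := by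
    intro n w hw
    have h0 := (hs n).1
    rw [mem_ball_zero_iff, lt_div_iff₀ h0] at hw
    rw [mem_ball_zero_iff, norm_mul, Complex.norm_real, Real.norm_eq_abs, abs_of_pos h0, mul_comm]
    exact hw
  have hsub' : ∀ n, Metric.closedBall (0 : ℂ) 1 ⊆ Metric.ball 0 (1 / s n) := fun n =>
    Metric.closedBall_subset_ball (by rw [lt_div_iff₀ (hs n).1, one_mul]; exact (hs n).2)
  have hHs : ∀ n, DifferentiableOn ℂ (fun w => H (s n * w)) (Metric.ball 0 (1 / s n)) := fun n =>
    hH.comp (by fun_prop) (hmem n)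
  have hn : ∀ n, (s n : ℂ) * deriv H (s n * z) = (2 * Real.pi : ℂ)⁻¹ *
      ∫ θ in (0 : ℝ)..2 * Real.pi, k θ * H (circleMap 0 (s n) θ) := by
    intro n
    have hz' := hsub' n (Metric.ball_subset_closedBall hz)
    -- The dilate w ↦ H(s_n w) is analytic across the unit circle, so Cauchy's formula applies to
    -- its product with A. Since A(z) = 1 and A'(z) = 0, the factor A does not change the derivative
    -- at z.
    have hd : HasDerivAt (fun w => H (s n * w) * A w) (s n * deriv H (s n * z)) z := by
      have h1 : HasDerivAt (fun w => H (s n * w)) (deriv H (s n * z) * (s n * 1)) z :=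
        HasDerivAt.comp z ((hH.differentiableAt (Metric.isOpen_ball.mem_nhds
          (hmem n z hz'))).hasDerivAt) ((hasDerivAt_id z).const_mul (s n : ℂ))
      have h2 := h1.mul (hA.differentiableAt (hU.mem_nhds hzU)).hasDerivAt
      convert! h2 using 1
      rw [hA1, hA2]; ring
    rw [← hd.deriv]
    rw [deriv_eq_integral_circleMap (f := fun w => H (s n * w) * A w) (hU.inter Metric.isOpen_ball)
      (subset_inter hsub (hsub' n)) (((hHs n).mono inter_subset_right).mul
      (hA.mono inter_subset_left)) hz]
    congr 1
    refine intervalIntegral.integral_congr fun θ _ => ?_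
    simp only [hk, circleMap_zero_eq_mul (s n)]
    ring
  have hl : Tendsto (fun n => (s n : ℂ) * deriv H (s n * z)) atTop (𝓝 (1 * deriv H (1 * z))) := by
    have h1 : Tendsto (fun n => (s n : ℂ)) atTop (𝓝 ((1 : ℝ) : ℂ)) :=
      (Complex.continuous_ofReal.tendsto 1).comp hs1
    rw [Complex.ofReal_one] at h1
    have h2 : ContinuousAt (deriv H) (1 * z) := by
      rw [one_mul]
      exact ((hH.deriv Metric.isOpen_ball).differentiableAt
        (Metric.isOpen_ball.mem_nhds hz)).continuousAt
    exact h1.mul (h2.tendsto.comp (h1.mul_const z))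
  rw [one_mul, one_mul] at hl
  refine tendsto_nhds_unique hl ?_
  simp_rw [hn]
  refine Tendsto.const_mul _ ?_
  simp_rw [intervalIntegral.integral_of_le Real.two_pi_pos.le]
  obtain ⟨K, hK⟩ := isCompact_Icc.exists_bound_of_continuousOn (s := Icc 0 (2 * Real.pi))
    hkc.continuousOn
  have hHc : ∀ n, Continuous fun θ : ℝ => H (circleMap 0 (s n) θ) := fun n =>
    hH.continuousOn.comp_continuous (continuous_circleMap 0 _)
      fun θ => circleMap_mem_unitBall (hs n).1.le (hs n).2 θ
  refine tendsto_integral_of_L1 (fun θ => k θ * φ θ) ?_ (Eventually.of_forall fun n => ?_) ?_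
  · refine ((hφ.bdd_mul (f := k) (c := K) hkc.aestronglyMeasurable ?_)).aestronglyMeasurable
    filter_upwards [ae_restrict_mem measurableSet_Ioc] with θ hθ using hK θ (Ioc_subset_Icc_self hθ)
  · exact (hkc.mul (hHc n)).integrableOn_Ioc
  · refine tendsto_of_tendsto_of_tendsto_of_le_of_le' (tendsto_const_nhds)
      (h := fun n => ENNReal.ofReal K *
        ∫⁻ θ in Ioc 0 (2 * Real.pi), ‖H (circleMap 0 (s n) θ) - φ θ‖ₑ) ?_
      (Eventually.of_forall fun n => zero_le) (Eventually.of_forall fun n => ?_)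
    · have := ENNReal.Tendsto.const_mul (a := ENNReal.ofReal K) hlim (Or.inr ENNReal.ofReal_ne_top)
      rwa [mul_zero] at this
    · rw [← lintegral_const_mul' _ _ ENNReal.ofReal_ne_top]
      refine setLIntegral_mono' measurableSet_Ioc fun θ hθ => ?_
      rw [← mul_sub, enorm_mul]
      gcongr
      rw [← ofReal_norm]
      exact ENNReal.ofReal_le_ofReal (hK θ (Ioc_subset_Icc_self hθ))

theorem integral_inv_sq_norm_sub {z : ℂ} (hz : z ∈ Metric.ball (0 : ℂ) 1) :
    ∫ θ in (0 : ℝ)..2 * Real.pi, (1 - ‖z‖ ^ 2) / ‖circleMap 0 1 θ - z‖ ^ 2 = 2 * Real.pi := by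
  have h := DiffContOnCl.circleAverage_poissonKernel_smul (f := fun _ : ℂ => (1 : ℂ)) (c := 0)
    (R := 1) (w := z) diffContOnCl_const hz
  rw [Real.circleAverage_def] at h
  have e : ∀ θ : ℝ, (poissonKernel 0 z • fun _ : ℂ => (1 : ℂ)) (circleMap 0 1 θ) =
      (((1 - ‖z‖ ^ 2) / ‖circleMap 0 1 θ - z‖ ^ 2 : ℝ) : ℂ) := by
    intro θ
    simp [poissonKernel_def]
  simp_rw [e] at h
  rw [intervalIntegral.integral_ofReal, Complex.real_smul, ← Complex.ofReal_mul] at h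
  have h' := Complex.ofReal_injective (h.trans Complex.ofReal_one.symm)
  have := Real.pi_pos
  field_simp at h'
  linarith

/-- Jordan's inequality |sin x| ≥ 2|x|/π at half the angle compares arc with chord. -/
theorem abs_le_norm_circleMap_sub {t θ : ℝ} (h : |t - θ| ≤ Real.pi) :
    |t - θ| ≤ Real.pi / 2 * ‖circleMap 0 1 t - circleMap 0 1 θ‖ := by
  have e : circleMap 0 1 t - circleMap 0 1 θ =
      circleMap 0 1 θ * (Complex.exp (Complex.I * ((t - θ : ℝ) : ℂ)) - 1) := by
    rw [mul_sub, mul_one, show t = θ + (t - θ) by ring, circleMap_zero_add 1 θ (t - θ), mul_comm]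
    simp [circleMap, mul_comm]
  rw [e, norm_mul, norm_circleMap_one, one_mul, Complex.norm_exp_I_mul_ofReal_sub_one,
    Real.norm_eq_abs, abs_mul, abs_two]
  have h1 := Real.mul_abs_le_abs_sin (x := (t - θ) / 2) (by rw [abs_div, abs_two]; linarith)
  rw [abs_div, abs_two] at h1
  have := Real.pi_pos
  calc |t - θ| = Real.pi / 2 * (2 * (2 / Real.pi * (|t - θ| / 2))) := by field_simp
    _ ≤ _ := by gcongr

/-! ### Fatou's theorem at a point of differentiability. -/

noncomputable section

/-- A sequence of radii in `(0, 1)` increasing to `1`. -/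
def radius (n : ℕ) : ℝ := 1 - 1 / (n + 2)

theorem radius_mem (n : ℕ) : radius n ∈ Ioo (0 : ℝ) 1 := by
  have h1 : (0 : ℝ) < 1 / (n + 2) := by positivity
  have h2 : (1 : ℝ) / (n + 2) < 1 := by
    rw [div_lt_one (by positivity)]; linarith [(Nat.cast_nonneg n : (0 : ℝ) ≤ n)]
  exact ⟨by simp only [radius]; linarith, by simp only [radius]; linarith⟩

theorem tendsto_radius : Tendsto radius atTop (𝓝 1) := by
  have h1 : Tendsto (fun n : ℕ => (1 : ℝ) / (n + 2)) atTop (𝓝 0) := by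
    have := (tendsto_one_div_add_atTop_nhds_zero_nat (𝕜 := ℝ)).comp (tendsto_add_atTop_nat 1)
    refine this.congr fun n => ?_
    simp only [Function.comp]; push_cast; ring_nf
  have := h1.const_sub 1
  rwa [sub_zero] at this

theorem tendsto_radius_left : Tendsto radius atTop (𝓝[<] 1) :=
  tendsto_nhdsWithin_iff.2 ⟨tendsto_radius, Eventually.of_forall fun n => (radius_mem n).2⟩

theorem continuous_comp_circleMap {H : ℂ → ℂ} (hH : DifferentiableOn ℂ H (Metric.ball 0 1)) {r : ℝ}
    (hr0 : 0 ≤ r) (hr : r < 1) : Continuous fun θ : ℝ => H (circleMap 0 r θ) :=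
  hH.continuousOn.comp_continuous (continuous_circleMap 0 _)
    fun θ => circleMap_mem_unitBall hr0 hr θ

theorem continuous_circleMap_radius (θ : ℝ) : Continuous fun r : ℝ => circleMap 0 r θ := by
  unfold circleMap; fun_prop

theorem periodic_of_radial_limit {H : ℂ → ℂ} {Hs : ℝ → ℂ}
    (h : ∀ θ, Tendsto (fun r : ℝ => H (circleMap 0 r θ)) (𝓝[<] 1) (𝓝 (Hs θ))) :
    Function.Periodic Hs (2 * Real.pi) := by
  intro θ
  have h1 := h (θ + 2 * Real.pi)
  simp_rw [periodic_circleMap 0 _ θ] at h1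
  exact tendsto_nhds_unique h1 (h θ)

/-- With the bare Cauchy kernel |ζ-z|^{-2} the linear term would cost a logarithm. An analytic
factor of size d/|ζ-z|, d = 1-|z|², turns the linear term into the Poisson kernel, of fixed mass,
and the cubic term into a multiple of d. The cube in the hypothesis is chosen to match |ζ-z|^{-3}.
-/
theorem norm_deriv_le_of_boundary_le {H : ℂ → ℂ} (hH : DifferentiableOn ℂ H (Metric.ball 0 1))
    {K₁ : ℝ} (hHb : ∀ z ∈ Metric.ball (0 : ℂ) 1, ‖H z‖ ≤ K₁) {Hs : ℝ → ℂ}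
    (hrad : ∀ θ, Tendsto (fun r : ℝ => H (circleMap 0 r θ)) (𝓝[<] 1) (𝓝 (Hs θ)))
    {ζ₀ z : ℂ} {M ε K : ℝ} (hM : 0 ≤ M) (hε : 0 ≤ ε) (hK : 0 ≤ K) (hz : z ∈ stolzRegion M ζ₀)
    (hb : ∀ θ, ‖Hs θ‖ ≤ ε * ‖circleMap 0 1 θ - ζ₀‖ + K * ‖circleMap 0 1 θ - ζ₀‖ ^ 3) :
    ‖deriv H z‖ ≤ 4 * (1 + M) * ε + 4 * K * (1 + M) ^ 3 * (1 - ‖z‖ ^ 2) := by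
  have hHsb : ∀ θ, ‖Hs θ‖ ≤ K₁ := by
    intro θ
    refine le_of_tendsto ((hrad θ).comp tendsto_radius_left).norm (Eventually.of_forall fun n => ?_)
    exact hHb _ (circleMap_mem_unitBall (radius_mem n).1.le (radius_mem n).2 θ)
  have hHc : ∀ n, Continuous fun θ : ℝ => H (circleMap 0 (radius n) θ) := fun n =>
    continuous_comp_circleMap hH (radius_mem n).1.le (radius_mem n).2
  have hHsm : Measurable Hs :=
    measurable_of_tendsto_metrizable (fun n => (hHc n).measurable)
      (tendsto_pi_nhds.2 fun θ => (hrad θ).comp tendsto_radius_left)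
  have hfin : IsFiniteMeasure (volume.restrict (Ioc 0 (2 * Real.pi))) := inferInstance
  have hlim : Tendsto (fun n => ∫⁻ θ in Ioc 0 (2 * Real.pi), ‖H (circleMap 0 (radius n) θ) - Hs θ‖ₑ)
      atTop (𝓝 0) := by
    rw [← lintegral_zero (μ := volume.restrict (Ioc 0 (2 * Real.pi)))]
    refine tendsto_lintegral_of_dominated_convergence (fun _ => ENNReal.ofReal (K₁ + K₁))
      (fun n => ((hHc n).measurable.sub hHsm).enorm) (fun n => Eventually.of_forall fun θ => ?_) ?_
      (Eventually.of_forall fun θ => ?_)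
    · simp only [← ofReal_norm]
      exact ENNReal.ofReal_le_ofReal ((norm_sub_le _ _).trans (add_le_add
        (hHb _ (circleMap_mem_unitBall (radius_mem n).1.le (radius_mem n).2 θ)) (hHsb θ)))
    · rw [lintegral_const]
      exact (ENNReal.mul_lt_top ENNReal.ofReal_lt_top (measure_lt_top _ _)).ne
    · have := (((hrad θ).comp tendsto_radius_left).sub_const (Hs θ)).enorm
      simpa using this
  have hHsint : IntegrableOn Hs (Ioc 0 (2 * Real.pi)) :=
    Measure.integrableOn_of_bounded measure_Ioc_lt_top.ne hHsm.aestronglyMeasurable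
      (Eventually.of_forall hHsb)
  have hz1 : ‖z‖ < 1 := hz.1
  have hzb : z ∈ Metric.ball (0 : ℂ) 1 := by rwa [mem_ball_zero_iff]
  set d : ℝ := 1 - ‖z‖ ^ 2 with hd
  have hd0 : 0 < d := by nlinarith [norm_nonneg z]
  set U : Set ℂ := {w | 1 - (starRingEnd ℂ) z * w ≠ 0} with hU
  have hUo : IsOpen U := isOpen_ne_fun (by fun_prop) continuous_const
  have hUsub : Metric.closedBall 0 1 ⊆ U := by
    intro w hw h0
    rw [mem_closedBall_zero_iff] at hw
    have h1 : ‖(starRingEnd ℂ) z * w‖ = 1 := by rw [← sub_eq_zero.1 h0]; simp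
    rw [norm_mul, RCLike.norm_conj] at h1
    nlinarith [norm_nonneg z, norm_nonneg w]
  set B : ℂ → ℂ := fun w => d / (1 - (starRingEnd ℂ) z * w) with hB
  have hBd : DifferentiableOn ℂ B U := by
    intro w hw
    have h1 : DifferentiableAt ℂ (fun w => 1 - (starRingEnd ℂ) z * w) w :=
      (differentiableAt_id.const_mul _).const_sub 1
    exact ((differentiableAt_const _).div h1 hw).differentiableWithinAt
  have hBz : B z = 1 := by
    have h1 : 1 - (starRingEnd ℂ) z * z = d := by
      rw [mul_comm, Complex.mul_conj, Complex.normSq_eq_norm_sq, hd]; push_cast; ring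
    simp only [hB, h1]
    exact div_self (by exact_mod_cast hd0.ne')
  -- A = 1-(1-B)², so A-1 vanishes to second order at z, while |A| ≤ 4|B| on the circle because |B|
  -- ≤ 2 there.
  set A : ℂ → ℂ := fun w => 2 * B w - B w * B w with hA
  have hAd : DifferentiableOn ℂ A U := (hBd.const_mul 2).sub (hBd.mul hBd)
  have hAz : A z = 1 := by simp only [hA, hBz]; norm_num
  have hAz' : deriv A z = 0 := by
    have h1 := (hBd.differentiableAt (hUo.mem_nhds (hUsub (Metric.ball_subset_closedBall hzb)))).hasDerivAt
    have h2 : HasDerivAt A _ z := (h1.const_mul 2).sub (h1.mul h1)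
    rw [h2.deriv, hBz]; ring
  have hmain := deriv_eq_integral_of_tendsto_L1 hH hUo hUsub hAd hzb hAz hAz' hHsint radius_mem
    tendsto_radius hlim
  set c₁ : ℝ := 4 * (1 + M) * ε
  set c₂ : ℝ := 4 * K * (1 + M) ^ 3 * d
  have hzne : ∀ θ, 0 < ‖circleMap 0 1 θ - z‖ := fun θ =>
    norm_pos_iff.2 (sub_ne_zero.2 (circleMap_ne_mem_ball hzb θ))
  have hpt : ∀ θ : ℝ, ‖circleMap 0 1 θ * ((circleMap 0 1 θ - z) ^ 2)⁻¹ * A (circleMap 0 1 θ) * Hs θ‖ ≤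
      c₁ * (d / ‖circleMap 0 1 θ - z‖ ^ 2) + c₂ := by
    intro θ
    set ζ := circleMap 0 1 θ with hζ
    have hζ1 : ‖ζ‖ = 1 := norm_circleMap_one θ
    have hζz : 0 < ‖ζ - z‖ := hzne θ
    have h1 : ‖1 - (starRingEnd ℂ) z * ζ‖ = ‖ζ - z‖ := by
      have : 1 - (starRingEnd ℂ) z * ζ = ζ * (starRingEnd ℂ) (ζ - z) := by
        rw [map_sub, mul_sub, Complex.mul_conj, Complex.normSq_eq_norm_sq, hζ1]; push_cast; ring
      rw [this, norm_mul, RCLike.norm_conj, hζ1, one_mul]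
    have h2 : ‖B ζ‖ = d / ‖ζ - z‖ := by
      simp only [hB]; rw [norm_div, h1, Complex.norm_real, Real.norm_of_nonneg hd0.le]
    have h3 : 1 - ‖z‖ ≤ ‖ζ - z‖ := by rw [← hζ1]; exact norm_sub_norm_le _ _
    have h4 : ‖B ζ‖ ≤ 2 := by
      rw [h2, div_le_iff₀ hζz]; nlinarith [norm_nonneg z]
    have h5 : ‖A ζ‖ ≤ 4 * (d / ‖ζ - z‖) := by
      rw [← h2]
      calc ‖A ζ‖ ≤ ‖2 * B ζ‖ + ‖B ζ * B ζ‖ := norm_sub_le _ _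
        _ = 2 * ‖B ζ‖ + ‖B ζ‖ * ‖B ζ‖ := by rw [norm_mul, norm_mul]; norm_num
        _ ≤ _ := by nlinarith [norm_nonneg (B ζ)]
    have h6 : ‖ζ - ζ₀‖ ≤ (1 + M) * ‖ζ - z‖ := by
      have h7 : ‖ζ - ζ₀‖ ≤ ‖ζ - z‖ + ‖ζ₀ - z‖ := by
        have := norm_sub_le (ζ - z) (ζ₀ - z); rwa [sub_sub_sub_cancel_right] at this
      have h8 : ‖ζ₀ - z‖ < M * (1 - ‖z‖) := hz.2
      nlinarith
    have h7 : ‖Hs θ‖ ≤ ε * ((1 + M) * ‖ζ - z‖) + K * ((1 + M) * ‖ζ - z‖) ^ 3 :=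
      (hb θ).trans (by gcongr)
    rw [norm_mul, norm_mul, norm_mul, norm_inv, norm_pow, hζ1, one_mul]
    calc (‖ζ - z‖ ^ 2)⁻¹ * ‖A ζ‖ * ‖Hs θ‖ ≤ (‖ζ - z‖ ^ 2)⁻¹ * (4 * (d / ‖ζ - z‖)) *
          (ε * ((1 + M) * ‖ζ - z‖) + K * ((1 + M) * ‖ζ - z‖) ^ 3) := by gcongr
      _ = _ := by simp only [c₁, c₂]; field_simp
  have hPc : Continuous fun θ : ℝ => d / ‖circleMap 0 1 θ - z‖ ^ 2 :=
    Continuous.div continuous_const (by fun_prop) fun θ => pow_ne_zero 2 (hzne θ).ne'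
  rw [hmain, norm_mul]
  have hpi := Real.pi_pos
  have hle := intervalIntegral.norm_integral_le_of_norm_le (μ := volume) Real.two_pi_pos.le
    (Eventually.of_forall fun θ _ => hpt θ)
    (((hPc.const_mul c₁).add continuous_const).intervalIntegrable 0 (2 * Real.pi))
  rw [intervalIntegral.integral_add ((hPc.const_mul c₁).intervalIntegrable _ _)
    (continuous_const.intervalIntegrable _ _), intervalIntegral.integral_const_mul,
    integral_inv_sq_norm_sub hzb, intervalIntegral.integral_const] at hle
  have h9 : ‖(2 * Real.pi : ℂ)⁻¹‖ = (2 * Real.pi)⁻¹ := by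
    rw [norm_inv, norm_mul, Complex.norm_real, Real.norm_of_nonneg hpi.le]; norm_num
  rw [h9]
  calc _ ≤ (2 * Real.pi)⁻¹ * (c₁ * (2 * Real.pi) + (2 * Real.pi - 0) • c₂) := by gcongr
    _ = _ := by rw [smul_eq_mul]; field_simp; ring

/-- Fatou's theorem at a point: the derivative of a bounded analytic function `G` has a
nontangential limit wherever the radial boundary function of `G` is differentiable. -/
theorem hasNontangentialLimit_of_hasDerivAt {G : ℂ → ℂ}
    (hG : DifferentiableOn ℂ G (Metric.ball 0 1)) {K₀ : ℝ}
    (hK₀ : ∀ z ∈ Metric.ball (0 : ℂ) 1, ‖G z‖ ≤ K₀) {F : ℝ → ℂ}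
    (hF : ∀ θ, Tendsto (fun r : ℝ => G (circleMap 0 r θ)) (𝓝[<] 1) (𝓝 (F θ)))
    {F' : ℂ} {θ₀ : ℝ} (hd : HasDerivAt F F' θ₀) :
    HasNontangentialLimit (deriv G) (circleMap 0 1 θ₀) (F' / (circleMap 0 1 θ₀ * Complex.I)) := by
  intro M hM
  set ζ₀ := circleMap 0 1 θ₀ with hζ₀
  set L := F' / (ζ₀ * Complex.I) with hL
  set Hs : ℝ → ℂ := fun θ => F θ - F θ₀ - L * (circleMap 0 1 θ - ζ₀) with hHs
  -- Subtracting the first-order part reduces the claim to a boundary function with value and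
  -- derivative zero at θ₀.
  set H : ℂ → ℂ := fun w => G w - F θ₀ - L * (w - ζ₀) with hH
  have hζ0 : ζ₀ ≠ 0 := circleMap_one_ne_zero θ₀
  have hHd : DifferentiableOn ℂ H (Metric.ball 0 1) := by
    refine (hG.sub_const _).sub ?_
    fun_prop
  have hHderiv : ∀ z ∈ Metric.ball (0 : ℂ) 1, deriv H z = deriv G z - L := by
    intro z hz
    have h1 := (hG.differentiableAt (Metric.isOpen_ball.mem_nhds hz)).hasDerivAt
    have h2 : HasDerivAt H (deriv G z - L * 1) z :=
      (h1.sub_const _).sub (((hasDerivAt_id z).sub_const ζ₀).const_mul L)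
    rw [h2.deriv, mul_one]
  have hrad : ∀ θ, Tendsto (fun r : ℝ => H (circleMap 0 r θ)) (𝓝[<] 1) (𝓝 (Hs θ)) := by
    intro θ
    have hc : Tendsto (fun r : ℝ => circleMap 0 r θ) (𝓝[<] 1) (𝓝 (circleMap 0 1 θ)) := by
      exact ((continuous_circleMap_radius θ).tendsto 1).mono_left nhdsWithin_le_nhds
    exact ((hF θ).sub_const _).sub ((hc.sub_const _).const_mul L)
  set K₁ := K₀ + ‖F θ₀‖ + ‖L‖ * 2 with hK₁
  have hHb : ∀ z ∈ Metric.ball (0 : ℂ) 1, ‖H z‖ ≤ K₁ := by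
    intro z hz
    have h1 : ‖z - ζ₀‖ ≤ 2 := by
      refine (norm_sub_le _ _).trans ?_
      rw [hζ₀, norm_circleMap_one]; rw [mem_ball_zero_iff] at hz; linarith
    calc ‖H z‖ ≤ ‖G z - F θ₀‖ + ‖L * (z - ζ₀)‖ := norm_sub_le _ _
      _ ≤ ‖G z‖ + ‖F θ₀‖ + ‖L‖ * ‖z - ζ₀‖ := by rw [norm_mul]; gcongr; exact norm_sub_le _ _
      _ ≤ K₁ := by rw [hK₁]; gcongr; exact hK₀ z hz
  have hHsb : ∀ θ, ‖Hs θ‖ ≤ K₁ := by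
    intro θ
    refine le_of_tendsto ((hrad θ).comp tendsto_radius_left).norm (Eventually.of_forall fun n => ?_)
    exact hHb _ (circleMap_mem_unitBall (radius_mem n).1.le (radius_mem n).2 θ)
  have hHs0 : HasDerivAt Hs 0 θ₀ := by
    have h1 := (hd.sub_const (F θ₀)).sub
      (((hasDerivAt_circleMap 0 1 θ₀).sub_const ζ₀).const_mul L)
    convert! h1 using 1
    rw [hL, ← hζ₀, div_mul_cancel₀ _ (mul_ne_zero hζ0 Complex.I_ne_zero), sub_self]
  have hper : Function.Periodic (fun θ => (Hs θ, circleMap 0 1 θ)) (2 * Real.pi) := fun θ => by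
    simp only [Prod.mk.injEq]
    exact ⟨periodic_of_radial_limit hrad θ, periodic_circleMap 0 1 θ⟩
  have hbound : ∀ ε : ℝ, 0 < ε → ∃ K : ℝ, 0 ≤ K ∧ ∀ θ,
      ‖Hs θ‖ ≤ ε * ‖circleMap 0 1 θ - ζ₀‖ + K * ‖circleMap 0 1 θ - ζ₀‖ ^ 3 := by
    intro ε hε
    have hpi := Real.pi_pos
    obtain ⟨η, hη, h3⟩ := Metric.eventually_nhds_iff.1
      ((hasDerivAt_iff_isLittleO.1 hHs0).def (show 0 < ε * (2 / Real.pi) by positivity))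
    have hHs00 : Hs θ₀ = 0 := by simp [hHs, hζ₀]
    have hK1 : 0 ≤ K₁ := (norm_nonneg _).trans (hHsb 0)
    -- Within η of θ₀ differentiability gives the linear term. Farther away the chord is at least
    -- 2η/π, so the uniform bound K₁ fits under the cubic term.
    refine ⟨K₁ / (2 / Real.pi * η) ^ 3, by positivity, fun θ => ?_⟩
    obtain ⟨t, ht, hte⟩ := hper.exists_mem_Ico Real.two_pi_pos θ (θ₀ - Real.pi)
    rw [Prod.mk.injEq] at hte
    rw [hte.1, hte.2]
    have h4 : |t - θ₀| ≤ Real.pi := abs_le.2 ⟨by linarith [ht.1], by linarith [ht.2]⟩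
    have h5 := abs_le_norm_circleMap_sub h4
    rw [← hζ₀] at h5
    have h6 : 2 / Real.pi * |t - θ₀| ≤ ‖circleMap 0 1 t - ζ₀‖ := by
      calc _ ≤ 2 / Real.pi * (Real.pi / 2 * ‖circleMap 0 1 t - ζ₀‖) := by gcongr
        _ = _ := by field_simp
    rcases lt_or_ge |t - θ₀| η with h7 | h7
    · have h8 := h3 (y := t) (by rwa [Real.dist_eq])
      rw [hHs00, smul_zero, sub_zero, sub_zero, Real.norm_eq_abs, mul_assoc] at h8
      have h9 : ε * (2 / Real.pi * |t - θ₀|) ≤ ε * ‖circleMap 0 1 t - ζ₀‖ := by gcongr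
      have h10 : 0 ≤ K₁ / (2 / Real.pi * η) ^ 3 * ‖circleMap 0 1 t - ζ₀‖ ^ 3 := by positivity
      linarith
    · have h8 : 2 / Real.pi * η ≤ ‖circleMap 0 1 t - ζ₀‖ := le_trans (by gcongr) h6
      calc ‖Hs t‖ ≤ K₁ := hHsb t
        _ = K₁ / (2 / Real.pi * η) ^ 3 * (2 / Real.pi * η) ^ 3 := by field_simp
        _ ≤ K₁ / (2 / Real.pi * η) ^ 3 * ‖circleMap 0 1 t - ζ₀‖ ^ 3 := by gcongr
        _ ≤ _ := by
          have : 0 ≤ ε * ‖circleMap 0 1 t - ζ₀‖ := by positivity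
          linarith
  rw [Metric.tendsto_nhdsWithin_nhds]
  intro ε hε
  have hM1 : 0 < 1 + M := by linarith
  -- This ε makes the linear contribution 4(1+M)ε/(8(1+M)) = ε/2; the radius below makes the cubic
  -- one at most ε/4.
  obtain ⟨K, hK, hb⟩ := hbound (ε / (8 * (1 + M))) (by positivity)
  refine ⟨ε / (32 * (K + 1) * (1 + M) ^ 3), by positivity, fun z hz hzd => ?_⟩
  have hz1 : ‖z‖ < 1 := hz.1
  have hzb : z ∈ Metric.ball (0 : ℂ) 1 := by rwa [mem_ball_zero_iff]
  have h1 := norm_deriv_le_of_boundary_le hHd hHb hrad (by linarith) (by positivity) hK hz hb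
  rw [hHderiv z hzb] at h1
  rw [dist_eq_norm]
  have h2 : 1 - ‖z‖ ^ 2 ≤ 2 * dist z ζ₀ := by
    have h3 : 1 - ‖z‖ ≤ dist z ζ₀ := by
      rw [dist_comm, dist_eq_norm, ← norm_circleMap_one θ₀]; exact norm_sub_norm_le _ _
    nlinarith [norm_nonneg z]
  have h3 : 4 * K * (1 + M) ^ 3 * (1 - ‖z‖ ^ 2) ≤ ε / 4 := by
    calc _ ≤ 4 * (K + 1) * (1 + M) ^ 3 * (2 * (ε / (32 * (K + 1) * (1 + M) ^ 3))) := by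
          have h4 : 0 ≤ 1 - ‖z‖ ^ 2 := by nlinarith [norm_nonneg z]
          have h5 : 1 - ‖z‖ ^ 2 ≤ 2 * (ε / (32 * (K + 1) * (1 + M) ^ 3)) := by linarith
          gcongr
          linarith
      _ = ε / 4 := by field_simp; ring
  have h4 : 4 * (1 + M) * (ε / (8 * (1 + M))) = ε / 2 := by field_simp; ring
  rw [h4] at h1
  linarith

end

/-! ### Existence of the boundary function in H^q. -/

theorem integralMean_eq (q r : ℝ) (f : ℂ → ℂ) :
    integralMean q r f = circleMean q fun θ => f (circleMap 0 r θ) := by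
  simp [integralMean, circleMap]

theorem lintegral_period_rpow (q : ℝ) (hq : 0 < q) (F : ℝ → ℂ) :
    ∫⁻ θ in Ioc 0 (2 * Real.pi), ‖F θ‖ₑ ^ q = ENNReal.ofReal (2 * Real.pi) * circleMean q F ^ q := by
  rw [circleMean, ← ENNReal.rpow_mul, one_div_mul_cancel hq.ne', ENNReal.rpow_one,
    ENNReal.mul_div_cancel ofReal_two_pi_ne_zero ENNReal.ofReal_ne_top]

theorem lintegral_arc_le {q : ℝ} (hq : 1 < q) {F : ℝ → ℂ} (hF : Measurable F)
    (hper : Function.Periodic F (2 * Real.pi)) {a b : ℝ} (hba : b ≤ a + 2 * Real.pi) :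
    ∫⁻ θ in Ioc a b, ‖F θ‖ₑ ≤
      ENNReal.ofReal (2 * Real.pi) ^ (1 / q) * circleMean q F * ENNReal.ofReal (b - a) ^ (1 - 1 / q) := by
  have hq0 : 0 < q := by linarith
  have hqc := Real.HolderConjugate.conjExponent hq
  have h1 := ENNReal.lintegral_mul_le_Lp_mul_Lq (volume.restrict (Ioc a b)) hqc
    (f := fun θ => ‖F θ‖ₑ) (g := fun _ => 1) hF.enorm.aemeasurable aemeasurable_const
  have e1 : 1 / q.conjExponent = 1 - 1 / q := by
    have := hqc.inv_add_inv_eq_one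
    rw [one_div, one_div]; linarith
  simp only [Pi.mul_apply, mul_one, ENNReal.one_rpow, lintegral_const, Measure.restrict_apply_univ,
    Real.volume_Ioc, one_mul, e1] at h1
  refine h1.trans ?_
  gcongr
  calc (∫⁻ θ in Ioc a b, ‖F θ‖ₑ ^ q) ^ (1 / q)
      ≤ (∫⁻ θ in Ioc a (a + 2 * Real.pi), ‖F θ‖ₑ ^ q) ^ (1 / q) :=
        ENNReal.rpow_le_rpow (lintegral_mono_set (Ioc_subset_Ioc_right hba)) (by positivity)
    _ = (∫⁻ θ in Ioc 0 (2 * Real.pi), ‖F θ‖ₑ ^ q) ^ (1 / q) := by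
        congr 1
        have := setLIntegral_period_eq (f := fun θ => ‖F θ‖ₑ ^ q) Real.two_pi_pos
          (fun θ => by simp [hper θ]) a 0
        rwa [zero_add] at this
    _ = _ := by
        rw [lintegral_period_rpow q hq0, ENNReal.mul_rpow_of_nonneg _ _ (by positivity),
          ← ENNReal.rpow_mul, mul_one_div_cancel hq0.ne', ENNReal.rpow_one]

theorem hasDerivAt_comp_circleMap {G : ℂ → ℂ} {g' : ℂ} {r θ : ℝ}
    (hG : HasDerivAt G g' (circleMap 0 r θ)) :
    HasDerivAt (fun t => G (circleMap 0 r t)) (circleMap 0 r θ * Complex.I * g') θ := by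
  have := HasDerivAt.scomp θ hG (hasDerivAt_circleMap 0 r θ)
  simpa [smul_eq_mul] using! this

theorem hasDerivAt_comp_circleMap_radius {G : ℂ → ℂ} {g' : ℂ} {r θ : ℝ}
    (hG : HasDerivAt G g' (circleMap 0 r θ)) :
    HasDerivAt (fun t : ℝ => G (circleMap 0 t θ)) (circleMap 0 1 θ * g') r := by
  have h1 : HasDerivAt (fun t : ℝ => circleMap 0 t θ) (circleMap 0 1 θ) r := by
    have h2 := (Complex.ofRealCLM.hasDerivAt (x := r)).mul_const (circleMap 0 1 θ)
    simp only [Complex.ofRealCLM_apply, Complex.ofReal_one, one_mul] at h2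
    exact h2.congr_of_eventuallyEq (Eventually.of_forall fun t => circleMap_zero_eq_mul t θ)
  have := HasDerivAt.scomp r hG h1
  simpa [smul_eq_mul] using! this

section Primitive

variable {g G : ℂ → ℂ}

theorem enorm_primitive_arc_le (hg : AnalyticInDisc g)
    (hG : ∀ z ∈ Metric.ball (0 : ℂ) 1, HasDerivAt G (g z) z) {r a b : ℝ} (hr0 : 0 ≤ r) (hr : r < 1)
    (hab : a ≤ b) : ‖G (circleMap 0 r b) - G (circleMap 0 r a)‖ₑ ≤
      ∫⁻ θ in Ioc a b, ‖g (circleMap 0 r θ)‖ₑ := by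
  have hc := continuous_comp_circleMap hg hr0 hr
  refine (enorm_sub_le_lintegral_of_hasDerivAt hab
    (fun t _ => hasDerivAt_comp_circleMap (hG _ (circleMap_mem_unitBall hr0 hr t)))
    (((continuous_circleMap 0 r).mul continuous_const).mul hc).continuousOn).trans
    (lintegral_mono fun θ => ?_)
  rw [enorm_mul, enorm_mul]
  have h1 : ‖circleMap 0 r θ‖ₑ ≤ 1 := by
    rw [← ofReal_norm, norm_circleMap_zero, abs_of_nonneg hr0]
    exact ENNReal.ofReal_le_one.2 hr.le
  have h2 : ‖Complex.I‖ₑ = 1 := by rw [← ofReal_norm]; simp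
  rw [h2, mul_one]
  calc _ ≤ 1 * ‖g (circleMap 0 r θ)‖ₑ := by gcongr
    _ = _ := one_mul _

/-- By Hölder on the arc, the primitive is Hölder continuous of exponent 1-1/q along circles,
uniformly in the radius. -/
theorem norm_primitive_arc_le {q : ℝ} (hq : 1 < q) (hg : AnalyticInDisc g)
    (hG : ∀ z ∈ Metric.ball (0 : ℂ) 1, HasDerivAt G (g z) z) {r a b B : ℝ} (hr0 : 0 ≤ r) (hr : r < 1)
    (hB0 : 0 ≤ B) (hB : integralMean q r g ≤ ENNReal.ofReal B)
    (hab : a ≤ b) (hba : b ≤ a + 2 * Real.pi) :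
    ‖G (circleMap 0 r b) - G (circleMap 0 r a)‖ ≤
      (2 * Real.pi) ^ (1 / q) * B * (b - a) ^ (1 - 1 / q) := by
  have hpi := Real.pi_pos
  have hq1 : 1 / q < 1 := by rw [div_lt_one (by linarith)]; exact hq
  have hb0 : 0 ≤ b - a := by linarith
  rw [← ENNReal.ofReal_le_ofReal_iff (by positivity), ofReal_norm, ENNReal.ofReal_mul (by positivity),
    ENNReal.ofReal_mul (by positivity), ← ENNReal.ofReal_rpow_of_nonneg (by positivity) (by positivity),
    ← ENNReal.ofReal_rpow_of_nonneg (by positivity) (by linarith)]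
  refine (enorm_primitive_arc_le hg hG hr0 hr hab).trans ?_
  refine (lintegral_arc_le hq (continuous_comp_circleMap hg hr0 hr).measurable
    (fun θ => by rw [periodic_circleMap 0 r θ]) hba).trans ?_
  rw [← integralMean_eq]
  gcongr

/-- A growth bound for g = G' from tangential increments of G alone: first g varies little along an
arc of length comparable to δ = 1-|z|, then the increment of G over that arc determines g(z). -/
theorem norm_le_of_arc_le {r₀ C γ : ℝ} (hC : 0 ≤ C)
    (hγ : 0 ≤ γ) (hG : ∀ z ∈ Metric.ball (0 : ℂ) 1, HasDerivAt G (g z) z)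
    (harc : ∀ r ∈ Ioo r₀ 1, ∀ a b : ℝ, a ≤ b → b ≤ a + 2 * Real.pi →
      ‖G (circleMap 0 r b) - G (circleMap 0 r a)‖ ≤ C * (b - a) ^ γ)
    {z : ℂ} (hz1 : ‖z‖ < 1) (hz2 : 1 / 2 ≤ ‖z‖) (hz3 : (1 + 2 * r₀) / 3 < ‖z‖) :
    ‖g z‖ ≤ 6 * C * (1 - ‖z‖) ^ (γ - 1) := by
  have hpi := Real.pi_gt_three
  set δ := 1 - ‖z‖ with hδ
  have hδ0 : 0 < δ := by linarith
  set α := Complex.arg z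
  have hzα : z = circleMap 0 ‖z‖ α := by
    rw [circleMap, zero_add, Complex.norm_mul_exp_arg_mul_I]
  have hrot : ∀ u : ℝ, ∀ w ∈ Metric.ball (0 : ℂ) 1, circleMap 0 1 u * w ∈ Metric.ball (0 : ℂ) 1 := by
    intro u w hw
    rw [mem_ball_zero_iff] at hw ⊢
    rwa [norm_mul, norm_circleMap_one, one_mul]
  have hzb : z ∈ Metric.ball (0 : ℂ) 1 := by rwa [mem_ball_zero_iff]
  -- Cauchy's estimate for w ↦ G(e^{iu}w) - G(w) on the disc of radius δ/2 about z. The lower bound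
  -- (1+2r₀)/3 on |z| keeps this disc in |w| > r₀.
  have hdiff : ∀ u ∈ Ico 0 δ, ‖circleMap 0 1 u * g (circleMap 0 1 u * z) - g z‖ ≤
      2 * C * δ ^ (γ - 1) := by
    intro u hu
    have hHd : ∀ w ∈ Metric.ball (0 : ℂ) 1, HasDerivAt (fun w => G (circleMap 0 1 u * w) - G w)
        (circleMap 0 1 u * g (circleMap 0 1 u * w) - g w) w := by
      intro w hw
      have h1 := HasDerivAt.comp w (hG _ (hrot u w hw)) ((hasDerivAt_id w).const_mul (circleMap 0 1 u))
      rw [mul_one, mul_comm] at h1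
      exact h1.sub (hG w hw)
    have hsub : Metric.closedBall z (δ / 2) ⊆ Metric.ball 0 1 := by
      intro w hw
      rw [mem_closedBall_iff_norm] at hw
      rw [mem_ball_zero_iff]
      have := norm_le_norm_add_norm_sub' w z
      linarith
    have h1 := Complex.norm_deriv_le_of_forall_mem_sphere_norm_le
      (f := fun w => G (circleMap 0 1 u * w) - G w) (c := z) (R := δ / 2) (C := C * δ ^ γ)
      (by positivity)
      (DifferentiableOn.diffContOnCl_ball (U := Metric.ball 0 1)
        (fun w hw => (hHd w hw).differentiableAt.differentiableWithinAt) hsub) ?_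
    · rw [(hHd z hzb).deriv] at h1
      refine h1.trans_eq ?_
      rw [Real.rpow_sub_one hδ0.ne']; field_simp
    · intro w hw
      have hw1 := hsub (Metric.sphere_subset_closedBall hw)
      rw [mem_ball_zero_iff] at hw1
      have hw2 : r₀ < ‖w‖ := by
        rw [mem_sphere_iff_norm] at hw
        have := norm_sub_norm_le z w
        rw [norm_sub_rev] at this
        linarith
      have hwα : w = circleMap 0 ‖w‖ (Complex.arg w) := by
        rw [circleMap, zero_add, Complex.norm_mul_exp_arg_mul_I]
      have h2 := harc ‖w‖ ⟨hw2, hw1⟩ (Complex.arg w) (Complex.arg w + u) (by linarith [hu.1])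
        (by linarith [hu.2])
      rw [circleMap_zero_add, ← hwα, add_sub_cancel_left] at h2
      refine h2.trans ?_
      have := Real.rpow_le_rpow hu.1 hu.2.le hγ
      gcongr
  -- Error of replacing G(e^{iu}z) by its linear part u·izg(z); `hdiff` bounds its derivative. In
  -- all δ|z||g(z)| ≤ 3Cδ^γ, and |z| ≥ 1/2 doubles the 3 to 6.
  set ψ : ℝ → ℂ := fun u => G (circleMap 0 1 u * z) - u * (z * Complex.I * g z) with hψ
  have hψd : ∀ u : ℝ, HasDerivAt ψ
      (z * Complex.I * (circleMap 0 1 u * g (circleMap 0 1 u * z) - g z)) u := by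
    intro u
    have h1 : HasDerivAt (fun u : ℝ => circleMap 0 1 u * z) (circleMap 0 1 u * Complex.I * z) u :=
      (hasDerivAt_circleMap 0 1 u).mul_const z
    have h2 := HasDerivAt.scomp u (hG _ (hrot u z hzb)) h1
    have h3 := (Complex.ofRealCLM.hasDerivAt (x := u)).mul_const (z * Complex.I * g z)
    have h4 := h2.sub h3
    convert! h4 using 1
    simp only [smul_eq_mul, Complex.ofRealCLM_apply, Complex.ofReal_one]; ring
  have h5 := norm_image_sub_le_of_norm_deriv_le_segment' (f := ψ) (a := 0) (b := δ)
    (C := 2 * C * δ ^ (γ - 1)) (fun u _ => (hψd u).hasDerivWithinAt) (fun u hu => by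
      rw [norm_mul, norm_mul, Complex.norm_I, mul_one]
      calc _ ≤ 1 * (2 * C * δ ^ (γ - 1)) := by
            have := hdiff u hu
            gcongr
        _ = _ := one_mul _) δ ⟨hδ0.le, le_rfl⟩
  have h6 := harc ‖z‖ ⟨by linarith, hz1⟩ α (α + δ) (by linarith) (by linarith)
  rw [circleMap_zero_add, ← hzα, add_sub_cancel_left] at h6
  have h7 : ψ δ - ψ 0 = (G (circleMap 0 1 δ * z) - G z) - δ * (z * Complex.I * g z) := by
    simp [hψ, circleMap]; ring
  rw [h7, sub_zero] at h5
  have h8 : ‖(δ : ℂ) * (z * Complex.I * g z)‖ = δ * ‖z‖ * ‖g z‖ := by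
    rw [norm_mul, norm_mul, norm_mul, Complex.norm_I, mul_one, Complex.norm_real,
      Real.norm_of_nonneg hδ0.le, mul_assoc]
  have h9 : δ * ‖z‖ * ‖g z‖ ≤ C * δ ^ γ + 2 * C * δ ^ (γ - 1) * δ := by
    rw [← h8]
    have := norm_sub_le (G (circleMap 0 1 δ * z) - G z)
      ((G (circleMap 0 1 δ * z) - G z) - δ * (z * Complex.I * g z))
    rw [sub_sub_cancel] at this
    linarith
  have h10 : δ ^ γ = δ ^ (γ - 1) * δ := by rw [Real.rpow_sub_one hδ0.ne']; field_simp
  rw [h10] at h9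
  have h11 : ‖z‖ * ‖g z‖ ≤ 3 * C * δ ^ (γ - 1) := by
    refine le_of_mul_le_mul_left ?_ hδ0
    linarith
  nlinarith [norm_nonneg (g z)]

/-- Since γ > 0, the bound (1-r)^{γ-1} is integrable up to r = 1, so G is uniformly Cauchy along
radii. -/
theorem exists_radial_limit {r₁ C γ : ℝ} (hr₁ : 0 ≤ r₁) (hr₁' : r₁ < 1)
    (hγ : 0 < γ) (hG : ∀ z ∈ Metric.ball (0 : ℂ) 1, HasDerivAt G (g z) z)
    (hb : ∀ z : ℂ, r₁ ≤ ‖z‖ → ‖z‖ < 1 → ‖g z‖ ≤ C * (1 - ‖z‖) ^ (γ - 1)) :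
    (∃ K : ℝ, ∀ z ∈ Metric.ball (0 : ℂ) 1, ‖G z‖ ≤ K) ∧
      ∃ F : ℝ → ℂ, ∀ θ, Tendsto (fun r : ℝ => G (circleMap 0 r θ)) (𝓝[<] 1) (𝓝 (F θ)) := by
  have hC : 0 ≤ C := by
    have h1 := hb r₁ (by simp [abs_of_nonneg hr₁]) (by simp [abs_of_nonneg hr₁, hr₁'])
    have h2 : 0 < (1 - ‖(r₁ : ℂ)‖) ^ (γ - 1) :=
      Real.rpow_pos_of_pos (by simp [abs_of_nonneg hr₁, hr₁']) _
    exact nonneg_of_mul_nonneg_left ((norm_nonneg _).trans h1) h2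
  have hrad : ∀ θ r s : ℝ, r₁ ≤ r → r ≤ s → s < 1 →
      ‖G (circleMap 0 s θ) - G (circleMap 0 r θ)‖ ≤ C / γ * (1 - r) ^ γ := by
    intro θ r s hr hrs hs
    have hmem : ∀ u ∈ Icc r s, 0 ≤ u ∧ u < 1 := fun u hu => ⟨hr₁.trans (hr.trans hu.1), hu.2.trans_lt hs⟩
    have hd : ∀ u ∈ Icc r s, HasDerivAt (fun t : ℝ => G (circleMap 0 t θ))
        (circleMap 0 1 θ * g (circleMap 0 u θ)) u := fun u hu =>
      hasDerivAt_comp_circleMap_radius (hG _ (circleMap_mem_unitBall (hmem u hu).1 (hmem u hu).2 θ))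
    have hBd : ∀ u ∈ Icc r s, HasDerivAt (fun t : ℝ => C / γ * (1 - r) ^ γ - C / γ * (1 - t) ^ γ)
        (C * (1 - u) ^ (γ - 1)) u := by
      intro u hu
      have h1 := ((hasDerivAt_id u).const_sub 1).rpow_const (p := γ)
        (Or.inl (by have := (hmem u hu).2; simp only [id]; linarith))
      have h2 := (h1.const_mul (C / γ)).const_sub (C / γ * (1 - r) ^ γ)
      convert! h2 using 1
      simp only [id]; field_simp
    have h1 := image_norm_le_of_norm_deriv_right_le_deriv_boundary'
      (f := fun t : ℝ => G (circleMap 0 t θ) - G (circleMap 0 r θ)) (a := r) (b := s)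
      (f' := fun u => circleMap 0 1 θ * g (circleMap 0 u θ))
      (B := fun t : ℝ => C / γ * (1 - r) ^ γ - C / γ * (1 - t) ^ γ)
      (B' := fun u => C * (1 - u) ^ (γ - 1))
      (fun u hu => ((hd u hu).continuousAt.sub continuousAt_const).continuousWithinAt)
      (fun u hu => ((hd u ⟨hu.1, hu.2.le⟩).sub_const _).hasDerivWithinAt) (by simp)
      (fun u hu => (hBd u hu).continuousAt.continuousWithinAt)
      (fun u hu => (hBd u ⟨hu.1, hu.2.le⟩).hasDerivWithinAt)
      (fun u hu => by
        have hu' := hmem u ⟨hu.1, hu.2.le⟩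
        rw [norm_mul, norm_circleMap_one, one_mul]
        have e : ‖circleMap 0 u θ‖ = u := by rw [norm_circleMap_zero, abs_of_nonneg hu'.1]
        have := hb (circleMap 0 u θ) (by rw [e]; exact hr.trans hu.1) (by rw [e]; exact hu'.2)
        rwa [e] at this) (x := s) ⟨hrs, le_rfl⟩
    have h2 : 0 ≤ C / γ * (1 - s) ^ γ := mul_nonneg (by positivity) (Real.rpow_nonneg (by linarith) _)
    linarith
  refine ⟨?_, ?_⟩
  · have hGc : ContinuousOn G (Metric.closedBall 0 r₁) := fun z hz =>
      (hG z (Metric.closedBall_subset_ball hr₁' hz)).continuousAt.continuousWithinAt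
    obtain ⟨K, hK⟩ := (isCompact_closedBall (0 : ℂ) r₁).exists_bound_of_continuousOn hGc
    refine ⟨K + C / γ * (1 - r₁) ^ γ, fun z hz => ?_⟩
    have h0 : 0 ≤ C / γ * (1 - r₁) ^ γ :=
      mul_nonneg (by positivity) (Real.rpow_nonneg (by linarith) _)
    rcases le_or_gt ‖z‖ r₁ with h | h
    · linarith [hK z (by rwa [mem_closedBall_zero_iff])]
    · rw [mem_ball_zero_iff] at hz
      have hzα : z = circleMap 0 ‖z‖ (Complex.arg z) := by
        rw [circleMap, zero_add, Complex.norm_mul_exp_arg_mul_I]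
      have h1 := hrad (Complex.arg z) r₁ ‖z‖ le_rfl h.le hz
      rw [← hzα] at h1
      have h2 := hK (circleMap 0 r₁ (Complex.arg z)) (by simp [abs_of_nonneg hr₁])
      have := norm_le_norm_add_norm_sub' (G z) (G (circleMap 0 r₁ (Complex.arg z)))
      linarith
  · have hex : ∀ θ : ℝ, ∃ l, Tendsto (fun r : ℝ => G (circleMap 0 r θ)) (𝓝[<] 1) (𝓝 l) := by
      intro θ
      rw [← cauchy_map_iff_exists_tendsto, Metric.cauchy_iff]
      refine ⟨inferInstance, fun ε hε => ?_⟩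
      have h1 : Tendsto (fun r : ℝ => C / γ * (1 - r) ^ γ) (𝓝[<] 1) (𝓝 0) := by
        have : ContinuousAt (fun r : ℝ => C / γ * (1 - r) ^ γ) 1 :=
          continuousAt_const.mul ((continuousAt_const.sub continuousAt_id).rpow_const (Or.inr hγ.le))
        have h2 := this.tendsto
        simp only [sub_self, Real.zero_rpow hγ.ne', mul_zero] at h2
        exact h2.mono_left nhdsWithin_le_nhds
      have h2 : ∀ᶠ r : ℝ in 𝓝[<] 1, C / γ * (1 - r) ^ γ < ε / 2 :=
        h1.eventually_lt_const (by positivity)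
      have h3 : ∀ᶠ r : ℝ in 𝓝[<] 1, r ∈ Ioo r₁ 1 := Ioo_mem_nhdsLT hr₁'
      obtain ⟨ρ, hρ1, hρ2⟩ := (h2.and h3).exists
      refine ⟨(fun r : ℝ => G (circleMap 0 r θ)) '' Ioo ρ 1,
        image_mem_map (Ioo_mem_nhdsLT hρ2.2), ?_⟩
      rintro _ ⟨s, hs, rfl⟩ _ ⟨t, ht, rfl⟩
      have h4 := hrad θ ρ s hρ2.1.le hs.1.le hs.2
      have h5 := hrad θ ρ t hρ2.1.le ht.1.le ht.2
      rw [← dist_eq_norm] at h4 h5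
      calc _ ≤ dist (G (circleMap 0 s θ)) (G (circleMap 0 ρ θ)) +
            dist (G (circleMap 0 t θ)) (G (circleMap 0 ρ θ)) := dist_triangle_right _ _ _
        _ < ε := by linarith
    choose F hF using hex
    exact ⟨F, hF⟩

/-- Variation is lower semicontinuous under pointwise limits, and the variation of G on the circle
of radius r is at most the L¹ norm of g there. So F has bounded variation on each period and
Lebesgue's theorem applies. -/
theorem ae_differentiableAt_radial_limit {r₀ : ℝ} {S : ℝ≥0∞} (hS : S ≠ ∞) (hr₀ : 0 ≤ r₀)
    (hr₀' : r₀ < 1) (hg : AnalyticInDisc g) (hG : ∀ z ∈ Metric.ball (0 : ℂ) 1, HasDerivAt G (g z) z)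
    (hb : ∀ r ∈ Ioo r₀ 1, ∀ a : ℝ, ∫⁻ θ in Ioc a (a + 2 * Real.pi), ‖g (circleMap 0 r θ)‖ₑ ≤ S)
    {F : ℝ → ℂ} (hF : ∀ θ, Tendsto (fun r : ℝ => G (circleMap 0 r θ)) (𝓝[<] 1) (𝓝 (F θ))) :
    ∀ᵐ θ, DifferentiableAt ℝ F θ := by
  have hbv : ∀ a : ℝ, BoundedVariationOn F (uIcc a (a + 2 * Real.pi)) := by
    intro a
    rw [uIcc_of_le (by linarith [Real.two_pi_pos])]
    refine ne_top_of_le_ne_top hS (le_of_not_gt fun hlt => ?_)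
    have h1 := eVariationOn.lowerSemicontinuous_aux (fun θ _ => hF θ) hlt
    have h2 : ∀ᶠ r : ℝ in 𝓝[<] 1, r ∈ Ioo r₀ 1 := Ioo_mem_nhdsLT hr₀'
    obtain ⟨r, hr1, hr2⟩ := (h1.and h2).exists
    refine absurd hr1 (not_lt.2 ?_)
    refine iSup_le fun P => ?_
    obtain ⟨n, u, hu, hus⟩ := P
    calc ∑ i ∈ Finset.range n, edist (G (circleMap 0 r (u (i + 1)))) (G (circleMap 0 r (u i)))
        ≤ ∑ i ∈ Finset.range n, ∫⁻ θ in Ioc (u i) (u (i + 1)), ‖g (circleMap 0 r θ)‖ₑ := by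
          refine Finset.sum_le_sum fun i _ => ?_
          rw [edist_eq_enorm_sub]
          exact enorm_primitive_arc_le hg hG (hr₀.trans hr2.1.le) hr2.2 (hu (Nat.le_succ i))
      _ = ∫⁻ θ in Ioc (u 0) (u n), ‖g (circleMap 0 r θ)‖ₑ := by
          clear hr1 hlt h1 h2
          induction n with
          | zero => simp
          | succ k ih =>
            rw [Finset.sum_range_succ, ih, ← lintegral_union measurableSet_Ioc,
              Ioc_union_Ioc_eq_Ioc (hu (Nat.zero_le k)) (hu (Nat.le_succ k))]
            exact Ioc_disjoint_Ioc_of_le le_rfl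
      _ ≤ ∫⁻ θ in Ioc a (a + 2 * Real.pi), ‖g (circleMap 0 r θ)‖ₑ :=
          lintegral_mono_set (Ioc_subset_Ioc (hus 0).1 (hus n).2)
      _ ≤ S := hb r hr2 a
  have h1 : ∀ k : ℤ, ∀ᵐ θ : ℝ, θ ∈ uIcc (k * (2 * Real.pi)) (k * (2 * Real.pi) + 2 * Real.pi) →
      DifferentiableAt ℝ F θ := fun k => (hbv _).ae_differentiableAt_of_mem_uIcc
  filter_upwards [ae_all_iff.2 h1] with θ hθ
  refine hθ ⌊θ / (2 * Real.pi)⌋ ?_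
  have hpi := Real.two_pi_pos
  rw [uIcc_of_le (by linarith)]
  have h2 := Int.floor_le (θ / (2 * Real.pi))
  have h3 := Int.lt_floor_add_one (θ / (2 * Real.pi))
  rw [le_div_iff₀ hpi] at h2
  rw [div_lt_iff₀ hpi] at h3
  exact ⟨h2, by linarith⟩

end Primitive

/-- Vitali's theorem for a sequence bounded in `L^q`, `q > 1`. -/
theorem tendsto_lintegral_zero_of_bounded_rpow {α : Type*} [MeasurableSpace α] {μ : Measure α}
    [IsFiniteMeasure μ] {d : ℕ → α → ℝ≥0∞} (hd : ∀ n, Measurable (d n))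
    (hlim : ∀ᵐ x ∂μ, Tendsto (fun n => d n x) atTop (𝓝 0)) {q : ℝ} (hq : 1 < q) {S : ℝ≥0∞}
    (hS : S ≠ ∞) (hb : ∀ᶠ n in atTop, ∫⁻ x, d n x ^ q ∂μ ≤ S) :
    Tendsto (fun n => ∫⁻ x, d n x ∂μ) atTop (𝓝 0) := by
  rw [ENNReal.tendsto_nhds_zero]
  intro ε hε
  have h1 : Tendsto (fun N : ℕ => ((N : ℝ≥0∞) ^ (q - 1))⁻¹ * S) atTop (𝓝 0) := by
    have h2 : Tendsto (fun N : ℕ => (N : ℝ≥0∞) ^ (q - 1)) atTop (𝓝 (∞ ^ (q - 1))) :=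
      (ENNReal.continuous_rpow_const.tendsto _).comp ENNReal.tendsto_nat_nhds_top
    rw [ENNReal.top_rpow_of_pos (by linarith)] at h2
    have h3 := ENNReal.Tendsto.mul_const (b := S) (tendsto_inv_iff.2 h2) (Or.inr hS)
    rwa [ENNReal.inv_top, zero_mul] at h3
  obtain ⟨N, hN, hN1⟩ := ((ENNReal.tendsto_nhds_zero.1 h1 (ε / 2) (ENNReal.half_pos hε.ne')).and
    (eventually_ge_atTop 1)).exists
  -- Above N one has x^{q-1} ≥ N^{q-1}: the unbounded part costs at most N^{1-q} times the q-th
  -- moment, uniformly in the sequence.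
  have hpt : ∀ x : ℝ≥0∞, x ≤ min x N + ((N : ℝ≥0∞) ^ (q - 1))⁻¹ * x ^ q := by
    intro x
    rcases le_or_gt x N with h | h
    · rw [min_eq_left h]; exact le_self_add
    · refine le_add_left ?_
      have hN0 : (N : ℝ≥0∞) ^ (q - 1) ≠ 0 := by
        have : (N : ℝ≥0∞) ≠ 0 := Nat.cast_ne_zero.2 (Nat.one_le_iff_ne_zero.1 hN1)
        simp [ENNReal.rpow_eq_zero_iff, this]
      have hNt : (N : ℝ≥0∞) ^ (q - 1) ≠ ∞ :=
        (ENNReal.rpow_lt_top_of_nonneg (by linarith) (by simp)).ne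
      calc x = ((N : ℝ≥0∞) ^ (q - 1))⁻¹ * ((N : ℝ≥0∞) ^ (q - 1) * x) := by
            rw [← mul_assoc, ENNReal.inv_mul_cancel hN0 hNt, one_mul]
        _ ≤ ((N : ℝ≥0∞) ^ (q - 1))⁻¹ * (x ^ (q - 1) * x) := by gcongr
        _ = ((N : ℝ≥0∞) ^ (q - 1))⁻¹ * x ^ q := by
            conv_rhs => rw [show q = (q - 1) + 1 by ring,
              ENNReal.rpow_add_of_nonneg _ _ (by linarith) zero_le_one, ENNReal.rpow_one]
            ring_nf
  have h2 : Tendsto (fun n => ∫⁻ x, min (d n x) N ∂μ) atTop (𝓝 0) := by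
    rw [← lintegral_zero (μ := μ)]
    refine tendsto_lintegral_of_dominated_convergence (fun _ => (N : ℝ≥0∞))
      (fun n => (hd n).min measurable_const) (fun n => Eventually.of_forall fun x => min_le_right _ _)
      ?_ ?_
    · rw [lintegral_const]; exact (ENNReal.mul_lt_top (by simp) (measure_lt_top _ _)).ne
    · filter_upwards [hlim] with x hx
      have := hx.min (tendsto_const_nhds (x := (N : ℝ≥0∞)))
      rwa [min_eq_left zero_le] at this
  filter_upwards [ENNReal.tendsto_nhds_zero.1 h2 (ε / 2) (ENNReal.half_pos hε.ne'), hb] with n hn1 hn2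
  calc ∫⁻ x, d n x ∂μ ≤ ∫⁻ x, (min (d n x) N + ((N : ℝ≥0∞) ^ (q - 1))⁻¹ * d n x ^ q) ∂μ :=
        lintegral_mono fun x => hpt _
    _ = ∫⁻ x, min (d n x) N ∂μ + ((N : ℝ≥0∞) ^ (q - 1))⁻¹ * ∫⁻ x, d n x ^ q ∂μ := by
        rw [lintegral_add_left ((hd n).min measurable_const),
          lintegral_const_mul _ ((hd n).pow_const q)]
    _ ≤ ε / 2 + ε / 2 := by
        refine add_le_add hn1 (le_trans ?_ hN)
        gcongr
    _ = ε := ENNReal.add_halves ε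

/-- `φ` is a measurable representative of the boundary function `θ ↦ g(e^{iθ})`, to which the
dilates of `g` converge in `L¹`. -/
structure IsBoundaryFunction (g : ℂ → ℂ) (φ : ℝ → ℂ) : Prop where
  measurable : Measurable φ
  periodic : Function.Periodic φ (2 * Real.pi)
  ae_boundaryValue : ∀ᵐ θ, boundaryValue g (circleMap 0 1 θ) = φ θ
  ae_tendsto : ∀ᵐ θ, Tendsto (fun r : ℝ => g (circleMap 0 r θ)) (𝓝[<] 1) (𝓝 (φ θ))
  integrableOn : IntegrableOn φ (Ioc 0 (2 * Real.pi))
  tendsto_L1 : Tendsto (fun n => ∫⁻ θ in Ioc 0 (2 * Real.pi), ‖g (circleMap 0 (radius n) θ) - φ θ‖ₑ)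
    atTop (𝓝 0)

theorem HasNontangentialLimit.tendsto_radial {g : ℂ → ℂ} {L : ℂ} {θ : ℝ}
    (h : HasNontangentialLimit g (circleMap 0 1 θ) L) :
    Tendsto (fun r : ℝ => g (circleMap 0 r θ)) (𝓝[<] 1) (𝓝 L) := by
  refine (h 2 one_lt_two).comp (tendsto_nhdsWithin_iff.2 ⟨?_, ?_⟩)
  · exact ((continuous_circleMap_radius θ).tendsto 1).mono_left nhdsWithin_le_nhds
  · filter_upwards [Ioo_mem_nhdsLT (show (0 : ℝ) < 1 by norm_num)] with r hr
    have h1 : ‖circleMap 0 r θ‖ = r := by rw [norm_circleMap_zero, abs_of_pos hr.1]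
    refine ⟨by rw [h1]; exact hr.2, ?_⟩
    have h2 : circleMap 0 1 θ - circleMap 0 r θ = ((1 - r : ℝ) : ℂ) * circleMap 0 1 θ := by
      rw [circleMap_zero_eq_mul r]; push_cast; ring
    rw [h2, h1, norm_mul, norm_circleMap_one, mul_one, Complex.norm_real,
      Real.norm_of_nonneg (by linarith [hr.2])]
    linarith [hr.2]

theorem boundaryValue_eq {g : ℂ → ℂ} {L : ℂ} {θ : ℝ}
    (h : HasNontangentialLimit g (circleMap 0 1 θ) L) : boundaryValue g (circleMap 0 1 θ) = L := by
  have hex : ∃ L, HasNontangentialLimit g (circleMap 0 1 θ) L := ⟨L, h⟩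
  rw [boundaryValue, dif_pos hex]
  exact tendsto_nhds_unique hex.choose_spec.tendsto_radial h.tendsto_radial

theorem circleMean_le_of_ae_tendsto {q : ℝ} (hq : 0 < q) {F : ℕ → ℝ → ℂ} {φ : ℝ → ℂ}
    (hF : ∀ n, Measurable (F n)) (h : ∀ᵐ θ, Tendsto (fun n => F n θ) atTop (𝓝 (φ θ))) {B : ℝ≥0∞}
    (hB : ∀ᶠ n in atTop, circleMean q (F n) ≤ B) : circleMean q φ ≤ B := by
  have h1 : ∫⁻ θ, ‖φ θ‖ₑ ^ q ∂circleMeasure ≤ B ^ q := by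
    calc ∫⁻ θ, ‖φ θ‖ₑ ^ q ∂circleMeasure
        = ∫⁻ θ, liminf (fun n => ‖F n θ‖ₑ ^ q) atTop ∂circleMeasure := by
          refine lintegral_congr_ae ?_
          filter_upwards [circleMeasure_absolutelyContinuous.ae_le h] with θ hθ
          exact (((ENNReal.continuous_rpow_const.tendsto _).comp hθ.enorm).liminf_eq).symm
      _ ≤ liminf (fun n => ∫⁻ θ, ‖F n θ‖ₑ ^ q ∂circleMeasure) atTop :=
          lintegral_liminf_le fun n => (hF n).enorm.pow_const q
      _ ≤ B ^ q := by
          refine liminf_le_of_frequently_le' (Eventually.frequently ?_)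
          filter_upwards [hB] with n hn
          rw [circleMean_eq] at hn
          have := ENNReal.rpow_le_rpow hn hq.le
          rwa [← ENNReal.rpow_mul, one_div_mul_cancel hq.ne', ENNReal.rpow_one] at this
  rw [circleMean_eq]
  have := ENNReal.rpow_le_rpow h1 (show 0 ≤ 1 / q by positivity)
  rwa [← ENNReal.rpow_mul, mul_one_div_cancel hq.ne', ENNReal.rpow_one] at this

theorem IsBoundaryFunction.circleMean_le {g : ℂ → ℂ} {φ : ℝ → ℂ} (hφ : IsBoundaryFunction g φ)
    (hg : AnalyticInDisc g) {q : ℝ} (hq : 0 < q) {B : ℝ≥0∞}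
    (hB : ∀ᶠ r : ℝ in 𝓝[<] 1, integralMean q r g ≤ B) : circleMean q φ ≤ B := by
  refine circleMean_le_of_ae_tendsto hq (F := fun n θ => g (circleMap 0 (radius n) θ))
    (fun n => (continuous_comp_circleMap hg (radius_mem n).1.le (radius_mem n).2).measurable) ?_ ?_
  · filter_upwards [hφ.ae_tendsto] with θ hθ using hθ.comp tendsto_radius_left
  · filter_upwards [tendsto_radius_left.eventually hB] with n hn
    rwa [integralMean_eq] at hn

/-- Fatou's theorem for the Hardy space `H^q`, `q > 1`. -/
theorem exists_isBoundaryFunction {g : ℂ → ℂ} (hg : AnalyticInDisc g) {q : ℝ} (hq : 1 < q)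
    {B₀ : ℝ≥0∞} (hB₀ : B₀ ≠ ∞) (hB : ∀ᶠ r : ℝ in 𝓝[<] 1, integralMean q r g ≤ B₀) :
    ∃ φ, IsBoundaryFunction g φ := by
  have hq0 : 0 < q := by linarith
  have hpi := Real.pi_pos
  obtain ⟨r', hr', hr'2⟩ := (mem_nhdsLT_iff_exists_Ioo_subset' (show (0 : ℝ) < 1 by norm_num)).1 hB
  set r₀ := max r' 0 with hr₀
  have hr₀0 : 0 ≤ r₀ := le_max_right _ _
  have hr₀1 : r₀ < 1 := max_lt hr' one_pos
  set B := B₀.toReal with hBdef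
  have hB0 : 0 ≤ B := ENNReal.toReal_nonneg
  have hBr : ∀ r ∈ Ioo r₀ 1, integralMean q r g ≤ ENNReal.ofReal B := fun r hr => by
    rw [hBdef, ENNReal.ofReal_toReal hB₀]
    exact hr'2 ⟨(le_max_left _ _).trans_lt hr.1, hr.2⟩
  obtain ⟨G, hG⟩ := DifferentiableOn.isExactOn_ball hg
  set γ := 1 - 1 / q with hγ
  have hγ0 : 0 < γ := by
    have : 1 / q < 1 := by rw [div_lt_one hq0]; exact hq
    linarith
  have harc : ∀ r ∈ Ioo r₀ 1, ∀ a b : ℝ, a ≤ b → b ≤ a + 2 * Real.pi →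
      ‖G (circleMap 0 r b) - G (circleMap 0 r a)‖ ≤ (2 * Real.pi) ^ (1 / q) * B * (b - a) ^ γ :=
    fun r hr a b hab hba => norm_primitive_arc_le hq hg hG (hr₀0.trans hr.1.le) hr.2 hB0 (hBr r hr) hab hba
  set r₁ := max (1 / 2) ((2 + r₀) / 3) with hr₁
  have hr₁1 : r₁ < 1 := max_lt (by norm_num) (by linarith)
  have hr₁0 : 0 ≤ r₁ := le_trans (by norm_num) (le_max_left _ _)
  obtain ⟨⟨K, hK⟩, F, hF⟩ := exists_radial_limit (C := 6 * ((2 * Real.pi) ^ (1 / q) * B)) hr₁0 hr₁1 hγ0 hG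
    (fun z hz hz1 => norm_le_of_arc_le (r₀ := r₀) (by positivity) hγ0.le hG harc hz1
      ((le_max_left _ _).trans hz) (lt_of_lt_of_le (by linarith) ((le_max_right _ _).trans hz)))
  have hdiff := ae_differentiableAt_radial_limit (r₀ := r₀)
    (S := ENNReal.ofReal (2 * Real.pi) ^ (1 / q) * ENNReal.ofReal B *
      ENNReal.ofReal (2 * Real.pi) ^ (1 - 1 / q))
    (ENNReal.mul_ne_top (ENNReal.mul_ne_top (ENNReal.rpow_lt_top_of_nonneg (by positivity)
      ENNReal.ofReal_ne_top).ne ENNReal.ofReal_ne_top) (ENNReal.rpow_lt_top_of_nonneg hγ0.le ENNReal.ofReal_ne_top).ne) hr₀0 hr₀1 hg hG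
    (fun r hr a => by
      have h1 := lintegral_arc_le hq
        (continuous_comp_circleMap hg (hr₀0.trans hr.1.le) hr.2).measurable
        (fun θ => congrArg g (periodic_circleMap 0 r θ)) (le_refl (a + 2 * Real.pi))
      rw [← integralMean_eq, add_sub_cancel_left] at h1
      refine h1.trans ?_
      gcongr
      exact hBr r hr) hF
  have hGd : DifferentiableOn ℂ G (Metric.ball 0 1) := fun z hz =>
    (hG z hz).differentiableAt.differentiableWithinAt
  -- The tangential derivative of G is iζG'(ζ), whence the quotient. Where F is not differentiable
  -- `deriv F` is 0, on a null set only; this choice makes φ measurable and periodic everywhere.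
  set φ : ℝ → ℂ := fun θ => deriv F θ / (circleMap 0 1 θ * Complex.I) with hφ
  have hFper : Function.Periodic F (2 * Real.pi) := periodic_of_radial_limit hF
  have hnt : ∀ᵐ θ, HasNontangentialLimit g (circleMap 0 1 θ) (φ θ) := by
    filter_upwards [hdiff] with θ hθ
    have h1 := hasNontangentialLimit_of_hasDerivAt hGd hK hF hθ.hasDerivAt
    intro M hM
    refine (h1 M hM).congr' ?_
    filter_upwards [self_mem_nhdsWithin] with z hz
    exact (hG z (by rw [mem_ball_zero_iff]; exact hz.1)).deriv
  have hφm : Measurable φ :=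
    (measurable_deriv F).div ((continuous_circleMap 0 1).measurable.mul_const _)
  have htend : ∀ᵐ θ, Tendsto (fun r : ℝ => g (circleMap 0 r θ)) (𝓝[<] 1) (𝓝 (φ θ)) := by
    filter_upwards [hnt] with θ hθ using hθ.tendsto_radial
  have hgm : ∀ n, Measurable fun θ => g (circleMap 0 (radius n) θ) := fun n =>
    (continuous_comp_circleMap hg (radius_mem n).1.le (radius_mem n).2).measurable
  have hBn : ∀ᶠ n in atTop, circleMean q (fun θ => g (circleMap 0 (radius n) θ)) ≤ B₀ := by
    filter_upwards [tendsto_radius_left.eventually hB] with n hn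
    rwa [integralMean_eq] at hn
  have hφB : circleMean q φ ≤ B₀ := by
    refine circleMean_le_of_ae_tendsto hq0 hgm ?_ hBn
    filter_upwards [htend] with θ hθ using hθ.comp tendsto_radius_left
  have hφper : Function.Periodic φ (2 * Real.pi) := by
    intro θ
    have h1 : deriv F (θ + 2 * Real.pi) = deriv F θ := by
      rw [← deriv_comp_add_const]; exact congrArg (fun f => deriv f θ) (funext hFper)
    simp only [hφ, h1, periodic_circleMap 0 1 θ]
  refine ⟨φ, hφm, hφper, ?_, htend, ⟨hφm.aestronglyMeasurable, ?_⟩, ?_⟩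
  · filter_upwards [hnt] with θ hθ using boundaryValue_eq hθ
  · have h1 := lintegral_arc_le hq hφm hφper (a := 0) (b := 2 * Real.pi) (by simp)
    refine lt_of_le_of_lt h1 ?_
    have h2 : circleMean q φ < ∞ := hφB.trans_lt hB₀.lt_top
    exact ENNReal.mul_lt_top (ENNReal.mul_lt_top (ENNReal.rpow_lt_top_of_nonneg (by positivity)
      ENNReal.ofReal_ne_top)
      h2) (ENNReal.rpow_lt_top_of_nonneg hγ0.le ENNReal.ofReal_ne_top)
  · have hfin : IsFiniteMeasure (volume.restrict (Ioc 0 (2 * Real.pi))) := inferInstance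
    refine tendsto_lintegral_zero_of_bounded_rpow (fun n => ((hgm n).sub hφm).enorm) ?_ hq
      (S := ENNReal.ofReal (2 * Real.pi) * (B₀ + B₀) ^ q) ?_ ?_
    · filter_upwards [ae_restrict_of_ae htend] with θ hθ
      have := ((hθ.comp tendsto_radius_left).sub_const (φ θ)).enorm
      simpa using this
    · exact ENNReal.mul_ne_top ENNReal.ofReal_ne_top
        (ENNReal.rpow_lt_top_of_nonneg hq0.le (ENNReal.add_ne_top.2 ⟨hB₀, hB₀⟩)).ne
    · filter_upwards [hBn] with n hn
      rw [lintegral_period_rpow q hq0]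
      gcongr
      exact (circleMean_sub_le hq.le (hgm n) hφm).trans (add_le_add hn hφB)

/-! ### Shifts of the boundary function and means of the derivative. -/

/-- Nothing is known about f outside the disc; extension by zero supplies the joint measurability in
(θ,u) that Minkowski's inequality requires. -/
theorem measurable_indicator_ball {f : ℂ → ℂ} (hf : AnalyticInDisc f) :
    Measurable ((Metric.ball (0 : ℂ) 1).indicator f) := by
  classical
  rw [← piecewise_eq_indicator]
  exact ContinuousOn.measurable_piecewise hf.continuousOn continuousOn_const measurableSet_ball

theorem AnalyticInDisc.deriv {f : ℂ → ℂ} (hf : AnalyticInDisc f) : AnalyticInDisc (deriv f) :=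
  DifferentiableOn.deriv hf Metric.isOpen_ball

theorem AnalyticInDisc.hasDerivAt {f : ℂ → ℂ} (hf : AnalyticInDisc f) {z : ℂ}
    (hz : z ∈ Metric.ball (0 : ℂ) 1) : HasDerivAt f (_root_.deriv f z) z :=
  (DifferentiableOn.differentiableAt hf (Metric.isOpen_ball.mem_nhds hz)).hasDerivAt

theorem AnalyticInDisc.measurable_circleMap {f : ℂ → ℂ} (hf : AnalyticInDisc f) {r : ℝ}
    (hr : r ∈ Ico (0 : ℝ) 1) : Measurable fun θ => f (circleMap 0 r θ) :=
  (continuous_comp_circleMap hf hr.1 hr.2).measurable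

theorem circleMean_le_lintegral_integralMean {f : ℂ → ℂ} (hf : AnalyticInDisc f) {q : ℝ}
    (hq : 1 < q) {F : ℝ → ℂ} {S : Set ℝ} (hS : MeasurableSet S) (hS1 : S ⊆ Ico 0 1)
    (h : ∀ᵐ θ, ‖F θ‖ₑ ≤ ∫⁻ u in S, ‖f (circleMap 0 u θ)‖ₑ) :
    circleMean q F ≤ ∫⁻ u in S, integralMean q u f := by
  set k := (Metric.ball (0 : ℂ) 1).indicator f with hk
  have hkf : ∀ u ∈ S, ∀ θ, k (circleMap 0 u θ) = f (circleMap 0 u θ) := fun u hu θ =>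
    indicator_of_mem (circleMap_mem_unitBall (hS1 hu).1 (hS1 hu).2 θ) f
  have hm : Measurable (Function.uncurry fun θ u : ℝ => k (circleMap 0 u θ)) := by
    refine (measurable_indicator_ball hf).comp ?_
    have : Continuous fun x : ℝ × ℝ => circleMap 0 x.2 x.1 := by unfold circleMap; fun_prop
    exact this.measurable
  have h1 := circleMean_le_lintegral (ν := volume.restrict S) (F := F) hq (k := fun _ => 1) measurable_const hm ?_
  · refine h1.trans_eq (setLIntegral_congr_fun hS fun u hu => ?_)
    simp only [mul_one, integralMean_eq]
    exact congrArg _ (funext (hkf u hu))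
  · filter_upwards [h] with θ hθ
    refine hθ.trans_eq (setLIntegral_congr_fun hS fun u hu => ?_)
    simp only [mul_one]
    rw [hkf u hu θ]

theorem enorm_sub_radial_le {g : ℂ → ℂ} (hg : AnalyticInDisc g) {r s : ℝ} (hr : 0 ≤ r) (hrs : r ≤ s)
    (hs : s < 1) (θ : ℝ) : ‖g (circleMap 0 s θ) - g (circleMap 0 r θ)‖ₑ ≤
      ∫⁻ u in Ioc r s, ‖deriv g (circleMap 0 u θ)‖ₑ := by
  have hmem : ∀ u ∈ Icc r s, circleMap 0 u θ ∈ Metric.ball (0 : ℂ) 1 := fun u hu =>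
    circleMap_mem_unitBall (hr.trans hu.1) (hu.2.trans_lt hs) θ
  refine (enorm_sub_le_lintegral_of_hasDerivAt (F := fun u => g (circleMap 0 u θ)) hrs
    (fun u hu => hasDerivAt_comp_circleMap_radius (hg.hasDerivAt (hmem u hu))) ?_).trans_eq ?_
  · exact continuousOn_const.mul (hg.deriv.continuousOn.comp
      (continuous_circleMap_radius θ).continuousOn hmem)
  · refine lintegral_congr fun u => ?_
    rw [enorm_mul, ← ofReal_norm (circleMap 0 1 θ), norm_circleMap_one, ENNReal.ofReal_one, one_mul]

theorem integralMean_le_lintegral {g : ℂ → ℂ} (hg : AnalyticInDisc g) {q : ℝ} (hq : 1 < q) {r : ℝ}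
    (hr : r ∈ Ico (0 : ℝ) 1) :
    integralMean q r g ≤ ‖g 0‖ₑ + ∫⁻ u in Ioo 0 1, integralMean q u (deriv g) := by
  have hq0 : 0 < q := by linarith
  have h1 : circleMean q (fun θ => g (circleMap 0 r θ) - g (circleMap 0 0 θ)) ≤
      ∫⁻ u in Ioc 0 r, integralMean q u (deriv g) :=
    circleMean_le_lintegral_integralMean hg.deriv hq measurableSet_Ioc
      (fun u hu => ⟨hu.1.le, hu.2.trans_lt hr.2⟩)
      (Eventually.of_forall fun θ => enorm_sub_radial_le hg le_rfl hr.1 hr.2 θ)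
  have hm := hg.measurable_circleMap hr
  have hm0 := hg.measurable_circleMap (r := 0) (by simp)
  calc integralMean q r g
      = circleMean q (fun θ => g (circleMap 0 0 θ) + (g (circleMap 0 r θ) - g (circleMap 0 0 θ))) := by
        simp [integralMean_eq]
    _ ≤ circleMean q (fun θ => g (circleMap 0 0 θ)) +
        circleMean q (fun θ => g (circleMap 0 r θ) - g (circleMap 0 0 θ)) :=
        circleMean_add_le hq.le hm0 (hm.sub hm0)
    _ ≤ _ := by
        refine add_le_add (circleMean_le_of_enorm_le hq0 fun θ => by simp) (h1.trans ?_)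
        exact lintegral_mono_set fun u hu => ⟨hu.1, hu.2.trans_lt hr.2⟩

/-- The increment is an integral of g' over rotations, all of which have the same mean. -/
theorem circleMean_sub_arc_le {g : ℂ → ℂ} (hg : AnalyticInDisc g) {q : ℝ} (hq : 1 < q) {r h : ℝ}
    (hr : r ∈ Ico (0 : ℝ) 1) (hh : 0 ≤ h) :
    circleMean q (fun θ => g (circleMap 0 r (θ + h)) - g (circleMap 0 r θ)) ≤
      ENNReal.ofReal h * integralMean q r (deriv g) := by
  have hc := hg.deriv.measurable_circleMap hr
  have hm : Measurable (Function.uncurry fun θ t : ℝ => deriv g (circleMap 0 r (θ + t))) :=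
    hc.comp (measurable_fst.add measurable_snd)
  refine (circleMean_le_lintegral (ν := volume.restrict (Ioc 0 h)) hq (k := fun _ => 1) measurable_const hm
    (Eventually.of_forall fun θ => ?_)).trans_eq ?_
  · refine (enorm_primitive_arc_le hg.deriv (fun z hz => hg.hasDerivAt hz) hr.1 hr.2
      (le_add_of_nonneg_right hh)).trans_eq ?_
    have h1 := (measurePreserving_add_left (volume : Measure ℝ) θ).setLIntegral_comp_preimage_emb
      (measurableEmbedding_addLeft θ) (fun t => ‖deriv g (circleMap 0 r t)‖ₑ) (Ioc θ (θ + h))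
    rw [preimage_const_add_Ioc, sub_self, add_sub_cancel_left] at h1
    rw [← h1]
    simp
  · have h2 : ∀ t : ℝ, circleMean q (fun θ => deriv g (circleMap 0 r (θ + t))) =
        integralMean q r (deriv g) := fun t => by
      rw [integralMean_eq]
      exact circleMean_add (F := fun θ => deriv g (circleMap 0 r θ))
        (fun θ => congrArg _ (periodic_circleMap 0 r θ)) t
    simp only [h2, mul_one, lintegral_const, Measure.restrict_apply_univ, Real.volume_Ioc, sub_zero]
    rw [mul_comm]

namespace IsBoundaryFunction

variable {g : ℂ → ℂ} {φ : ℝ → ℂ}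

theorem circleMean_sub_radial_le (hφ : IsBoundaryFunction g φ) (hg : AnalyticInDisc g) {q : ℝ}
    (hq : 1 < q) {r : ℝ} (hr : r ∈ Ico (0 : ℝ) 1) :
    circleMean q (fun θ => φ θ - g (circleMap 0 r θ)) ≤
      ∫⁻ u in Ioo r 1, integralMean q u (deriv g) := by
  refine circleMean_le_lintegral_integralMean hg.deriv hq measurableSet_Ioo
    (fun u hu => ⟨hr.1.trans hu.1.le, hu.2⟩) ?_
  filter_upwards [hφ.ae_tendsto] with θ hθ
  refine le_of_tendsto (hθ.sub_const _).enorm ?_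
  filter_upwards [Ioo_mem_nhdsLT hr.2] with s hs
  refine (enorm_sub_radial_le hg hr.1 hs.1.le hs.2 θ).trans (lintegral_mono_set ?_)
  exact fun u hu => ⟨hu.1, hu.2.trans_lt hs.2⟩

theorem circleMean_boundaryValue (hφ : IsBoundaryFunction g φ) (q h : ℝ) :
    circleMean q (fun θ => boundaryValue g (Complex.exp (((θ + h : ℝ) : ℂ) * Complex.I)) -
      boundaryValue g (Complex.exp ((θ : ℂ) * Complex.I))) =
      circleMean q fun θ => φ (θ + h) - φ θ := by
  have e : ∀ θ : ℝ, Complex.exp ((θ : ℂ) * Complex.I) = circleMap 0 1 θ := fun θ => by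
    simp [circleMap]
  simp_rw [e]
  refine circleMean_congr_ae ?_
  filter_upwards [hφ.ae_boundaryValue,
    (measurePreserving_add_right (volume : Measure ℝ) h).quasiMeasurePreserving.ae
      hφ.ae_boundaryValue] with θ h1 h2
  rw [h1, h2]

theorem boundaryModulus_eq (hφ : IsBoundaryFunction g φ) (q t : ℝ) :
    boundaryModulus q g t = ⨆ h ∈ Ioc (0 : ℝ) t, circleMean q fun θ => φ (θ + h) - φ θ := by
  simp_rw [boundaryModulus, hφ.circleMean_boundaryValue]

theorem circleMean_le_boundaryModulus (hφ : IsBoundaryFunction g φ) (q : ℝ) {h t : ℝ} (hh : 0 < h)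
    (ht : h ≤ t) : circleMean q (fun θ => φ (θ + h) - φ θ) ≤ boundaryModulus q g t := by
  rw [hφ.boundaryModulus_eq]
  exact le_iSup₂ (f := fun h (_ : h ∈ Ioc (0 : ℝ) t) => circleMean q fun θ => φ (θ + h) - φ θ) h
    ⟨hh, ht⟩

/-- The detour through radius r: two radial legs, equal in mean by rotation invariance, and one arc.
-/
theorem circleMean_shift_sub_le (hφ : IsBoundaryFunction g φ) (hg : AnalyticInDisc g) {q : ℝ}
    (hq : 1 < q) {r h : ℝ} (hr : r ∈ Ico (0 : ℝ) 1) (hh : 0 ≤ h) :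
    circleMean q (fun θ => φ (θ + h) - φ θ) ≤
      2 * (∫⁻ u in Ioo r 1, integralMean q u (deriv g)) +
        ENNReal.ofReal h * integralMean q r (deriv g) := by
  have hm := hg.measurable_circleMap hr
  set d : ℝ → ℂ := fun θ => φ θ - g (circleMap 0 r θ) with hd
  have hdm : Measurable d := hφ.measurable.sub hm
  have hdp : Function.Periodic d (2 * Real.pi) := fun θ => by
    simp only [hd, hφ.periodic θ, periodic_circleMap 0 r θ]
  have hd1 := hφ.circleMean_sub_radial_le hg hq hr
  have hdh : Measurable fun θ => d (θ + h) := hdm.comp (measurable_add_const h)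
  have hmh : Measurable fun θ => g (circleMap 0 r (θ + h)) := hm.comp (measurable_add_const h)
  calc circleMean q (fun θ => φ (θ + h) - φ θ)
      = circleMean q (fun θ => (d (θ + h) - d θ) +
          (g (circleMap 0 r (θ + h)) - g (circleMap 0 r θ))) := by
        congr 1; funext θ; simp only [hd]; ring
    _ ≤ circleMean q (fun θ => d (θ + h) - d θ) +
          circleMean q (fun θ => g (circleMap 0 r (θ + h)) - g (circleMap 0 r θ)) :=
        circleMean_add_le hq.le (hdh.sub hdm) (hmh.sub hm)
    _ ≤ (circleMean q (fun θ => d (θ + h)) + circleMean q d) +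
          ENNReal.ofReal h * integralMean q r (deriv g) :=
        add_le_add (circleMean_sub_le hq.le hdh hdm) (circleMean_sub_arc_le hg hq hr hh)
    _ ≤ _ := by
        rw [circleMean_add hdp, ← two_mul]
        gcongr

theorem circleMean_shift_neg (hφ : IsBoundaryFunction g φ) (q h : ℝ) :
    circleMean q (fun θ => φ (θ + -h) - φ θ) = circleMean q (fun θ => φ (θ + h) - φ θ) := by
  have hp : Function.Periodic (fun θ => φ (θ + -h) - φ θ) (2 * Real.pi) := fun θ => by
    simp only [hφ.periodic θ, show θ + 2 * Real.pi + -h = θ + -h + 2 * Real.pi by ring,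
      hφ.periodic (θ + -h)]
  rw [← circleMean_add hp h, ← circleMean_neg]
  congr 1; funext θ; simp

theorem circleMean_shift_two_mul_le (hφ : IsBoundaryFunction g φ) {q : ℝ} (hq : 1 ≤ q) (h : ℝ) :
    circleMean q (fun θ => φ (θ + 2 * h) - φ θ) ≤
      2 * circleMean q (fun θ => φ (θ + h) - φ θ) := by
  have hm := hφ.measurable
  have hmh : ∀ h, Measurable fun θ => φ (θ + h) := fun h => hm.comp (measurable_add_const h)
  have hp : Function.Periodic (fun θ => φ (θ + h) - φ θ) (2 * Real.pi) := fun θ => by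
    simp only [hφ.periodic θ, show θ + 2 * Real.pi + h = θ + h + 2 * Real.pi by ring,
      hφ.periodic (θ + h)]
  calc _ = circleMean q (fun θ => (φ (θ + h + h) - φ (θ + h)) + (φ (θ + h) - φ θ)) := by
        congr 1; funext θ; rw [show θ + 2 * h = θ + h + h by ring]; ring
    _ ≤ circleMean q (fun θ => φ (θ + h + h) - φ (θ + h)) + circleMean q (fun θ => φ (θ + h) - φ θ) :=
        circleMean_add_le hq (((hmh h).comp (measurable_add_const h)).sub (hmh h)) ((hmh h).sub hm)
    _ = _ := by
        rw [circleMean_add hp, two_mul]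

theorem enorm_deriv_le (hφ : IsBoundaryFunction g φ) (hg : AnalyticInDisc g) {r : ℝ}
    (hr : r ∈ Ioo (0 : ℝ) 1) (α : ℝ) :
    ‖deriv g (circleMap 0 r α)‖ₑ ≤ ∫⁻ t in Ioc (-Real.pi) Real.pi, ‖φ (α + t) - φ α‖ₑ *
      ENNReal.ofReal ((2 * Real.pi)⁻¹ * (‖circleMap 0 1 t - r‖ ^ 2)⁻¹) := by
  have hpi := Real.pi_pos
  set z := circleMap 0 r α with hz
  have hzb : z ∈ Metric.ball (0 : ℂ) 1 := circleMap_mem_unitBall hr.1.le hr.2 α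
  have h1 := deriv_eq_integral_of_tendsto_L1 hg (A := fun _ => 1) isOpen_univ (subset_univ _)
    (differentiableOn_const 1) hzb rfl (by simp) hφ.integrableOn radius_mem tendsto_radius
    hφ.tendsto_L1
  have h2 := deriv_eq_integral_circleMap (f := fun _ => φ α) isOpen_univ (subset_univ _)
    (differentiableOn_const _) hzb
  simp only [mul_one, deriv_const] at h1 h2
  set k : ℝ → ℂ := fun θ => circleMap 0 1 θ * ((circleMap 0 1 θ - z) ^ 2)⁻¹ with hk
  have hkc : Continuous k := continuous_cauchyKernel hzb
  have hki : IntervalIntegrable (fun θ => k θ * φ θ) volume 0 (2 * Real.pi) :=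
    ((intervalIntegrable_iff_integrableOn_Ioc_of_le Real.two_pi_pos.le).2
      hφ.integrableOn).continuousOn_mul hkc.continuousOn
  -- A constant has derivative zero, so Cauchy's formula for the constant φ(α) may be subtracted;
  -- this brings in the differences measured by the modulus.
  have h3 : deriv g z = (2 * Real.pi : ℂ)⁻¹ * ∫ θ in (0 : ℝ)..2 * Real.pi, k θ * (φ θ - φ α) := by
    have hkα : IntervalIntegrable (fun θ => k θ * φ α) volume 0 (2 * Real.pi) :=
      (hkc.mul continuous_const).intervalIntegrable _ _
    simp_rw [mul_sub]
    rw [intervalIntegral.integral_sub hki hkα, mul_sub,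
      ← h1, ← h2, sub_zero]
  have hkn : ∀ t, ‖k (α + t)‖ₑ = ENNReal.ofReal ((‖circleMap 0 1 t - r‖ ^ 2)⁻¹) := by
    intro t
    have e : circleMap 0 1 (α + t) - z = circleMap 0 1 α * (circleMap 0 1 t - r) := by
      rw [hz, circleMap_zero_add, circleMap_zero_eq_mul r]; ring
    rw [← ofReal_norm]
    simp only [hk]
    rw [norm_mul, norm_circleMap_one, one_mul, norm_inv, norm_pow, e, norm_mul, norm_circleMap_one,
      one_mul]
  rw [h3, enorm_mul, intervalIntegral.integral_of_le Real.two_pi_pos.le]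
  have h4 : ‖(2 * Real.pi : ℂ)⁻¹‖ₑ = ENNReal.ofReal (2 * Real.pi)⁻¹ := by
    rw [← ofReal_norm, norm_inv, norm_mul, Complex.norm_real, Real.norm_of_nonneg hpi.le]; norm_num
  rw [h4]
  have hper : Function.Periodic (fun θ => ‖k θ * (φ θ - φ α)‖ₑ) (2 * Real.pi) := fun θ => by
    simp only [hk, periodic_circleMap 0 1 θ, hφ.periodic θ]
  have h5 : ∫⁻ θ in Ioc 0 (2 * Real.pi), ‖k θ * (φ θ - φ α)‖ₑ =
      ∫⁻ t in Ioc (-Real.pi) Real.pi, ‖k (α + t) * (φ (α + t) - φ α)‖ₑ := by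
    have h6 := (measurePreserving_add_left (volume : Measure ℝ) α).setLIntegral_comp_preimage_emb
      (measurableEmbedding_addLeft α) (fun θ => ‖k θ * (φ θ - φ α)‖ₑ) (Ioc (α - Real.pi) (α + Real.pi))
    rw [preimage_const_add_Ioc, add_sub_cancel_left, show α - Real.pi - α = -Real.pi by ring] at h6
    rw [h6]
    have h7 := setLIntegral_period_eq Real.two_pi_pos hper 0 (α - Real.pi)
    rwa [zero_add, show α - Real.pi + 2 * Real.pi = α + Real.pi by ring] at h7
  calc _ ≤ ENNReal.ofReal (2 * Real.pi)⁻¹ * ∫⁻ θ in Ioc 0 (2 * Real.pi), ‖k θ * (φ θ - φ α)‖ₑ := by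
        gcongr; exact enorm_integral_le_lintegral_enorm _
    _ = _ := by
        rw [h5, ← lintegral_const_mul' _ _ ENNReal.ofReal_ne_top]
        refine lintegral_congr fun t => ?_
        rw [enorm_mul, hkn, ENNReal.ofReal_mul (by positivity)]
        ring

theorem integralMean_deriv_le (hφ : IsBoundaryFunction g φ) (hg : AnalyticInDisc g) {q : ℝ}
    (hq : 1 < q) {r : ℝ} (hr : r ∈ Ioo (0 : ℝ) 1) :
    integralMean q r (deriv g) ≤ ∫⁻ t in Ioc (-Real.pi) Real.pi,
      circleMean q (fun θ => φ (θ + t) - φ θ) *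
        ENNReal.ofReal ((2 * Real.pi)⁻¹ * (‖circleMap 0 1 t - r‖ ^ 2)⁻¹) := by
  rw [integralMean_eq]
  refine circleMean_le_lintegral (ν := volume.restrict (Ioc (-Real.pi) Real.pi))
    (G := fun θ t => φ (θ + t) - φ θ) hq ?_ ?_ (Eventually.of_forall fun θ => hφ.enorm_deriv_le hg hr θ)
  · refine Measurable.ennreal_ofReal ?_
    exact ((((continuous_circleMap 0 1).sub continuous_const).norm.pow 2).measurable.inv).const_mul _
  · exact (hφ.measurable.comp (measurable_fst.add measurable_snd)).sub
      (hφ.measurable.comp measurable_fst)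

end IsBoundaryFunction

/-! ### The kernel and its integral against the gauge. -/

theorem setLIntegral_symm_le {f : ℝ → ℝ≥0∞} (hf : ∀ t, f (-t) = f t) {a : ℝ} (ha : 0 ≤ a) :
    ∫⁻ t in Ioc (-a) a, f t = 2 * ∫⁻ t in Ioc 0 a, f t := by
  have h1 : ∫⁻ t in Ioc (-a) 0, f t = ∫⁻ t in Ioc 0 a, f t := by
    have h := (Measure.measurePreserving_neg (volume : Measure ℝ)).setLIntegral_comp_preimage_emb
      (MeasurableEquiv.neg ℝ).measurableEmbedding f (Ioc (-a) 0)
    rw [← h]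
    simp only [hf, neg_preimage, neg_Ioc, neg_zero, neg_neg]
    exact setLIntegral_congr Ico_ae_eq_Ioc
  rw [← Ioc_union_Ioc_eq_Ioc (neg_nonpos.2 ha) ha, lintegral_union measurableSet_Ioc
    (Ioc_disjoint_Ioc_of_le le_rfl), h1, two_mul]

/-- |e^{it}-r| is at least 1-r, and also at least |t|/π because |e^{it}-1| ≤ |e^{it}-r| + (1-r). The
constant is π²/(2π) = π/2 ≤ 2. -/
theorem inv_sq_norm_circleMap_sub_le {r t : ℝ} (hr0 : 0 ≤ r) (hr : r < 1) (ht : |t| ≤ Real.pi)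
    (ht0 : t ≠ 0) : (2 * Real.pi)⁻¹ * (‖circleMap 0 1 t - r‖ ^ 2)⁻¹ ≤
      2 * min ((1 - r) ^ 2)⁻¹ (t ^ 2)⁻¹ := by
  have hpi := Real.pi_gt_three
  have hpi4 := Real.pi_le_four
  have h0 : 0 < 1 - r := by linarith
  have h1 : 1 - r ≤ ‖circleMap 0 1 t - r‖ := by
    have := norm_sub_norm_le (circleMap 0 1 t) (r : ℂ)
    rw [norm_circleMap_one, Complex.norm_real, Real.norm_eq_abs] at this
    rwa [abs_of_nonneg hr0] at this
  have h2 : |t| ≤ Real.pi * ‖circleMap 0 1 t - r‖ := by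
    have h3 := abs_le_norm_circleMap_sub (t := t) (θ := 0) (by rwa [sub_zero])
    have h4 : ‖circleMap 0 1 t - circleMap 0 1 0‖ ≤ ‖circleMap 0 1 t - r‖ + (1 - r) := by
      have e : circleMap 0 1 t - circleMap 0 1 0 = (circleMap 0 1 t - r) - ((1 - r : ℝ) : ℂ) := by
        simp [circleMap]
      rw [e]
      refine (norm_sub_le _ _).trans_eq ?_
      rw [Complex.norm_real, Real.norm_of_nonneg h0.le]
    rw [sub_zero] at h3
    nlinarith
  have h3 : 0 < |t| := abs_pos.2 ht0
  have h5 : 0 < ‖circleMap 0 1 t - r‖ := h0.trans_le h1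
  rw [mul_min_of_nonneg _ _ zero_le_two]
  refine le_min ?_ ?_
  · refine mul_le_mul ?_ (inv_anti₀ (by positivity) (by gcongr)) (by positivity) zero_le_two
    refine (inv_le_one_of_one_le₀ (by linarith)).trans one_le_two
  · have h6 : t ^ 2 ≤ Real.pi ^ 2 * ‖circleMap 0 1 t - r‖ ^ 2 := by
      rw [← sq_abs, ← mul_pow]; gcongr
    have h7 : 0 < t ^ 2 := by positivity
    rw [← mul_inv, ← div_eq_mul_inv, le_div_iff₀ h7, inv_mul_le_iff₀ (by positivity)]
    calc t ^ 2 ≤ Real.pi ^ 2 * ‖circleMap 0 1 t - r‖ ^ 2 := h6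
      _ = Real.pi * (Real.pi * ‖circleMap 0 1 t - r‖ ^ 2) := by ring
      _ ≤ 4 * (Real.pi * ‖circleMap 0 1 t - r‖ ^ 2) := by gcongr
      _ = _ := by ring

theorem IsBoundaryFunction.integralMean_deriv_le_boundaryModulus {g : ℂ → ℂ} {φ : ℝ → ℂ}
    (hφ : IsBoundaryFunction g φ) (hg : AnalyticInDisc g) {q : ℝ} (hq : 1 < q) {r : ℝ}
    (hr : r ∈ Ioo (0 : ℝ) 1) :
    integralMean q r (deriv g) ≤ 4 * (∫⁻ t in Ioo 0 1, boundaryModulus q g t *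
      ENNReal.ofReal (min ((1 - r) ^ 2)⁻¹ (t ^ 2)⁻¹)) + 48 * boundaryModulus q g (4 / 5) := by
  have hpi := Real.pi_gt_three
  have hpi4 := Real.pi_le_four
  set E : ℝ → ℝ≥0∞ := fun t => circleMean q (fun θ => φ (θ + t) - φ θ) with hE
  set m : ℝ → ℝ≥0∞ := fun t => ENNReal.ofReal (2 * min ((1 - r) ^ 2)⁻¹ (t ^ 2)⁻¹) with hm
  have hm2 : ∀ t, m t = 2 * ENNReal.ofReal (min ((1 - r) ^ 2)⁻¹ (t ^ 2)⁻¹) := fun t => by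
    simp only [hm]; rw [ENNReal.ofReal_mul zero_le_two]; simp
  calc integralMean q r (deriv g) ≤ _ := hφ.integralMean_deriv_le hg hq hr
    _ ≤ ∫⁻ t in Ioc (-Real.pi) Real.pi, E t * m t := by
        refine lintegral_mono_ae ?_
        filter_upwards [ae_restrict_mem measurableSet_Ioc,
          ae_restrict_of_ae (Measure.ae_ne volume (0 : ℝ))] with t ht ht0
        gcongr
        exact ENNReal.ofReal_le_ofReal (inv_sq_norm_circleMap_sub_le hr.1.le hr.2 (abs_le.2 ⟨ht.1.le, ht.2⟩) ht0)
    _ = 2 * ∫⁻ t in Ioc 0 Real.pi, E t * m t := by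
        refine setLIntegral_symm_le (fun t => ?_) (by linarith)
        simp only [hE, hm, hφ.circleMean_shift_neg, neg_sq]
    _ ≤ 2 * (2 * (∫⁻ t in Ioo 0 1, boundaryModulus q g t *
          ENNReal.ofReal (min ((1 - r) ^ 2)⁻¹ (t ^ 2)⁻¹)) + 24 * boundaryModulus q g (4 / 5)) := by
        gcongr
        rw [← Ioo_union_Icc_eq_Ioc one_pos (by linarith), lintegral_union measurableSet_Icc
          (Set.disjoint_left.2 fun t h1 h2 => absurd h1.2 (not_lt.2 h2.1))]
        refine add_le_add ?_ ?_
        · rw [← lintegral_const_mul' _ _ ENNReal.ofNat_ne_top]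
          refine setLIntegral_mono' measurableSet_Ioo fun t ht => ?_
          rw [hm2, mul_left_comm]
          gcongr
          exact hφ.circleMean_le_boundaryModulus q ht.1 le_rfl
        · calc ∫⁻ t in Icc 1 Real.pi, E t * m t
              ≤ ∫⁻ _ in Icc 1 Real.pi, 4 * boundaryModulus q g (4 / 5) * 2 := by
                refine setLIntegral_mono' measurableSet_Icc fun t ht => ?_
                refine mul_le_mul' ?_ ?_
                · have h1 := hφ.circleMean_shift_two_mul_le hq.le (t / 2)
                  have h2 := hφ.circleMean_shift_two_mul_le hq.le (t / 4)
                  rw [show 2 * (t / 2) = t by ring] at h1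
                  rw [show 2 * (t / 4) = t / 2 by ring] at h2
                  have h3 := hφ.circleMean_le_boundaryModulus q (h := t / 4) (t := 4 / 5)
                    (by linarith [ht.1]) (by linarith [ht.2, Real.pi_lt_d2])
                  calc E t ≤ 2 * (2 * boundaryModulus q g (4 / 5)) :=
                        h1.trans (by gcongr; exact h2.trans (by gcongr))
                    _ = _ := by rw [← mul_assoc]; norm_num
                · rw [hm2]
                  refine mul_le_of_le_one_right' (ENNReal.ofReal_le_one.2 ?_)
                  exact (min_le_right _ _).trans (inv_le_one_of_one_le₀ (one_le_pow₀ ht.1))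
            _ = 8 * boundaryModulus q g (4 / 5) * ENNReal.ofReal (Real.pi - 1) := by
                rw [setLIntegral_const, Real.volume_Icc]; ring
            _ ≤ 8 * boundaryModulus q g (4 / 5) * 3 := by
                gcongr
                exact (ENNReal.ofReal_le_ofReal (by linarith)).trans_eq (by norm_num : ENNReal.ofReal 3 = 3)
            _ = _ := by ring
    _ = _ := by ring

/-- On (0,δ] the gauge is at most κ(δ) and the kernel is δ^{-2} times length δ; on (δ,1) the tail
estimate applies. -/
theorem MuckenhouptCondition.exists_lintegral_min_le {p η : ℝ} {ω : ℝ → ℝ} (hp : 1 < p)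
    (hη₀ : 0 ≤ η) (hη : η < 1 / p) (hω : IsRadialWeight ω) (hM : MuckenhouptCondition p ω) :
    ∃ K : ℝ, 0 < K ∧ ∀ δ ∈ Ioo (0 : ℝ) 1,
      ∫⁻ t in Ioo 0 1, ENNReal.ofReal (lipGauge (1 / p) ω η t) *
        ENNReal.ofReal (min (δ ^ 2)⁻¹ (t ^ 2)⁻¹) ≤
        ENNReal.ofReal (K * (lipGauge (1 / p) ω η δ / δ)) := by
  obtain ⟨K, hK, h⟩ := hM.exists_lintegral_lipGauge_le hp hη₀ hη hω
  have hp0 : 0 < p := by linarith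
  refine ⟨1 + K, by linarith, fun δ hδ => ?_⟩
  have hδ0 := hδ.1
  have hκ := hω.lipGauge_pos (1 / p) η (t := δ) ⟨hδ.1, hδ.2.le⟩
  rw [← Ioc_union_Ioo_eq_Ioo hδ.1.le hδ.2, lintegral_union measurableSet_Ioo
    (Set.disjoint_left.2 fun t h1 h2 => absurd h2.1 (not_lt.2 h1.2)), add_mul, one_mul,
    ENNReal.ofReal_add (by positivity) (by positivity)]
  refine add_le_add ?_ ?_
  · calc _ ≤ ∫⁻ _ in Ioc 0 δ, ENNReal.ofReal (lipGauge (1 / p) ω η δ) * ENNReal.ofReal (δ ^ 2)⁻¹ := by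
          refine setLIntegral_mono' measurableSet_Ioc fun t ht => ?_
          gcongr
          · exact hω.lipGauge_le (by positivity) hη₀ ht.1 ht.2 hδ.2.le
          · exact min_le_left _ _
      _ = _ := by
          rw [setLIntegral_const, Real.volume_Ioc, sub_zero, ← ENNReal.ofReal_mul hκ.le,
            ← ENNReal.ofReal_mul (by positivity)]
          congr 1; field_simp
  · refine le_trans (setLIntegral_mono' measurableSet_Ioo fun t ht => ?_) (h δ hδ)
    have ht0 : 0 < t := hδ0.trans ht.1
    rw [← ENNReal.ofReal_mul (hω.lipGauge_pos _ _ ⟨ht0, ht.2.le⟩).le,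
      div_eq_mul_inv (lipGauge _ _ _ _)]
    refine ENNReal.ofReal_le_ofReal ?_
    have := hω.lipGauge_pos (1 / p) η (t := t) ⟨ht0, ht.2.le⟩
    gcongr
    exact min_le_right _ _

/-! ### Passing between the derivative and the modulus. -/

section Main

variable {p q η : ℝ} {ω : ℝ → ℝ} {g : ℂ → ℂ}

theorem IsRadialWeight.lambdaQuotient_eq (hω : IsRadialWeight ω) (q α β : ℝ) (g : ℂ → ℂ) {r : ℝ}
    (hr : r ∈ Ioo (0 : ℝ) 1) : lambdaQuotient q α ω β g r =
      integralMean q r (deriv g) / ENNReal.ofReal (lipGauge α ω β (1 - r) / (1 - r)) := by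
  have hδ : 0 < 1 - r := by linarith [hr.2]
  have hW : 0 < tailIntegral ω r ^ β :=
    Real.rpow_pos_of_pos (hω.tailIntegral_pos ⟨hr.1.le, hr.2⟩) _
  have h1 : 0 < (1 - r) ^ (1 - α) := Real.rpow_pos_of_pos hδ _
  have e : lipGauge α ω β (1 - r) / (1 - r) = tailIntegral ω r ^ β / (1 - r) ^ (1 - α) := by
    have h2 : 0 < (1 - r) ^ α := Real.rpow_pos_of_pos hδ _
    rw [lipGauge, sub_sub_cancel, Real.rpow_sub hδ, Real.rpow_one]
    field_simp
  rw [lambdaQuotient, e, ENNReal.ofReal_div_of_pos h1, mul_div_assoc, div_eq_mul_inv (integralMean _ _ _),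
    ENNReal.inv_div (Or.inl ENNReal.ofReal_ne_top) (Or.inl (ENNReal.ofReal_pos.2 h1).ne')]

theorem IsRadialWeight.lambdaQuotient_le_iff (hω : IsRadialWeight ω) {q α β : ℝ} {g : ℂ → ℂ} {r : ℝ}
    (hr : r ∈ Ioo (0 : ℝ) 1) {N : ℝ≥0∞} : lambdaQuotient q α ω β g r ≤ N ↔
      integralMean q r (deriv g) ≤ N * ENNReal.ofReal (lipGauge α ω β (1 - r) / (1 - r)) := by
  have hδ : 0 < 1 - r := by linarith [hr.2]
  have hκ := hω.lipGauge_pos α β (t := 1 - r) ⟨hδ, by linarith [hr.1]⟩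
  rw [hω.lambdaQuotient_eq q α β g hr,
    ENNReal.div_le_iff (ENNReal.ofReal_pos.2 (div_pos hκ hδ)).ne' ENNReal.ofReal_ne_top]

theorem IsRadialWeight.modulusQuotient_le_iff (hω : IsRadialWeight ω) {q α β : ℝ} {g : ℂ → ℂ} {t : ℝ}
    (ht : t ∈ Ioo (0 : ℝ) 1) {N : ℝ≥0∞} : modulusQuotient q α ω β g t ≤ N ↔
      boundaryModulus q g t ≤ N * ENNReal.ofReal (lipGauge α ω β t) := by
  have hκ := hω.lipGauge_pos α β (t := t) ⟨ht.1, ht.2.le⟩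
  rw [modulusQuotient, ENNReal.div_le_iff (ENNReal.ofReal_pos.2 hκ).ne' ENNReal.ofReal_ne_top]

theorem MemHardy.eventually_le (hg : MemHardy q g) :
    ∃ B : ℝ≥0∞, B ≠ ∞ ∧ ∀ᶠ r : ℝ in 𝓝[<] 1, integralMean q r g ≤ B := by
  obtain ⟨-, L, hL, h⟩ := hg
  refine ⟨L + 1, ENNReal.add_ne_top.2 ⟨hL.ne, ENNReal.one_ne_top⟩, ?_⟩
  filter_upwards [h.eventually_lt_const (ENNReal.lt_add_right hL.ne one_ne_zero)] with r hr using hr.le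

theorem lintegral_integralMean_le (hω : IsRadialWeight ω) {α β : ℝ} (hα : 0 < α) (hβ : 0 ≤ β)
    {N : ℝ≥0∞} (hN : N ≠ ∞) {t : ℝ} (ht : t ∈ Ioc (0 : ℝ) 1)
    (h : ∀ r ∈ Ioo (0 : ℝ) 1, 1 - t ≤ r → lambdaQuotient q α ω β g r ≤ N) :
    ∫⁻ u in Ioo (1 - t) 1, integralMean q u (deriv g) ≤
      N * ENNReal.ofReal (lipGauge α ω β t / α) := by
  calc _ ≤ ∫⁻ u in Ioo (1 - t) 1, N * ENNReal.ofReal (lipGauge α ω β (1 - u) / (1 - u)) := by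
        refine setLIntegral_mono' measurableSet_Ioo fun u hu => ?_
        have hu' : u ∈ Ioo (0 : ℝ) 1 := ⟨by linarith [ht.2, hu.1], hu.2⟩
        exact (hω.lambdaQuotient_le_iff hu').1 (h u hu' hu.1.le)
    _ ≤ _ := by
        rw [lintegral_const_mul' _ _ hN]
        gcongr
        exact hω.lintegral_lipGauge_div_le hα hβ ht

/-- A shift by s is routed through radius 1-s, where arc and radial legs both cost a multiple of
κ(s). Only radii at least 1-t occur; this locality gives the little-o version. -/
theorem boundaryModulus_le_of_lambdaQuotient_le {φ : ℝ → ℂ} (hφ : IsBoundaryFunction g φ)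
    (hg : AnalyticInDisc g) (hq : 1 < q) (hω : IsRadialWeight ω) {α β : ℝ} (hα : 0 < α) (hβ : 0 ≤ β)
    {N : ℝ≥0∞} (hN : N ≠ ∞) {t : ℝ} (ht : t ∈ Ioo (0 : ℝ) 1)
    (h : ∀ r ∈ Ioo (0 : ℝ) 1, 1 - t ≤ r → lambdaQuotient q α ω β g r ≤ N) :
    boundaryModulus q g t ≤ ENNReal.ofReal (2 / α + 1) * N * ENNReal.ofReal (lipGauge α ω β t) := by
  rw [hφ.boundaryModulus_eq]
  refine iSup₂_le fun s hs => ?_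
  have hs1 : s < 1 := hs.2.trans_lt ht.2
  have hs0 := hs.1
  have hr : 1 - s ∈ Ioo (0 : ℝ) 1 := ⟨by linarith, by linarith⟩
  have hκ := hω.lipGauge_pos α β (t := s) ⟨hs.1, hs1.le⟩
  have h1 := lintegral_integralMean_le hω hα hβ hN (t := s) ⟨hs.1, hs1.le⟩
    (fun r hr hsr => h r hr (by linarith [hs.2]))
  have h2 := (hω.lambdaQuotient_le_iff hr).1 (h (1 - s) hr (by linarith [hs.2]))
  rw [sub_sub_cancel] at h2
  calc _ ≤ 2 * (∫⁻ u in Ioo (1 - s) 1, integralMean q u (deriv g)) +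
        ENNReal.ofReal s * integralMean q (1 - s) (deriv g) :=
        hφ.circleMean_shift_sub_le hg hq ⟨hr.1.le, hr.2⟩ hs.1.le
    _ ≤ 2 * (N * ENNReal.ofReal (lipGauge α ω β s / α)) +
        ENNReal.ofReal s * (N * ENNReal.ofReal (lipGauge α ω β s / s)) := by gcongr
    _ = N * ENNReal.ofReal ((2 / α + 1) * lipGauge α ω β s) := by
        have e : (2 / α + 1) * lipGauge α ω β s =
            2 * (lipGauge α ω β s / α) + s * (lipGauge α ω β s / s) := by field_simp
        rw [e, ENNReal.ofReal_add (by positivity) (by positivity), ENNReal.ofReal_mul zero_le_two,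
          ENNReal.ofReal_mul hs.1.le, ENNReal.ofReal_ofNat]
        ring
    _ ≤ N * ENNReal.ofReal ((2 / α + 1) * lipGauge α ω β t) := by
        gcongr
        exact hω.lipGauge_le hα.le hβ hs.1 hs.2 ht.2.le
    _ = _ := by
        rw [ENNReal.ofReal_mul (by positivity)]; ring

theorem memHardy_of_lambdaQuotient_le (hg : AnalyticInDisc g) (hq : 1 < q) (hω : IsRadialWeight ω)
    {α β : ℝ} (hα : 0 < α) (hβ : 0 ≤ β) {N : ℝ≥0∞} (hN : N ≠ ∞)
    (h : ∀ r ∈ Ioo (0 : ℝ) 1, lambdaQuotient q α ω β g r ≤ N) : MemHardy q g := by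
  have hq0 : 0 < q := by linarith
  have htail : ∀ t ∈ Ioc (0 : ℝ) 1, ∫⁻ u in Ioo (1 - t) 1, integralMean q u (deriv g) ≤
      N * ENNReal.ofReal (lipGauge α ω β t / α) := fun t ht =>
    lintegral_integralMean_le hω hα hβ hN ht fun r hr _ => h r hr
  set B : ℝ≥0∞ := ‖g 0‖ₑ + N * ENNReal.ofReal (lipGauge α ω β 1 / α) with hB
  have hBt : B ≠ ∞ := ENNReal.add_ne_top.2 ⟨by simp, ENNReal.mul_ne_top hN ENNReal.ofReal_ne_top⟩
  have hMB : ∀ r ∈ Ico (0 : ℝ) 1, integralMean q r g ≤ B := fun r hr => by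
    refine (integralMean_le_lintegral hg hq hr).trans ?_
    have := htail 1 (by simp)
    rw [sub_self] at this
    exact add_le_add le_rfl this
  have hev : ∀ᶠ r : ℝ in 𝓝[<] 1, integralMean q r g ≤ B := by
    filter_upwards [Ioo_mem_nhdsLT (show (0 : ℝ) < 1 by norm_num)] with r hr
    exact hMB r ⟨hr.1.le, hr.2⟩
  obtain ⟨φ, hφ⟩ := exists_isBoundaryFunction hg hq hBt hev
  have hφB := hφ.circleMean_le hg hq0 hev
  have hφt : circleMean q φ ≠ ∞ := ne_top_of_le_ne_top hBt hφB
  -- The Hardy space asks for a limit of the means: it is the mean of φ, since φ and the dilate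
  -- differ in mean by at most ∫_r^1 M_q(u,g') du → 0.
  refine ⟨hg, circleMean q φ, hφt.lt_top, ?_⟩
  have ht0 : Tendsto (fun r : ℝ => ∫⁻ u in Ioo r 1, integralMean q u (deriv g)) (𝓝[<] 1) (𝓝 0) := by
    have h1 : Tendsto (fun r : ℝ => N * ENNReal.ofReal ((1 - r) ^ α * tailIntegral ω 0 ^ β / α))
        (𝓝[<] 1) (𝓝 0) := by
      have h2 : Tendsto (fun r : ℝ => (1 - r) ^ α * tailIntegral ω 0 ^ β / α) (𝓝[<] 1) (𝓝 0) := by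
        have h3 : ContinuousAt (fun r : ℝ => (1 - r) ^ α * tailIntegral ω 0 ^ β / α) 1 :=
          (((continuousAt_const.sub continuousAt_id).rpow_const (Or.inr hα.le)).mul
            continuousAt_const).div_const _
        have h4 := h3.tendsto
        simp only [sub_self, Real.zero_rpow hα.ne', zero_mul, zero_div] at h4
        exact h4.mono_left nhdsWithin_le_nhds
      have h5 := ENNReal.Tendsto.const_mul (ENNReal.tendsto_ofReal h2) (a := N) (Or.inr hN)
      rwa [ENNReal.ofReal_zero, mul_zero] at h5
    refine tendsto_of_tendsto_of_tendsto_of_le_of_le' tendsto_const_nhds h1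
      (Eventually.of_forall fun _ => zero_le) ?_
    filter_upwards [Ioo_mem_nhdsLT (show (0 : ℝ) < 1 by norm_num)] with r hr
    have h2 := htail (1 - r) ⟨by linarith [hr.2], by linarith [hr.1]⟩
    rw [sub_sub_cancel] at h2
    refine h2.trans ?_
    have h6 : 0 ≤ (1 - r) ^ α := Real.rpow_nonneg (by linarith [hr.2]) _
    have h7 := hω.tailIntegral_le le_rfl hr.1.le hr.2.le
    have h8 := hω.tailIntegral_pos (r := r) ⟨hr.1.le, hr.2⟩
    rw [lipGauge, sub_sub_cancel]
    gcongr
  rw [ENNReal.tendsto_nhds hφt]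
  intro ε hε
  filter_upwards [ENNReal.tendsto_nhds_zero.1 ht0 ε hε,
    Ioo_mem_nhdsLT (show (0 : ℝ) < 1 by norm_num)] with r hr1 hr2
  have hr3 : r ∈ Ico (0 : ℝ) 1 := ⟨hr2.1.le, hr2.2⟩
  have hm := hg.measurable_circleMap hr3
  have h1 := (hφ.circleMean_sub_radial_le hg hq hr3).trans hr1
  have h2 : circleMean q φ ≤ circleMean q (fun θ => φ θ - g (circleMap 0 r θ)) + integralMean q r g := by
    have := circleMean_add_le hq.le (hφ.measurable.sub hm) hm
    simpa [integralMean_eq] using! this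
  have h3 : integralMean q r g ≤ circleMean q φ + circleMean q (fun θ => φ θ - g (circleMap 0 r θ)) := by
    have := circleMean_sub_le hq.le hφ.measurable (hφ.measurable.sub hm)
    simpa [integralMean_eq] using! this
  refine ⟨tsub_le_iff_left.2 (h2.trans (by gcongr)), h3.trans (by gcongr)⟩

/-- The estimate of `M_q(r, g')` through the modulus of continuity of the boundary function. -/
theorem exists_lambdaQuotient_le (hp : 1 < p) (hq : 1 < q) (hη₀ : 0 ≤ η) (hη : η < 1 / p)
    (hω : IsRadialWeight ω) (hM : MuckenhouptCondition p ω) : ∃ K : ℝ, 0 < K ∧ ∀ g φ,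
      AnalyticInDisc g → IsBoundaryFunction g φ → ∀ N : ℝ≥0∞, N ≠ ∞ → ∀ X : ℝ≥0∞,
      (∀ t ∈ Ioo (0 : ℝ) 1,
        boundaryModulus q g t ≤ N * ENNReal.ofReal (lipGauge (1 / p) ω η t) +
          X * ENNReal.ofReal (t ^ 2)) → ∀ r ∈ Ioo (0 : ℝ) 1,
      integralMean q r (deriv g) ≤
        ENNReal.ofReal K * N * ENNReal.ofReal (lipGauge (1 / p) ω η (1 - r) / (1 - r)) +
          52 * X := by
  obtain ⟨K, hK, h⟩ := hM.exists_lintegral_min_le hp hη₀ hη hω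
  obtain ⟨c, hc, h'⟩ := hM.exists_le_lipGauge (η := η) hp hη₀ hω
  have hp0 : 0 < p := by linarith
  have hκ := hω.lipGauge_pos (1 / p) η (t := 4 / 5) (by norm_num)
  -- 4K comes from the kernel integral. The rest absorbs the modulus at 4/5, because κ(δ)/δ ≥ c.
  refine ⟨4 * K + 48 * (lipGauge (1 / p) ω η (4 / 5) / c), by positivity,
    fun g φ hg hφ N hN X hD r hr => ?_⟩
  set δ := 1 - r with hδ
  have hδ1 : δ ∈ Ioo (0 : ℝ) 1 := ⟨by linarith [hr.2], by linarith [hr.1]⟩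
  have hδ0 := hδ1.1
  have hκδ := hω.lipGauge_pos (1 / p) η (t := δ) ⟨hδ1.1, hδ1.2.le⟩
  have h1 : c ≤ lipGauge (1 / p) ω η δ / δ := by
    refine le_trans ?_ (h' δ hδ1)
    refine le_mul_of_one_le_right hc.le
      (Real.one_le_rpow_of_pos_of_le_one_of_nonpos hδ1.1 hδ1.2.le ?_)
    have : 0 ≤ (p - 1) * (1 / p - η) := mul_nonneg (by linarith) (by linarith)
    linarith
  have hI : ∫⁻ t in Ioo 0 1, boundaryModulus q g t * ENNReal.ofReal (min (δ ^ 2)⁻¹ (t ^ 2)⁻¹) ≤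
      N * ENNReal.ofReal (K * (lipGauge (1 / p) ω η δ / δ)) + X := by
    -- The factor t² cancels the t^{-2} of the kernel, so the X term costs a constant independent of
    -- r; with the term at 4/5 it totals 4 + 48 = 52.
    calc _ ≤ ∫⁻ t in Ioo 0 1, (X + N * (ENNReal.ofReal (lipGauge (1 / p) ω η t) *
          ENNReal.ofReal (min (δ ^ 2)⁻¹ (t ^ 2)⁻¹))) := by
          refine setLIntegral_mono' measurableSet_Ioo fun t ht => ?_
          have ht2 : 0 < t ^ 2 := pow_pos ht.1 2
          calc _ ≤ (N * ENNReal.ofReal (lipGauge (1 / p) ω η t) + X * ENNReal.ofReal (t ^ 2)) *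
                ENNReal.ofReal (min (δ ^ 2)⁻¹ (t ^ 2)⁻¹) := by gcongr; exact hD t ht
            _ = X * (ENNReal.ofReal (t ^ 2) * ENNReal.ofReal (min (δ ^ 2)⁻¹ (t ^ 2)⁻¹)) +
                N * (ENNReal.ofReal (lipGauge (1 / p) ω η t) *
                  ENNReal.ofReal (min (δ ^ 2)⁻¹ (t ^ 2)⁻¹)) := by ring
            _ ≤ _ := by
              gcongr
              refine mul_le_of_le_one_right' ?_
              rw [← ENNReal.ofReal_mul ht2.le]
              refine ENNReal.ofReal_le_one.2 ?_
              calc _ ≤ t ^ 2 * (t ^ 2)⁻¹ := by gcongr; exact min_le_right _ _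
                _ = 1 := mul_inv_cancel₀ ht2.ne'
      _ ≤ X + N * ENNReal.ofReal (K * (lipGauge (1 / p) ω η δ / δ)) := by
          rw [lintegral_add_left measurable_const, lintegral_const_mul' _ _ hN]
          refine add_le_add ?_ (by gcongr; exact h δ hδ1)
          rw [setLIntegral_const, Real.volume_Ioo]; simp
      _ = _ := add_comm _ _
  have h45 : boundaryModulus q g (4 / 5) ≤
      N * ENNReal.ofReal (lipGauge (1 / p) ω η (4 / 5) / c * (lipGauge (1 / p) ω η δ / δ)) + X := by
    refine (hD (4 / 5) (by norm_num)).trans (add_le_add ?_ ?_)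
    · gcongr
      calc lipGauge (1 / p) ω η (4 / 5) = lipGauge (1 / p) ω η (4 / 5) / c * c := by field_simp
        _ ≤ _ := by gcongr
    · exact mul_le_of_le_one_right' (ENNReal.ofReal_le_one.2 (by norm_num))
  calc _ ≤ _ := hφ.integralMean_deriv_le_boundaryModulus hg hq hr
    _ ≤ 4 * (N * ENNReal.ofReal (K * (lipGauge (1 / p) ω η δ / δ)) + X) +
        48 * (N * ENNReal.ofReal (lipGauge (1 / p) ω η (4 / 5) / c * (lipGauge (1 / p) ω η δ / δ)) +
          X) := by gcongr
    _ = N * (4 * ENNReal.ofReal (K * (lipGauge (1 / p) ω η δ / δ)) +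
        48 * ENNReal.ofReal (lipGauge (1 / p) ω η (4 / 5) / c * (lipGauge (1 / p) ω η δ / δ))) +
        52 * X := by ring
    _ = _ := by
        rw [mul_comm (ENNReal.ofReal (4 * K + _)) N, mul_assoc N, ← ENNReal.ofReal_mul (by positivity)]
        congr 2
        rw [add_mul, ENNReal.ofReal_add (by positivity) (by positivity), mul_assoc 4 K, mul_assoc 48,
          ENNReal.ofReal_mul (by norm_num : (0 : ℝ) ≤ 4), ENNReal.ofReal_mul (by norm_num : (0 : ℝ) ≤ 48)]
        norm_num

/-- Away from 0 the modulus is at most twice the H^q bound while the increasing gauge is bounded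
below. -/
theorem exists_boundaryModulus_le (hg : MemHardy q g) (hq : 1 < q) (hω : IsRadialWeight ω) {α β : ℝ}
    (hα : 0 ≤ α) (hβ : 0 ≤ β) {C : ℝ≥0∞} (hC : C ≠ ∞)
    (h : ∀ᶠ t in 𝓝[>] (0 : ℝ), boundaryModulus q g t ≤ C * ENNReal.ofReal (lipGauge α ω β t)) :
    ∃ N : ℝ≥0∞, N ≠ ∞ ∧ ∀ t ∈ Ioo (0 : ℝ) 1,
      boundaryModulus q g t ≤ N * ENNReal.ofReal (lipGauge α ω β t) := by
  obtain ⟨B, hB, hBe⟩ := hg.eventually_le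
  obtain ⟨φ, hφ⟩ := exists_isBoundaryFunction hg.1 hq hB hBe
  have hφB := hφ.circleMean_le hg.1 (by linarith) hBe
  obtain ⟨t₀', ht₀', hsub⟩ := (mem_nhdsGT_iff_exists_Ioo_subset' (show (0 : ℝ) < 1 by norm_num)).1 h
  set t₀ := min t₀' (1 / 2) with ht₀
  have ht₀0 : 0 < t₀ := lt_min ht₀' (by norm_num)
  have ht₀1 : t₀ ≤ 1 / 2 := min_le_right _ _
  have hκ := hω.lipGauge_pos α β (t := t₀) ⟨ht₀0, by linarith⟩
  have hκ' := ENNReal.ofReal_pos.2 hκ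
  refine ⟨max C ((B + B) / ENNReal.ofReal (lipGauge α ω β t₀)), ?_, fun t ht => ?_⟩
  · exact (max_lt hC.lt_top (ENNReal.div_lt_top (ENNReal.add_ne_top.2 ⟨hB, hB⟩) hκ'.ne')).ne
  · rcases lt_or_ge t t₀ with h1 | h1
    · exact (hsub ⟨ht.1, h1.trans_le (min_le_left _ _)⟩ : boundaryModulus q g t ≤ _).trans
        (by gcongr; exact le_max_left _ _)
    · have h2 : boundaryModulus q g t ≤ B + B := by
        rw [hφ.boundaryModulus_eq]
        refine iSup₂_le fun s _ => ?_
        refine (circleMean_sub_le hq.le (hφ.measurable.comp (measurable_add_const s))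
          hφ.measurable).trans (add_le_add ?_ hφB)
        exact (circleMean_add hφ.periodic s).trans_le hφB
      calc _ ≤ B + B := h2
        _ = (B + B) / ENNReal.ofReal (lipGauge α ω β t₀) * ENNReal.ofReal (lipGauge α ω β t₀) :=
            (ENNReal.div_mul_cancel hκ'.ne' ENNReal.ofReal_ne_top).symm
        _ ≤ _ := by
            gcongr
            · exact le_max_right _ _
            · exact hω.lipGauge_le hα hβ ht₀0 h1 ht.2.le

/-- Near the circle the quotient is at most 1; on a compact disc g' is bounded and κ(δ)/δ is bounded
below. -/
theorem MemLittleLambda.exists_le {α β : ℝ} (hα : 0 ≤ α) (hβ : 0 ≤ β) (hq : 0 < q)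
    (hω : IsRadialWeight ω) (hg : MemLittleLambda q α ω β g) :
    ∃ N : ℝ≥0∞, N ≠ ∞ ∧ ∀ r ∈ Ioo (0 : ℝ) 1, lambdaQuotient q α ω β g r ≤ N := by
  obtain ⟨hg, h⟩ := hg
  have h1 : ∀ᶠ r : ℝ in 𝓝[<] 1, lambdaQuotient q α ω β g r ≤ 1 := by
    filter_upwards [h.eventually_lt_const one_pos] with r hr using hr.le
  obtain ⟨r', hr', hsub⟩ := (mem_nhdsLT_iff_exists_Ioo_subset' (show (0 : ℝ) < 1 by norm_num)).1 h1
  set r₀ := max r' (1 / 2) with hr₀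
  have hr₀1 : r₀ < 1 := max_lt hr' (by norm_num)
  have hr₀0 : 1 / 2 ≤ r₀ := le_max_right _ _
  obtain ⟨A, hA⟩ := (isCompact_closedBall (0 : ℂ) r₀).exists_bound_of_continuousOn
    (hg.deriv.continuousOn.mono (Metric.closedBall_subset_ball hr₀1))
  have hA0 : 0 ≤ A := (norm_nonneg _).trans (hA 0 (by simp; linarith))
  have hκ := hω.lipGauge_pos α β (t := 1 - r₀) ⟨by linarith, by linarith⟩
  refine ⟨max 1 (ENNReal.ofReal (A / lipGauge α ω β (1 - r₀))),
    (max_lt ENNReal.one_lt_top ENNReal.ofReal_lt_top).ne, fun r hr => ?_⟩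
  rcases lt_or_ge r₀ r with h2 | h2
  · exact (hsub ⟨(le_max_left _ _).trans_lt h2, hr.2⟩ : lambdaQuotient q α ω β g r ≤ 1).trans
      (le_max_left _ _)
  · refine le_trans ?_ (le_max_right _ _)
    have hr1 : 0 < 1 - r := by linarith [hr.2]
    rw [hω.lambdaQuotient_le_iff hr, ← ENNReal.ofReal_mul (by positivity), integralMean_eq]
    refine circleMean_le_of_enorm_le hq fun θ => ?_
    rw [← ofReal_norm]
    refine ENNReal.ofReal_le_ofReal ?_
    have h3 := hω.lipGauge_le hα hβ (s := 1 - r₀) (t := 1 - r) (by linarith) (by linarith)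
      (by linarith [hr.1])
    calc _ ≤ A := hA _ (by simp [abs_of_pos hr.1, h2])
      _ = A / lipGauge α ω β (1 - r₀) * lipGauge α ω β (1 - r₀) := by field_simp
      _ ≤ A / lipGauge α ω β (1 - r₀) * (lipGauge α ω β (1 - r) / (1 - r)) := by
          gcongr
          refine h3.trans (le_div_self (hκ.le.trans h3) hr1 (by linarith [hr.1]))

/-- Strictness of η < 1/p makes κ(δ)/δ tend to infinity, so bounded contributions are negligible for
the little-o statement. -/
theorem MuckenhouptCondition.tendsto_div_lipGauge (hp : 1 < p) (hη₀ : 0 ≤ η) (hη : η < 1 / p)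
    (hω : IsRadialWeight ω) (hM : MuckenhouptCondition p ω) {X : ℝ≥0∞} (hX : X ≠ ∞) :
    Tendsto (fun r : ℝ => X / ENNReal.ofReal (lipGauge (1 / p) ω η (1 - r) / (1 - r))) (𝓝[<] 1)
      (𝓝 0) := by
  obtain ⟨c, hc, h⟩ := hM.exists_le_lipGauge (η := η) hp hη₀ hω
  set κ := (p - 1) * (1 / p - η) with hκ
  have hκ0 : 0 < κ := mul_pos (by linarith) (by linarith)
  have h1 : Tendsto (fun r : ℝ => X * ENNReal.ofReal (c⁻¹ * (1 - r) ^ κ)) (𝓝[<] 1) (𝓝 0) := by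
    have h2 : ContinuousAt (fun r : ℝ => c⁻¹ * (1 - r) ^ κ) 1 :=
      continuousAt_const.mul ((continuousAt_const.sub continuousAt_id).rpow_const (Or.inr hκ0.le))
    have h3 := h2.tendsto
    simp only [sub_self, Real.zero_rpow hκ0.ne', mul_zero] at h3
    have h4 := ENNReal.Tendsto.const_mul (ENNReal.tendsto_ofReal
      (h3.mono_left (nhdsWithin_le_nhds (s := Iio 1)))) (a := X) (Or.inr hX)
    rwa [ENNReal.ofReal_zero, mul_zero] at h4
  refine tendsto_of_tendsto_of_tendsto_of_le_of_le' tendsto_const_nhds h1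
    (Eventually.of_forall fun _ => zero_le) ?_
  filter_upwards [Ioo_mem_nhdsLT (show (0 : ℝ) < 1 by norm_num)] with r hr
  have hδ0 : 0 < 1 - r := by linarith [hr.2]
  have h5 := h (1 - r) ⟨hδ0, by linarith [hr.1]⟩
  have h6 := Real.rpow_pos_of_pos hδ0 κ
  rw [Real.rpow_neg hδ0.le] at h5
  have h7 : 0 < lipGauge (1 / p) ω η (1 - r) / (1 - r) := lt_of_lt_of_le (by positivity) h5
  rw [div_eq_mul_inv X, ← ENNReal.ofReal_inv_of_pos h7]
  gcongr
  calc _ ≤ (c * ((1 - r) ^ κ)⁻¹)⁻¹ := inv_anti₀ (by positivity) h5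
    _ = _ := by rw [mul_inv, inv_inv]

end Main

/-! ### The two characterizations and the comparison of norms. -/

section Characterization

variable {p q η : ℝ} {ω : ℝ → ℝ} {g : ℂ → ℂ}

theorem MemHardy.exists_isBoundaryFunction (hg : MemHardy q g) (hq : 1 < q) :
    ∃ φ, IsBoundaryFunction g φ := by
  obtain ⟨B, hB, hBe⟩ := hg.eventually_le
  exact _root_.exists_isBoundaryFunction hg.1 hq hB hBe

theorem lambdaNorm_lt_top_iff {α β : ℝ} : lambdaNorm q α ω β g < ∞ ↔
    ∃ N : ℝ≥0∞, N ≠ ∞ ∧ ∀ r ∈ Ioo (0 : ℝ) 1, lambdaQuotient q α ω β g r ≤ N := by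
  constructor
  · intro h
    exact ⟨_, (lt_of_le_of_lt le_self_add h).ne, fun r hr =>
      le_iSup₂ (f := fun r (_ : r ∈ Ioo (0 : ℝ) 1) => lambdaQuotient q α ω β g r) r hr⟩
  · rintro ⟨N, hN, h⟩
    exact (add_le_add (iSup₂_le h) le_rfl).trans_lt
      (ENNReal.add_lt_top.2 ⟨hN.lt_top, enorm_lt_top⟩)

theorem memLambda_iff (hp : 1 < p) (hq : 1 < q) (hη₀ : 0 ≤ η) (hη : η < 1 / p)
    (hω : IsRadialWeight ω) (hM : MuckenhouptCondition p ω) (hg : AnalyticInDisc g) :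
    MemLambda q (1 / p) ω η g ↔ MemHardy q g ∧ ∃ C : ℝ, 0 < C ∧ ∀ᶠ t in 𝓝[>] (0 : ℝ),
      boundaryModulus q g t ≤ ENNReal.ofReal (C * lipGauge (1 / p) ω η t) := by
  have hα : 0 < 1 / p := by positivity
  constructor
  · rintro ⟨-, h⟩
    obtain ⟨N, hN, hNr⟩ := lambdaNorm_lt_top_iff.1 h
    have hH := memHardy_of_lambdaQuotient_le hg hq hω hα hη₀ hN hNr
    obtain ⟨φ, hφ⟩ := hH.exists_isBoundaryFunction hq
    refine ⟨hH, (2 / (1 / p) + 1) * (N.toReal + 1), by positivity, ?_⟩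
    filter_upwards [Ioo_mem_nhdsGT (show (0 : ℝ) < 1 by norm_num)] with t ht
    refine (boundaryModulus_le_of_lambdaQuotient_le hφ hg hq hω hα hη₀ hN ht
      fun r hr _ => hNr r hr).trans ?_
    rw [ENNReal.ofReal_mul (by positivity), ENNReal.ofReal_mul (by positivity)]
    gcongr
    rw [ENNReal.le_ofReal_iff_toReal_le hN (by positivity)]
    linarith
  · rintro ⟨hH, C, hC, hD⟩
    obtain ⟨φ, hφ⟩ := hH.exists_isBoundaryFunction hq
    obtain ⟨K, -, hK⟩ := exists_lambdaQuotient_le hp hq hη₀ hη hω hM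
    simp only [ENNReal.ofReal_mul hC.le] at hD
    obtain ⟨N, hN, hNt⟩ :=
      exists_boundaryModulus_le hH hq hω hα.le hη₀ ENNReal.ofReal_ne_top hD
    refine ⟨hg, lambdaNorm_lt_top_iff.2 ⟨ENNReal.ofReal K * N,
      ENNReal.mul_ne_top ENNReal.ofReal_ne_top hN, fun r hr => ?_⟩⟩
    rw [hω.lambdaQuotient_le_iff hr]
    simpa using hK g φ hg hφ N hN 0 (by simpa using hNt) r hr

theorem exists_lambdaNorm_le_and_le (hp : 1 < p) (hq : 1 < q) (hη₀ : 0 ≤ η) (hη : η < 1 / p)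
    (hω : IsRadialWeight ω) (hM : MuckenhouptCondition p ω) :
    ∃ C : ℝ, 0 < C ∧ ∀ g : ℂ → ℂ, MemHardy q g →
      lambdaNorm q (1 / p) ω η g ≤
        ENNReal.ofReal C *
          (‖g 0‖ₑ + ⨆ t ∈ Ioo (0 : ℝ) 1, modulusQuotient q (1 / p) ω η g t) ∧
      ‖g 0‖ₑ + (⨆ t ∈ Ioo (0 : ℝ) 1, modulusQuotient q (1 / p) ω η g t) ≤
        ENNReal.ofReal C * lambdaNorm q (1 / p) ω η g := by
  have hα : 0 < 1 / p := by positivity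
  obtain ⟨K, hK0, hK⟩ := exists_lambdaQuotient_le hp hq hη₀ hη hω hM
  -- K serves the first inequality and 2p+1 the second; C ≥ 1 takes care of |g(0)|.
  set C : ℝ := K + (2 / (1 / p) + 1) with hCdef
  have hC2 : 2 / (1 / p) + 1 ≤ C := by linarith
  have hC1 : 1 ≤ ENNReal.ofReal C := by
    have : 0 < 2 / (1 / p) := by positivity
    exact ENNReal.one_le_ofReal.2 (by linarith)
  have hCK : K ≤ C := by
    have : 0 < 2 / (1 / p) := by positivity
    linarith
  refine ⟨C, by positivity, fun g hH => ?_⟩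
  obtain ⟨φ, hφ⟩ := hH.exists_isBoundaryFunction hq
  have hg := hH.1
  constructor
  · set Q := ⨆ t ∈ Ioo (0 : ℝ) 1, modulusQuotient q (1 / p) ω η g t with hQ
    rcases eq_or_ne Q ∞ with hQt | hQt
    · rw [hQt, add_top, ENNReal.mul_top (zero_lt_one.trans_le hC1).ne']
      exact le_top
    have hD : ∀ t ∈ Ioo (0 : ℝ) 1,
        boundaryModulus q g t ≤ Q * ENNReal.ofReal (lipGauge (1 / p) ω η t) := fun t ht =>
      (hω.modulusQuotient_le_iff ht).1
        (le_iSup₂ (f := fun t (_ : t ∈ Ioo (0 : ℝ) 1) => modulusQuotient q (1 / p) ω η g t) t ht)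
    rw [lambdaNorm, add_comm, mul_add]
    refine add_le_add (le_mul_of_one_le_left' hC1) (iSup₂_le fun r hr => ?_)
    rw [hω.lambdaQuotient_le_iff hr]
    have h := hK g φ hg hφ Q hQt 0 (by simpa using hD) r hr
    rw [mul_zero, add_zero] at h
    exact h.trans (by gcongr)
  · set N := ⨆ r ∈ Ioo (0 : ℝ) 1, lambdaQuotient q (1 / p) ω η g r with hN
    rw [lambdaNorm, ← hN, add_comm N, mul_add]
    refine add_le_add (le_mul_of_one_le_left' hC1) ?_
    rcases eq_or_ne N ∞ with hNt | hNt
    · rw [hNt, ENNReal.mul_top (zero_lt_one.trans_le hC1).ne']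
      exact le_top
    refine iSup₂_le fun t ht => ?_
    rw [hω.modulusQuotient_le_iff ht]
    refine (boundaryModulus_le_of_lambdaQuotient_le hφ hg hq hω hα hη₀ hNt ht fun r hr _ =>
      le_iSup₂ (f := fun r (_ : r ∈ Ioo (0 : ℝ) 1) => lambdaQuotient q (1 / p) ω η g r) r hr).trans ?_
    gcongr

theorem memLittleLambda_iff (hp : 1 < p) (hq : 1 < q) (hη₀ : 0 ≤ η) (hη : η < 1 / p)
    (hω : IsRadialWeight ω) (hM : MuckenhouptCondition p ω) (hg : AnalyticInDisc g) :
    MemLittleLambda q (1 / p) ω η g ↔ MemHardy q g ∧ ∀ ε : ℝ, 0 < ε → ∀ᶠ t in 𝓝[>] (0 : ℝ),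
      boundaryModulus q g t ≤ ENNReal.ofReal (ε * lipGauge (1 / p) ω η t) := by
  have hα : 0 < 1 / p := by positivity
  constructor
  · intro h
    obtain ⟨N, hN, hNr⟩ := h.exists_le hα.le hη₀ (by linarith) hω
    have hH := memHardy_of_lambdaQuotient_le hg hq hω hα hη₀ hN hNr
    obtain ⟨φ, hφ⟩ := hH.exists_isBoundaryFunction hq
    refine ⟨hH, fun ε hε => ?_⟩
    have hA : 0 < 2 / (1 / p) + 1 := by positivity
    have hε' : 0 < ε / (2 / (1 / p) + 1) := by positivity
    obtain ⟨r₀, hr₀, hsub⟩ := (mem_nhdsLT_iff_exists_Ioo_subset' (show (0 : ℝ) < 1 by norm_num)).1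
      (ENNReal.tendsto_nhds_zero.1 h.2 _ (ENNReal.ofReal_pos.2 hε'))
    have hr₀1 : r₀ < 1 := hr₀
    filter_upwards [Ioo_mem_nhdsGT (show (0 : ℝ) < 1 by norm_num),
      Ioo_mem_nhdsGT (show (0 : ℝ) < 1 - r₀ by linarith)] with t ht ht'
    refine (boundaryModulus_le_of_lambdaQuotient_le hφ hg hq hω hα hη₀ ENNReal.ofReal_ne_top ht
      fun r hr htr => hsub ⟨by linarith [ht'.2], hr.2⟩).trans_eq ?_
    rw [← ENNReal.ofReal_mul hA.le, mul_div_cancel₀ _ hA.ne', ENNReal.ofReal_mul hε.le]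
  · rintro ⟨hH, hD⟩
    obtain ⟨φ, hφ⟩ := hH.exists_isBoundaryFunction hq
    obtain ⟨K, hK0, hK⟩ := exists_lambdaQuotient_le hp hq hη₀ hη hω hM
    obtain ⟨N, hN, hNt⟩ := exists_boundaryModulus_le hH hq hω hα.le hη₀ (C := 1) ENNReal.one_ne_top
      (by simpa using hD 1 one_pos)
    refine ⟨hg, ENNReal.tendsto_nhds_zero.2 fun ε hε => ?_⟩
    obtain ⟨ε₁, hε₁, hε₁K⟩ : ∃ ε₁ : ℝ, 0 < ε₁ ∧ ENNReal.ofReal K * ENNReal.ofReal ε₁ ≤ ε / 2 := by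
      rcases eq_or_ne ε ∞ with rfl | hεt
      · exact ⟨1, one_pos, by simp [ENNReal.top_div]⟩
      · have h0 : 0 < ε.toReal := ENNReal.toReal_pos hε.ne' hεt
        refine ⟨ε.toReal / 2 / K, by positivity, ?_⟩
        rw [← ENNReal.ofReal_mul hK0.le, mul_div_cancel₀ _ hK0.ne',
          ENNReal.ofReal_div_of_pos two_pos, ENNReal.ofReal_toReal hεt, ENNReal.ofReal_ofNat]
    obtain ⟨u, hu, hsub⟩ := (mem_nhdsGT_iff_exists_Ioo_subset' (show (0 : ℝ) < 1 by norm_num)).1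
      (hD ε₁ hε₁)
    have hu0 : 0 < u := hu
    have hκ1 := hω.lipGauge_pos (1 / p) η (t := 1) (by norm_num)
    -- For t ≥ u the modulus is not small, but Nκ(t) ≤ Nκ(1) ≤ Xt²; that part contributes a
    -- constant, which is o(κ(δ)/δ).
    set X := N * ENNReal.ofReal (lipGauge (1 / p) ω η 1 / u ^ 2) with hX
    have hXt : X ≠ ∞ := ENNReal.mul_ne_top hN ENNReal.ofReal_ne_top
    have hDX : ∀ t ∈ Ioo (0 : ℝ) 1, boundaryModulus q g t ≤
        ENNReal.ofReal ε₁ * ENNReal.ofReal (lipGauge (1 / p) ω η t) + X * ENNReal.ofReal (t ^ 2) := by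
      intro t ht
      rcases lt_or_ge t u with h1 | h1
      · refine le_trans ?_ le_self_add
        rw [← ENNReal.ofReal_mul hε₁.le]
        exact hsub ⟨ht.1, h1⟩
      · refine le_trans ?_ le_add_self
        refine (hNt t ht).trans ?_
        rw [hX, mul_assoc, ← ENNReal.ofReal_mul (by positivity)]
        gcongr
        calc _ ≤ lipGauge (1 / p) ω η 1 := hω.lipGauge_le hα.le hη₀ ht.1 ht.2.le le_rfl
          _ = lipGauge (1 / p) ω η 1 / u ^ 2 * u ^ 2 := by field_simp
          _ ≤ _ := by gcongr
    have ht := hM.tendsto_div_lipGauge hp hη₀ hη hω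
      (ENNReal.mul_ne_top (by norm_num : (52 : ℝ≥0∞) ≠ ∞) hXt)
    filter_upwards [ENNReal.tendsto_nhds_zero.1 ht (ε / 2) (ENNReal.half_pos hε.ne'),
      Ioo_mem_nhdsLT (show (0 : ℝ) < 1 by norm_num)] with r hr1 hr
    have hδ : 0 < 1 - r := by linarith [hr.2]
    have hκ := hω.lipGauge_pos (1 / p) η (t := 1 - r) ⟨hδ, by linarith [hr.1]⟩
    rw [ENNReal.div_le_iff (ENNReal.ofReal_pos.2 (div_pos hκ hδ)).ne' ENNReal.ofReal_ne_top] at hr1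
    rw [hω.lambdaQuotient_le_iff hr]
    calc _ ≤ _ := hK g φ hg hφ _ ENNReal.ofReal_ne_top X hDX r hr
      _ ≤ ε / 2 * ENNReal.ofReal (lipGauge (1 / p) ω η (1 - r) / (1 - r)) +
          ε / 2 * ENNReal.ofReal (lipGauge (1 / p) ω η (1 - r) / (1 - r)) := by gcongr
      _ = _ := by rw [← add_mul, ENNReal.add_halves]

end Characterization

theorem mainTheorem9 (p q η : ℝ) (hp : 1 < p) (hq : 1 < q) (hη₀ : 0 ≤ η) (hη : η < 1 / p)
    (ω : ℝ → ℝ) (hω : IsRegularWeight ω) (hM : MuckenhouptCondition p ω) :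
    -- (i): membership in the big Lipschitz space
    (∀ g : ℂ → ℂ, AnalyticInDisc g →
      (MemLambda q (1 / p) ω η g ↔
        MemHardy q g ∧
          ∃ C : ℝ, 0 < C ∧ ∀ᶠ t in 𝓝[>] (0 : ℝ),
            boundaryModulus q g t ≤ ENNReal.ofReal (C * lipGauge (1 / p) ω η t))) ∧
    -- (i): comparability of the norms, with a constant independent of the function
    (∃ C : ℝ, 0 < C ∧ ∀ g : ℂ → ℂ, MemHardy q g →
      lambdaNorm q (1 / p) ω η g ≤
        ENNReal.ofReal C *
          (‖g 0‖ₑ + ⨆ t ∈ Ioo (0 : ℝ) 1, modulusQuotient q (1 / p) ω η g t) ∧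
      ‖g 0‖ₑ + (⨆ t ∈ Ioo (0 : ℝ) 1, modulusQuotient q (1 / p) ω η g t) ≤
        ENNReal.ofReal C * lambdaNorm q (1 / p) ω η g) ∧
    -- (ii): membership in the little Lipschitz space
    (∀ g : ℂ → ℂ, AnalyticInDisc g →
      (MemLittleLambda q (1 / p) ω η g ↔
        MemHardy q g ∧
          ∀ ε : ℝ, 0 < ε → ∀ᶠ t in 𝓝[>] (0 : ℝ),
            boundaryModulus q g t ≤ ENNReal.ofReal (ε * lipGauge (1 / p) ω η t))) := by
  have hr := hω.radialWeight
  exact ⟨fun g hg => memLambda_iff hp hq hη₀ hη hr hM hg,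
    exists_lambdaNorm_le_and_le hp hq hη₀ hη hr hM,
    fun g hg => memLittleLambda_iff hp hq hη₀ hη hr hM hg⟩
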